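/- Let $m \ge 1$ be an integer and consider the polynomials in six variables $x_0,x_1,s_0,s_1,t_0,t_1$ given by $$ Q = (x_0+x_1)(s_0+s_1)^m(t_0+t_1)^m, \qquad P_\ell = \binom{m}{\ell}\Bigl( x_0\, s_0^{\ell} s_1^{m-\ell} (t_0+t_1)^m + x_1\, t_0^{\ell} t_1^{m-\ell} (s_0+s_1)^m \Bigr), \quad \ell = 0,1,\ldots,m, $$ so that $p_\ell = P_\ell/Q$ is the probability of observing $\ell$ heads in $m$ tosses in the mixture-of-coins model $$ p_\ell = \binom{m}{\ell}\frac{x_0}{x_0+x_1}\frac{s_0^{\ell}s_1^{m-\ell}}{(s_0+s_1)^m} + \binom{m}{\ell}\frac{x_1}{x_0+x_1}\frac{t_0^{\ell}t_1^{m-\ell}}{(t_0+t_1)^m}. $$ Let $\mathcal N(f) \subset \mathbb R^6$ denote the Newton polytope of $f$, i.e. the convex hull of the exponent vectors of the monomials of $f$. Then the Minkowski sum $$ \mathcal N(Q) + \mathcal N(P_0) + \mathcal N(P_1) + \cdots + \mathcal N(P_m) $$ is a $3$-dimensional polytope with $8(m+1)$ vertices, $14m+12$ edges and $6(m+1)$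 facets. The polytope $\mathcal N(Q)$ is, up to an affine change of coordinates, a $3$-cube, and each of its eight vertices $v$ is a summand of exactly $m+1$ vertices $u$ of the Minkowski sum (that is, $u = v + p_0 + \cdots + p_m$ with $p_\ell \in \mathcal N(P_\ell)$). Among the $6(m+1)$ facets, four are pentagons, two are $2(m+1)$-gons, and the remaining ones are quadrilaterals. -/

import Mathlib

open scoped Pointwise

noncomputable section

/-- The Newton polytope of a polynomial: the convex hull, in the real space with one coordinate for
each variable, of the exponent vectors of the monomials that occur with nonzero coefficient. -/
def newtonPolytope {σ R : Type*} [CommSemiring R] (f : MvPolynomial σ R) : Set (σ → ℝ) :=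
  convexHull ℝ ((fun (a : σ →₀ ℕ) (i : σ) => (a i : ℝ)) '' (f.support : Set (σ →₀ ℕ)))

section Polytopes

variable {E : Type*} [AddCommGroup E] [Module ℝ E] [TopologicalSpace E]

/-- The dimension of a (nonempty) convex set: the dimension of its affine span. -/
def polyDim (P : Set E) : ℕ := Module.finrank ℝ (vectorSpan ℝ P)

/-- The nonempty faces of a polytope `P`: the sets of points of `P` at which some linear functional
attains its maximum over `P` (for the zero functional this is `P` itself). -/
def polyFaces (P : Set E) : Set (Set E) := {F | F.Nonempty ∧ IsExposed ℝ P F}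

/-- The vertices of a polytope `P`: the points `v` such that `{v}` is a face of `P`. -/
def polyVertices (P : Set E) : Set E := {v | {v} ∈ polyFaces P}

/-- The edges of a polytope: its faces of dimension one. -/
def polyEdges (P : Set E) : Set (Set E) := {F ∈ polyFaces P | polyDim F = 1}

/-- The facets of a polytope: its faces of codimension one. -/
def polyFacets (P : Set E) : Set (Set E) := {F ∈ polyFaces P | polyDim F + 1 = polyDim P}

/-- `F` is a convex `k`-gon: a two-dimensional polytope with exactly `k` vertices. -/
def IsConvexPolygon (k : ℕ) (F : Set E) : Prop :=
  (∃ S : Set E, S.Finite ∧ F = convexHull ℝ S) ∧ polyDim F = 2 ∧ (polyVertices F).ncard = k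

/-- `C` is a 3-cube up to an affine change of coordinates. -/
def IsAffineCube (C : Set E) : Prop :=
  ∃ φ : (Fin 3 → ℝ) →ᵃ[ℝ] E, Function.Injective φ ∧ φ '' Set.Icc 0 1 = C

end Polytopes

section Coins

open MvPolynomial

/-! The six variables `x₀, x₁, s₀, s₁, t₀, t₁` are `X 0, X 1, X 2, X 3, X 4, X 5`. -/

/-- The common denominator `Q = (x₀ + x₁) (s₀ + s₁)^m (t₀ + t₁)^m` of the mixture-of-coins model
with `m` coin tosses. -/
def coinQ (m : ℕ) : MvPolynomial (Fin 6) ℂ :=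
  (X 0 + X 1) * (X 2 + X 3) ^ m * (X 4 + X 5) ^ m

/-- The numerator `P_ℓ` of the probability
`p_ℓ = binom(m,ℓ) (x₀/(x₀+x₁)) (s₀^ℓ s₁^(m-ℓ) / (s₀+s₁)^m)
     + binom(m,ℓ) (x₁/(x₀+x₁)) (t₀^ℓ t₁^(m-ℓ) / (t₀+t₁)^m)`
of observing `ℓ` heads, over the common denominator `Q`; it is meant for `0 ≤ ℓ ≤ m`. -/
def coinP (m ℓ : ℕ) : MvPolynomial (Fin 6) ℂ :=
  (Nat.choose m ℓ : MvPolynomial (Fin 6) ℂ) *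
    (X 0 * X 2 ^ ℓ * X 3 ^ (m - ℓ) * (X 4 + X 5) ^ m +
      X 1 * X 4 ^ ℓ * X 5 ^ (m - ℓ) * (X 2 + X 3) ^ m)

/-- The Minkowski sum `N(P_0) + N(P_1) + ⋯ + N(P_m)`. -/
def coinNumeratorSum (m : ℕ) : Set (Fin 6 → ℝ) :=
  ∑ ℓ ∈ Finset.range (m + 1), newtonPolytope (coinP m ℓ)

/-- The Newton polytope `N(Q) + N(P_0) + N(P_1) + ⋯ + N(P_m)` (a Minkowski sum). -/
def coinPolytope (m : ℕ) : Set (Fin 6 → ℝ) :=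
  newtonPolytope (coinQ m) + coinNumeratorSum m

end Coins

end

/-! The proof computes the normal fan of the Minkowski sum by sign vectors. On the affine space
containing the polytopes, a functional matters only through three weights `w = (u, a, b)`, its
values on the directions of `x₀`, `s₀`, `t₀`. The face of a Minkowski sum is the sum of the faces of
its summands. The face of the box `N(Q)` is given by the signs of `u`, `a`, `b`. The tetrahedron
`N(P_ℓ)` has two opposite edges, one at `x₀ = 1` and one at `x₀ = 0`, and its face is given by the
signs of `a`, `b` and of the gap between the maxima on these edges. Hence a face is the same thing
as a realizable sign vector `coinType m w`, and inclusion of faces is replacement of signs by zero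
(`coinFace_subset_iff`, `coinFace_eq_iff`).

The gap is `u + ℓ (a - b) + m (max b 0 - max a 0)`, an arithmetic progression in `ℓ`. If `u, a > 0`
its last term is positive, so the progression has one of the `2m + 1` patterns `signPattern m p`
with `p ≤ 2m`, and all of them occur (`exists_coinType_eq`, `exists_weight_of_signPattern`). Even
`p` means a sign change between consecutive indices, odd `p` a zero. Exchanging the coins and
exchanging heads with tails act on directions and reduce the remaining sign triples to a few cases,
mostly with `u = 0` or `a = 0`.

The dimension of a face is the rank of an explicit set of edge directions (`vectorSpan_coinFace`,
`finrank_faceDirection`), so summing over the 27 sign triples gives the numbers of vertices, edges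
and facets. In particular each open octant contributes `m + 1` vertices; octants are the normal
cones of the corners of the cube `N(Q)`, whence the statement on summands.

The vertices of a facet are the vertices of the polytope whose sign vectors degenerate to that of
the facet. In an octant they are indexed by the position `j` of the sign change, so each polygon is
identified by counting admissible `j` octant by octant (`octantCount_eq_ncard`). -/

theorem Set.finset_sum_nonempty {ι E : Type*} [AddCommMonoid E] (s : Finset ι) (A : ι → Set E)
    (h : ∀ i ∈ s, (A i).Nonempty) :
    (∑ i ∈ s, A i).Nonempty := by
  classical
  induction s using Finset.induction_on with
  | empty => exact ⟨0, by simp⟩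
  | insert a s ha ih =>
    rw [Finset.sum_insert ha]
    exact (h a (by simp)).add (ih fun i hi => h i (by simp [hi]))

/-! ### Directions of Minkowski sums and convex hulls. -/

section VectorSpan

variable {E : Type*} [AddCommGroup E] [Module ℝ E]

theorem vectorSpan_convexHull (S : Set E) :
    vectorSpan ℝ (convexHull ℝ S) = vectorSpan ℝ S := by
  rw [← direction_affineSpan, affineSpan_convexHull, direction_affineSpan]

theorem vectorSpan_add_of_nonempty {A B : Set E} (hA : A.Nonempty) (hB : B.Nonempty) :
    vectorSpan ℝ (A + B) = vectorSpan ℝ A ⊔ vectorSpan ℝ B := by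
  obtain ⟨a₀, ha₀⟩ := hA
  obtain ⟨b₀, hb₀⟩ := hB
  apply le_antisymm
  · rw [vectorSpan_def, Submodule.span_le]
    rintro _ ⟨_, ⟨a, ha, b, hb, rfl⟩, _, ⟨a', ha', b', hb', rfl⟩, rfl⟩
    have : (a + b) -ᵥ (a' + b') = (a -ᵥ a') + (b -ᵥ b') := by simp only [vsub_eq_sub]; abel
    simp only [this]
    exact Submodule.add_mem_sup (vsub_mem_vectorSpan ℝ ha ha') (vsub_mem_vectorSpan ℝ hb hb')
  · refine sup_le ?_ ?_ <;> rw [vectorSpan_def, Submodule.span_le]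
    · rintro _ ⟨a, ha, a', ha', rfl⟩
      have : a -ᵥ a' = (a + b₀) -ᵥ (a' + b₀) := by simp
      simp only [this]
      exact vsub_mem_vectorSpan ℝ (Set.add_mem_add ha hb₀) (Set.add_mem_add ha' hb₀)
    · rintro _ ⟨a, ha, a', ha', rfl⟩
      have : a -ᵥ a' = (a₀ + a) -ᵥ (a₀ + a') := by simp
      simp only [this]
      exact vsub_mem_vectorSpan ℝ (Set.add_mem_add ha₀ ha) (Set.add_mem_add ha₀ ha')

theorem vectorSpan_sum_of_nonempty {ι : Type*} (s : Finset ι) (A : ι → Set E)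
    (hA : ∀ i ∈ s, (A i).Nonempty) :
    vectorSpan ℝ (∑ i ∈ s, A i) = ⨆ i ∈ s, vectorSpan ℝ (A i) := by
  classical
  induction s using Finset.induction_on with
  | empty =>
    rw [Finset.sum_empty, ← Set.singleton_zero, vectorSpan_singleton]
    simp
  | insert a s ha ih =>
    have h' : ∀ i ∈ s, (A i).Nonempty := fun i hi => hA i (by simp [hi])
    have hne := Set.finset_sum_nonempty s A h'
    rw [Finset.sum_insert ha, vectorSpan_add_of_nonempty (hA a (by simp)) hne, ih h',
      Finset.iSup_insert]

end VectorSpan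

/-! ### Exposed faces of Minkowski sums and of convex hulls of finite sets. -/

section Faces

variable {E : Type*} [AddCommGroup E] [Module ℝ E] [TopologicalSpace E]

theorem mem_toExposed {l : StrongDual ℝ E} {A : Set E} {x : E} :
    x ∈ l.toExposed A ↔ x ∈ A ∧ ∀ y ∈ A, l y ≤ l x := Iff.rfl

theorem mem_polyFaces_iff {P F : Set E} :
    F ∈ polyFaces P ↔ F.Nonempty ∧ ∃ l : StrongDual ℝ E, F = l.toExposed P :=
  ⟨fun h => ⟨h.1, h.2 h.1⟩, fun h => ⟨h.1, fun _ => h.2⟩⟩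

/-- A sum `a + b` maximizes `l` exactly when both terms do, since either term can be varied with the
other fixed. -/
theorem toExposed_add (l : StrongDual ℝ E) (A B : Set E) :
    l.toExposed (A + B) = l.toExposed A + l.toExposed B := by
  ext x
  simp only [Set.mem_add, mem_toExposed]
  constructor
  · rintro ⟨⟨a, ha, b, hb, rfl⟩, h⟩
    refine ⟨a, ⟨ha, fun y hy => ?_⟩, b, ⟨hb, fun y hy => ?_⟩, rfl⟩
    · have := h (y + b) ⟨y, hy, b, hb, rfl⟩
      simp only [map_add] at this
      linarith
    · have := h (a + y) ⟨a, ha, y, hy, rfl⟩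
      simp only [map_add] at this
      linarith
  · rintro ⟨a, ⟨ha, ha'⟩, b, ⟨hb, hb'⟩, rfl⟩
    refine ⟨⟨a, ha, b, hb, rfl⟩, ?_⟩
    rintro _ ⟨a', h1, b', h2, rfl⟩
    simp only [map_add]
    exact add_le_add (ha' _ h1) (hb' _ h2)

theorem toExposed_sum {ι : Type*} (l : StrongDual ℝ E) (s : Finset ι) (A : ι → Set E) :
    l.toExposed (∑ i ∈ s, A i) = ∑ i ∈ s, l.toExposed (A i) := by
  classical
  induction s using Finset.induction_on with
  | empty =>
    ext x
    simp only [Finset.sum_empty, mem_toExposed, Set.mem_zero]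
    constructor
    · exact fun h => h.1
    · rintro rfl
      exact ⟨rfl, fun y hy => by rw [hy]⟩
  | insert a s ha ih => rw [Finset.sum_insert ha, Finset.sum_insert ha, toExposed_add, ih]

/-- Cancelling a common summand splits the inclusion. Nonemptiness supplies the point to cancel;
without it the left side could hold vacuously. -/
theorem toExposed_add_subset_iff {l l' : StrongDual ℝ E} {A B : Set E}
    (hA : (l.toExposed A).Nonempty) (hB : (l.toExposed B).Nonempty) :
    l.toExposed (A + B) ⊆ l'.toExposed (A + B) ↔
      l.toExposed A ⊆ l'.toExposed A ∧ l.toExposed B ⊆ l'.toExposed B := by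
  constructor
  · intro h
    have key : ∀ a ∈ l.toExposed A, ∀ b ∈ l.toExposed B,
        a ∈ l'.toExposed A ∧ b ∈ l'.toExposed B := by
      intro a ha b hb
      have hab : a + b ∈ l'.toExposed (A + B) := by
        apply h
        rw [toExposed_add]
        exact Set.add_mem_add ha hb
      refine ⟨⟨ha.1, fun y hy => ?_⟩, ⟨hb.1, fun y hy => ?_⟩⟩
      · have := hab.2 (y + b) (Set.add_mem_add hy hb.1)
        simp only [map_add] at this
        linarith
      · have := hab.2 (a + y) (Set.add_mem_add ha.1 hy)
        simp only [map_add] at this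
        linarith
    obtain ⟨a₀, ha₀⟩ := hA
    obtain ⟨b₀, hb₀⟩ := hB
    exact ⟨fun a ha => (key a ha b₀ hb₀).1, fun b hb => (key a₀ ha₀ b hb).2⟩
  · rintro ⟨h1, h2⟩
    rw [toExposed_add, toExposed_add]
    exact Set.add_subset_add h1 h2

theorem toExposed_sum_subset_iff {ι : Type*} {l l' : StrongDual ℝ E} (s : Finset ι)
    (A : ι → Set E) (hA : ∀ i ∈ s, (l.toExposed (A i)).Nonempty) :
    l.toExposed (∑ i ∈ s, A i) ⊆ l'.toExposed (∑ i ∈ s, A i) ↔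
      ∀ i ∈ s, l.toExposed (A i) ⊆ l'.toExposed (A i) := by
  classical
  induction s using Finset.induction_on with
  | empty =>
    simp only [Finset.sum_empty, Finset.notMem_empty, false_imp_iff, implies_true, iff_true]
    rintro x ⟨hx, -⟩
    refine ⟨hx, fun y hy => ?_⟩
    rw [Set.mem_zero.1 hx, Set.mem_zero.1 hy]
  | insert a s ha ih =>
    rw [Finset.sum_insert ha, toExposed_add_subset_iff (hA a (by simp)), ih]
    · simp
    · exact fun i hi => hA i (by simp [hi])
    · rw [toExposed_sum]
      exact Set.finset_sum_nonempty _ _ fun i hi => hA i (by simp [hi])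

theorem toExposed_nonempty_of_finite (l : StrongDual ℝ E) {S : Set E} (hS : S.Finite)
    (hne : S.Nonempty) : (l.toExposed S).Nonempty := by
  obtain ⟨x, hx, h⟩ := Set.exists_max_image S l hS hne
  exact ⟨x, hx, h⟩

theorem toExposed_convexHull (l : StrongDual ℝ E) {S : Set E} (hS : S.Finite) :
    l.toExposed (convexHull ℝ S) = convexHull ℝ (l.toExposed S) := by
  rcases S.eq_empty_or_nonempty with rfl | hne
  · ext x
    simp [ContinuousLinearMap.toExposed]
  obtain ⟨x₀, hx₀, hmax⟩ := toExposed_nonempty_of_finite l hS hne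
  have hle : ∀ y ∈ convexHull ℝ S, l y ≤ l x₀ := by
    have : convexHull ℝ S ⊆ {y | l y ≤ l x₀} :=
      convexHull_min hmax (convex_halfSpace_le l.toLinearMap.isLinear _)
    exact this
  apply Set.Subset.antisymm
  · rintro x ⟨hx, hx'⟩
    have hval : l x = l x₀ := le_antisymm (hle x hx) (hx' x₀ (subset_convexHull ℝ S hx₀))
    rw [mem_convexHull_iff_exists_fintype] at hx
    obtain ⟨ι, _, w, z, hw0, hw1, hz, rfl⟩ := hx
    -- The weighted deficits are nonnegative and sum to zero, so only maximizers of `l` carry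
    -- positive weight.
    have hzero : ∀ i, w i * (l x₀ - l (z i)) = 0 := by
      have hsum : ∑ i, w i * (l x₀ - l (z i)) = 0 := by
        simp only [mul_sub, Finset.sum_sub_distrib, ← Finset.sum_mul, hw1, one_mul]
        rw [← hval, map_sum]
        simp
      intro i
      exact (Finset.sum_eq_zero_iff_of_nonneg fun i _ =>
        mul_nonneg (hw0 i) (sub_nonneg.2 (hmax _ (hz i)))).1 hsum i (Finset.mem_univ i)
    have hne : ∑ i, w i • z i = ∑ i with w i ≠ 0, w i • z i := by
      rw [Finset.sum_filter]
      exact Finset.sum_congr rfl fun i _ => by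
        by_cases h : w i = 0 <;> simp [h]
    rw [hne]
    refine (convex_convexHull ℝ _).sum_mem (fun i _ => hw0 i) ?_ fun i hi => ?_
    · rw [Finset.sum_filter_ne_zero, hw1]
    · apply subset_convexHull
      refine ⟨hz i, fun y hy => ?_⟩
      have := (mul_eq_zero.1 (hzero i)).resolve_left (Finset.mem_filter.1 hi).2
      have h2 := hmax y hy
      linarith
  · refine convexHull_min ?_ ?_
    · rintro x ⟨hx, hx'⟩
      exact ⟨subset_convexHull ℝ S hx, fun y hy => (hle y hy).trans (hx' _ hx₀)⟩
    · exact ContinuousLinearMap.toExposed.isExposed.convex (convex_convexHull ℝ S)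

theorem toExposed_convexHull_subset_iff {l l' : StrongDual ℝ E} {S : Set E} (hS : S.Finite) :
    l.toExposed (convexHull ℝ S) ⊆ l'.toExposed (convexHull ℝ S) ↔
      l.toExposed S ⊆ l'.toExposed S := by
  constructor
  · rintro h x ⟨hx, hx'⟩
    have h1 : x ∈ l.toExposed (convexHull ℝ S) := by
      rw [toExposed_convexHull l hS]
      exact subset_convexHull ℝ _ ⟨hx, hx'⟩
    exact ⟨hx, fun y hy => (h h1).2 y (subset_convexHull ℝ S hy)⟩
  · intro h
    rw [toExposed_convexHull l hS, toExposed_convexHull l' hS]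
    exact convexHull_mono h

theorem polyVertices_eq_exposedPoints (P : Set E) : polyVertices P = P.exposedPoints ℝ := by
  ext v
  rw [mem_exposedPoints_iff_exposed_singleton]
  exact ⟨fun h => h.2, fun h => ⟨Set.singleton_nonempty v, h⟩⟩

/-- An extreme point lies outside the compact hull of the other generators, and a functional
separating it strictly from that hull exposes it. -/
theorem polyVertices_convexHull [IsTopologicalAddGroup E] [ContinuousSMul ℝ E] [T2Space E]
    [LocallyConvexSpace ℝ E] {S : Set E} (hS : S.Finite) :
    polyVertices (convexHull ℝ S) = (convexHull ℝ S).extremePoints ℝ := by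
  rw [polyVertices_eq_exposedPoints]
  apply Set.Subset.antisymm exposedPoints_subset_extremePoints
  intro x hx
  have hxS : x ∈ S := extremePoints_convexHull_subset hx
  have hnot : x ∉ convexHull ℝ (S \ {x}) := fun h =>
    (((convex_convexHull ℝ S).mem_extremePoints_iff_mem_sdiff_convexHull_sdiff.1 hx).2
      (convexHull_mono (Set.sdiff_subset_sdiff_left (subset_convexHull ℝ S)) h)).elim
  have hcl : IsClosed (convexHull ℝ (S \ {x})) :=
    ((hS.subset Set.sdiff_subset).isCompact_convexHull ℝ).isClosed
  obtain ⟨l, c, h1, h2⟩ := geometric_hahn_banach_closed_point (convex_convexHull ℝ _) hcl hnot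
  rw [mem_exposedPoints_iff_exposed_singleton]
  intro _
  refine ⟨l, ?_⟩
  change {x} = l.toExposed (convexHull ℝ S)
  have hmax : ∀ y ∈ S, y ≠ x → l y < l x := fun y hy hyx =>
    (h1 y (subset_convexHull ℝ _ ⟨hy, hyx⟩)).trans h2
  have : l.toExposed S = {x} := by
    ext y
    simp only [mem_toExposed, Set.mem_singleton_iff]
    constructor
    · rintro ⟨hy, hy'⟩
      by_contra hne
      exact absurd (hy' x hxS) (not_le.2 (hmax y hy hne))
    · rintro rfl
      refine ⟨hxS, fun z hz => ?_⟩
      by_cases hzx : z = y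
      · rw [hzx]
      · exact (hmax z hz hzx).le
  rw [toExposed_convexHull l hS, this, convexHull_singleton]

/-- Faces are extreme subsets, and extreme points of an extreme subset are those of the whole set
that lie in it. This lets polygon vertices be counted among the vertices of the polytope. -/
theorem polyVertices_toExposed [IsTopologicalAddGroup E] [ContinuousSMul ℝ E] [T2Space E]
    [LocallyConvexSpace ℝ E] {S : Set E} (hS : S.Finite) (l : StrongDual ℝ E) :
    polyVertices (l.toExposed (convexHull ℝ S)) =
      {v ∈ polyVertices (convexHull ℝ S) | v ∈ l.toExposed (convexHull ℝ S)} := by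
  have hS' : (l.toExposed S).Finite := hS.subset fun x hx => hx.1
  have h1 : IsExtreme ℝ (convexHull ℝ S) (l.toExposed (convexHull ℝ S)) :=
    ContinuousLinearMap.toExposed.isExposed.isExtreme
  have h2 : polyVertices (l.toExposed (convexHull ℝ S)) =
      (l.toExposed (convexHull ℝ S)).extremePoints ℝ := by
    rw [toExposed_convexHull l hS, polyVertices_convexHull hS']
  rw [h2, polyVertices_convexHull hS, h1.extremePoints_eq]
  ext v
  simp [and_comm]

end Faces

theorem Set.finite_finset_sum {ι E : Type*} [AddCommMonoid E] (s : Finset ι) (A : ι → Set E)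
    (h : ∀ i ∈ s, (A i).Finite) : (∑ i ∈ s, A i).Finite := by
  classical
  induction s using Finset.induction_on with
  | empty => simp
  | insert a s ha ih =>
    rw [Finset.sum_insert ha]
    exact (h a (by simp)).add (ih fun i hi => h i (by simp [hi]))

/-! ### Candidate vertices of the box and of the tetrahedra. -/

/-- The point of `ℝ⁶` with coordinates `x₀, s₀, t₀` equal to `i, a, b` in the affine space
`x₀ + x₁ = 1`, `s₀ + s₁ = t₀ + t₁ = m`. -/
def coinPoint (m : ℕ) (i a b : ℝ) : Fin 6 → ℝ := ![i, 1 - i, a, m - a, b, m - b]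

/-- The vertices of the box `N(Q)`. -/
def boxPoints (m : ℕ) : Set (Fin 6 → ℝ) :=
  {x | ∃ i ∈ ({0, 1} : Set ℝ), ∃ a ∈ ({0, 1} : Set ℝ), ∃ b ∈ ({0, 1} : Set ℝ),
    x = coinPoint m i (m * a) (m * b)}

/-- The vertices of the tetrahedron `N(P_ℓ)`. -/
def tetraPoints (m ℓ : ℕ) : Set (Fin 6 → ℝ) :=
  {x | (∃ b ∈ ({0, 1} : Set ℝ), x = coinPoint m 1 ℓ (m * b)) ∨
    ∃ a ∈ ({0, 1} : Set ℝ), x = coinPoint m 0 (m * a) ℓ}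

theorem boxPoints_finite (m : ℕ) : (boxPoints m).Finite := by
  have h : boxPoints m ⊆ (fun p : ℝ × ℝ × ℝ => coinPoint m p.1 (m * p.2.1) (m * p.2.2)) ''
      (({0, 1} : Set ℝ) ×ˢ ({0, 1} : Set ℝ) ×ˢ ({0, 1} : Set ℝ)) := by
    rintro x ⟨i, hi, a, ha, b, hb, rfl⟩
    exact ⟨(i, a, b), ⟨hi, ha, hb⟩, rfl⟩
  refine Set.Finite.subset (Set.Finite.image _ ?_) h
  exact (Set.toFinite _).prod ((Set.toFinite _).prod (Set.toFinite _))

theorem tetraPoints_finite (m ℓ : ℕ) : (tetraPoints m ℓ).Finite := by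
  have h : tetraPoints m ℓ ⊆ (fun b : ℝ => coinPoint m 1 ℓ (m * b)) '' {0, 1} ∪
      (fun a : ℝ => coinPoint m 0 (m * a) ℓ) '' {0, 1} := by
    rintro x (⟨b, hb, rfl⟩ | ⟨a, ha, rfl⟩)
    · exact Or.inl ⟨b, hb, rfl⟩
    · exact Or.inr ⟨a, ha, rfl⟩
  exact (((Set.toFinite _).image _).union ((Set.toFinite _).image _)).subset h

theorem boxPoints_nonempty (m : ℕ) : (boxPoints m).Nonempty :=
  ⟨_, 0, by simp, 0, by simp, 0, by simp, rfl⟩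

theorem tetraPoints_nonempty (m ℓ : ℕ) : (tetraPoints m ℓ).Nonempty :=
  ⟨_, Or.inl ⟨0, by simp, rfl⟩⟩

/-! ### Newton polytopes of `Q` and `P_ℓ`. -/

section Newton

open MvPolynomial

/-- The exponent vector of `x₀^i x₁^(1-i) s₀^a s₁^(m-a) t₀^b t₁^(m-b)`. -/
noncomputable def coinExponent (m : ℕ) (k : ℕ × ℕ × ℕ) : Fin 6 →₀ ℕ :=
  Finsupp.single 0 k.1 + Finsupp.single 1 (1 - k.1) + (Finsupp.single 2 k.2.1 +
    Finsupp.single 3 (m - k.2.1)) + (Finsupp.single 4 k.2.2 + Finsupp.single 5 (m - k.2.2))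

theorem coinExponent_injective (m : ℕ) : Function.Injective (coinExponent m) := by
  rintro ⟨i, a, b⟩ ⟨i', a', b'⟩ h
  have h0 := DFunLike.congr_fun h 0
  have h2 := DFunLike.congr_fun h 2
  have h4 := DFunLike.congr_fun h 4
  simp [coinExponent] at h0 h2 h4
  simp [h0, h2, h4]

theorem coinExponent_cast {m : ℕ} {k : ℕ × ℕ × ℕ} (h1 : k.1 ≤ 1) (h2 : k.2.1 ≤ m)
    (h3 : k.2.2 ≤ m) :
    (fun i => ((coinExponent m k) i : ℝ)) = coinPoint m k.1 k.2.1 k.2.2 := by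
  funext i
  fin_cases i <;> simp [coinExponent, coinPoint, Nat.cast_sub, h1, h2, h3]

/-- Injectivity of `e` excludes cancellation between terms, so every listed exponent survives in the
support. -/
theorem newtonPolytope_sum_monomial {σ R ι : Type*} [CommSemiring R] (s : Finset ι)
    (e : ι → σ →₀ ℕ) (he : Function.Injective e) (c : ι → R) (hc : ∀ k ∈ s, c k ≠ 0) :
    newtonPolytope (∑ k ∈ s, monomial (e k) (c k)) =
      convexHull ℝ ((fun k (i : σ) => (e k i : ℝ)) '' s) := by
  classical
  have : ((∑ k ∈ s, monomial (e k) (c k)).support : Set (σ →₀ ℕ)) = e '' s := by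
    ext a
    simp only [Finset.mem_coe, mem_support_iff, coeff_sum, coeff_monomial, Set.mem_image]
    constructor
    · intro h
      obtain ⟨k, hk, hk'⟩ := Finset.exists_ne_zero_of_sum_ne_zero h
      exact ⟨k, hk, by by_contra hne; simp [hne] at hk'⟩
    · rintro ⟨k, hk, rfl⟩
      rw [Finset.sum_eq_single k]
      · simpa using hc k hk
      · intro b _ hb
        simp [he.ne hb]
      · exact fun h => absurd hk h
  rw [newtonPolytope, this, Set.image_image]

theorem X_add_X_pow {σ R : Type*} [CommSemiring R] (i j : σ) (n : ℕ) :
    (X i + X j : MvPolynomial σ R) ^ n = ∑ k ∈ Finset.range (n + 1),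
      monomial (Finsupp.single i k + Finsupp.single j (n - k)) (n.choose k : R) := by
  rw [add_pow]
  refine Finset.sum_congr rfl fun k _ => ?_
  rw [X_pow_eq_monomial, X_pow_eq_monomial, monomial_mul, ← map_natCast (C : R →+* _), mul_comm,
    C_mul_monomial]
  simp

theorem coinQ_eq_sum (m : ℕ) :
    coinQ m = ∑ k ∈ Finset.range 2 ×ˢ Finset.range (m + 1) ×ˢ Finset.range (m + 1),
      monomial (coinExponent m k) ((m.choose k.2.1 : ℂ) * m.choose k.2.2) := by
  have h1 : (X 0 + X 1 : MvPolynomial (Fin 6) ℂ) = ∑ k ∈ Finset.range 2,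
      monomial (Finsupp.single 0 k + Finsupp.single 1 (1 - k)) 1 := by
    simp [Finset.sum_range_succ, X, add_comm]
  rw [coinQ, h1, X_add_X_pow, X_add_X_pow, Finset.sum_mul_sum, ← Finset.sum_product',
    Finset.sum_mul_sum, Finset.sum_product, Finset.sum_product]
  refine Finset.sum_congr rfl fun i _ => ?_
  rw [Finset.sum_product]
  refine Finset.sum_congr rfl fun a _ => Finset.sum_congr rfl fun b _ => ?_
  rw [monomial_mul, monomial_mul, one_mul, coinExponent]

/-- The two blocks are the expansions of the two summands of `P_ℓ`; the exponent of `x₀` keeps them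
disjoint. -/
theorem coinP_eq_sum (m ℓ : ℕ) :
    coinP m ℓ = ∑ k ∈ (({1} : Finset ℕ) ×ˢ {ℓ} ×ˢ Finset.range (m + 1) ∪
        {0} ×ˢ Finset.range (m + 1) ×ˢ {ℓ}),
      monomial (coinExponent m k)
        ((m.choose ℓ : ℂ) * m.choose (if k.1 = 1 then k.2.2 else k.2.1)) := by
  rw [Finset.sum_union]
  · simp only [Finset.sum_product, Finset.sum_singleton]
    rw [coinP, X_add_X_pow, X_add_X_pow, mul_add, Finset.mul_sum, Finset.mul_sum, Finset.mul_sum,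
      Finset.mul_sum, ← map_natCast (C : ℂ →+* _)]
    simp only [X_pow_eq_monomial]
    simp only [X, monomial_mul, map_natCast]
    simp only [← map_natCast (C : ℂ →+* MvPolynomial (Fin 6) ℂ), C_mul_monomial]
    congr 1
    · refine Finset.sum_congr rfl fun b _ => ?_
      simp only [coinExponent, if_true, one_mul, mul_one]
      congr 1
      simp only [Nat.sub_self, Finsupp.single_zero, add_zero]
      abel_nf
    · refine Finset.sum_congr rfl fun a _ => ?_
      simp only [coinExponent, zero_ne_one, if_false, one_mul, mul_one]
      congr 1
      simp only [Nat.sub_zero, Finsupp.single_zero, zero_add]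
      abel_nf
  · rw [Finset.disjoint_left]
    rintro ⟨i, a, b⟩
    simp only [Finset.mem_product, Finset.mem_singleton]
    rintro ⟨rfl, -⟩
    simp

/-- The affine parametrization of the box `N(Q)` by the standard cube. -/
noncomputable def boxMap (m : ℕ) : (Fin 3 → ℝ) →ᵃ[ℝ] (Fin 6 → ℝ) :=
  AffineMap.pi ![(LinearMap.proj 0).toAffineMap,
    AffineMap.const ℝ _ 1 - (LinearMap.proj 0).toAffineMap,
    ((m : ℝ) • LinearMap.proj 1).toAffineMap,
    AffineMap.const ℝ _ (m : ℝ) - ((m : ℝ) • LinearMap.proj 1).toAffineMap,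
    ((m : ℝ) • LinearMap.proj 2).toAffineMap,
    AffineMap.const ℝ _ (m : ℝ) - ((m : ℝ) • LinearMap.proj 2).toAffineMap]

theorem boxMap_apply (m : ℕ) (y : Fin 3 → ℝ) :
    boxMap m y = coinPoint m (y 0) (m * y 1) (m * y 2) := by
  funext i
  fin_cases i <;> simp [boxMap, coinPoint]

theorem boxMap_image_Icc (m : ℕ) : boxMap m '' Set.Icc 0 1 = convexHull ℝ (boxPoints m) := by
  have h : Set.Icc (0 : Fin 3 → ℝ) 1 = convexHull ℝ (Set.univ.pi fun _ => {0, 1}) := by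
    rw [convexHull_pi, ← Set.pi_univ_Icc]
    simp [convexHull_pair, segment_eq_Icc]
  rw [h, AffineMap.image_convexHull]
  congr 1
  ext x
  constructor
  · rintro ⟨y, hy, rfl⟩
    exact ⟨y 0, hy 0 trivial, y 1, hy 1 trivial, y 2, hy 2 trivial, boxMap_apply m y⟩
  · rintro ⟨i, hi, a, ha, b, hb, rfl⟩
    refine ⟨![i, a, b], ?_, by simp [boxMap_apply]⟩
    intro j _
    fin_cases j <;> assumption

theorem boxMap_injective {m : ℕ} (hm : 1 ≤ m) : Function.Injective (boxMap m) := by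
  intro y y' h
  rw [boxMap_apply, boxMap_apply] at h
  have hm' : (m : ℝ) ≠ 0 := by positivity
  have h0 := congrFun h 0
  have h2 := congrFun h 2
  have h4 := congrFun h 4
  simp [coinPoint] at h0 h2 h4
  funext i
  fin_cases i
  · exact h0
  · exact h2.resolve_right (by omega)
  · exact h4.resolve_right (by omega)

theorem newtonPolytope_coinQ {m : ℕ} (hm : 1 ≤ m) :
    newtonPolytope (coinQ m) = convexHull ℝ (boxPoints m) := by
  rw [coinQ_eq_sum, newtonPolytope_sum_monomial _ _ (coinExponent_injective m)]
  · apply Set.Subset.antisymm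
    · refine convexHull_min ?_ (convex_convexHull ℝ _)
      rintro _ ⟨⟨i, a, b⟩, hk, rfl⟩
      simp only [Finset.coe_product, Set.mem_prod, Finset.coe_range, Set.mem_Iio] at hk
      obtain ⟨hi, ha, hb⟩ := hk
      simp only
      rw [coinExponent_cast (by simp; omega) (by simp; omega) (by simp; omega), ← boxMap_image_Icc]
      have hm' : (0 : ℝ) < m := by positivity
      have hi' : (i : ℝ) ≤ 1 := by exact_mod_cast Nat.lt_succ_iff.1 hi
      have ha' : (a : ℝ) ≤ m := by exact_mod_cast Nat.lt_succ_iff.1 ha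
      have hb' : (b : ℝ) ≤ m := by exact_mod_cast Nat.lt_succ_iff.1 hb
      refine ⟨![i, a / m, b / m], ⟨?_, ?_⟩, ?_⟩
      · intro j
        fin_cases j <;> simp <;> positivity
      · intro j
        fin_cases j <;> simp [hi', div_le_one hm', ha', hb']
      · simp [boxMap_apply, mul_div_cancel₀, hm'.ne']
    · apply convexHull_mono
      have key : ∀ x ∈ ({0, 1} : Set ℝ), ∃ n : ℕ, n ≤ 1 ∧ (n : ℝ) = x := by
        rintro x (rfl | rfl)
        · exact ⟨0, by simp⟩
        · exact ⟨1, by simp⟩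
      rintro _ ⟨x, hx, y, hy, z, hz, rfl⟩
      obtain ⟨i, hi, rfl⟩ := key x hx
      obtain ⟨a, ha, rfl⟩ := key y hy
      obtain ⟨b, hb, rfl⟩ := key z hz
      have ha' : m * a ≤ m := by nlinarith
      have hb' : m * b ≤ m := by nlinarith
      refine ⟨(i, m * a, m * b), ?_, ?_⟩
      · simp only [Finset.coe_product, Set.mem_prod, Finset.coe_range, Set.mem_Iio]
        omega
      · simp only
        rw [coinExponent_cast hi ha' hb']
        simp
  · rintro ⟨i, a, b⟩ hk
    simp only [Finset.mem_product, Finset.mem_range] at hk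
    have ha := Nat.choose_pos (Nat.lt_succ_iff.1 hk.2.1)
    have hb := Nat.choose_pos (Nat.lt_succ_iff.1 hk.2.2)
    simp only [ne_eq, mul_eq_zero, Nat.cast_eq_zero]
    omega

theorem newtonPolytope_coinP {m ℓ : ℕ} (hm : 1 ≤ m) (hℓ : ℓ ≤ m) :
    newtonPolytope (coinP m ℓ) = convexHull ℝ (tetraPoints m ℓ) := by
  have hm' : (0 : ℝ) < m := by positivity
  rw [coinP_eq_sum, newtonPolytope_sum_monomial _ _ (coinExponent_injective m)]
  · apply Set.Subset.antisymm
    · refine convexHull_min ?_ (convex_convexHull ℝ _)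
      rintro _ ⟨⟨i, a, b⟩, hk, rfl⟩
      simp only [Finset.coe_union, Finset.coe_product, Set.mem_prod, Finset.coe_range, Set.mem_Iio,
        Finset.coe_singleton, Set.mem_union, Set.mem_singleton_iff] at hk
      simp only
      rcases hk with ⟨rfl, rfl, hb⟩ | ⟨rfl, ha, rfl⟩
      · rw [coinExponent_cast (by simp) (by simpa) (by simp; omega)]
        have hb' : (b : ℝ) ≤ m := by exact_mod_cast Nat.lt_succ_iff.1 hb
        -- All exponents of this block lie on one edge of the tetrahedron, at the fraction `b / m`
        -- of its length.
        have : coinPoint m (1 : ℕ) a b = (1 - b / m : ℝ) • coinPoint m 1 a (m * 0) +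
            (b / m : ℝ) • coinPoint m 1 a (m * 1) := by
          funext j
          fin_cases j <;> simp [coinPoint] <;> field_simp <;> ring
        simp only [this]
        refine convex_convexHull ℝ (tetraPoints m a) (subset_convexHull ℝ _ (Or.inl ⟨0, by simp, rfl⟩))
          (subset_convexHull ℝ _ (Or.inl ⟨1, by simp, rfl⟩)) ?_ (by positivity) (by ring)
        rw [sub_nonneg, div_le_one hm']
        exact hb'
      · rw [coinExponent_cast (by simp) (by simp; omega) (by simpa)]
        have ha' : (a : ℝ) ≤ m := by exact_mod_cast Nat.lt_succ_iff.1 ha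
        have : coinPoint m (0 : ℕ) a b = (1 - a / m : ℝ) • coinPoint m 0 (m * 0) b +
            (a / m : ℝ) • coinPoint m 0 (m * 1) b := by
          funext j
          fin_cases j <;> simp [coinPoint] <;> field_simp <;> ring
        simp only [this]
        refine convex_convexHull ℝ (tetraPoints m b) (subset_convexHull ℝ _ (Or.inr ⟨0, by simp, rfl⟩))
          (subset_convexHull ℝ _ (Or.inr ⟨1, by simp, rfl⟩)) ?_ (by positivity) (by ring)
        rw [sub_nonneg, div_le_one hm']
        exact ha'
    · apply convexHull_mono
      have key : ∀ x ∈ ({0, 1} : Set ℝ), ∃ n : ℕ, m * n ≤ m ∧ ((m * n : ℕ) : ℝ) = m * x := by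
        rintro x (rfl | rfl)
        · exact ⟨0, by simp⟩
        · exact ⟨1, by simp⟩
      rintro _ (⟨b, hb, rfl⟩ | ⟨a, ha, rfl⟩)
      · obtain ⟨n, hn, hnb⟩ := key b hb
        refine ⟨(1, ℓ, m * n), by simp; omega, ?_⟩
        simp only
        rw [coinExponent_cast le_rfl hℓ hn, ← hnb]
        simp
      · obtain ⟨n, hn, hna⟩ := key a ha
        refine ⟨(0, m * n, ℓ), by simp; omega, ?_⟩
        simp only
        rw [coinExponent_cast (by simp) hn hℓ, ← hna]
        simp
  · rintro ⟨i, a, b⟩ hk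
    simp only [Finset.mem_union, Finset.mem_product, Finset.mem_range, Finset.mem_singleton] at hk
    have h1 := Nat.choose_pos hℓ
    have h2 : 0 < m.choose (if i = 1 then b else a) := by
      apply Nat.choose_pos
      split_ifs <;> omega
    simp only [ne_eq, mul_eq_zero, Nat.cast_eq_zero]
    omega

end Newton

theorem coinNumeratorSum_eq {m : ℕ} (hm : 1 ≤ m) :
    coinNumeratorSum m = ∑ ℓ ∈ Finset.range (m + 1), convexHull ℝ (tetraPoints m ℓ) :=
  Finset.sum_congr rfl fun _ hℓ =>
    newtonPolytope_coinP hm (Nat.lt_succ_iff.1 (Finset.mem_range.1 hℓ))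

theorem coinPolytope_eq {m : ℕ} (hm : 1 ≤ m) :
    coinPolytope m = convexHull ℝ (boxPoints m) +
      ∑ ℓ ∈ Finset.range (m + 1), convexHull ℝ (tetraPoints m ℓ) := by
  rw [coinPolytope, newtonPolytope_coinQ hm, coinNumeratorSum_eq hm]

theorem exists_finite_coinPolytope_eq_convexHull {m : ℕ} (hm : 1 ≤ m) :
    ∃ S : Set (Fin 6 → ℝ), S.Finite ∧ coinPolytope m = convexHull ℝ S := by
  refine ⟨boxPoints m + ∑ ℓ ∈ Finset.range (m + 1), tetraPoints m ℓ, ?_, ?_⟩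
  · exact (boxPoints_finite m).add (Set.finite_finset_sum _ _ fun ℓ _ => tetraPoints_finite m ℓ)
  · rw [coinPolytope_eq hm, convexHull_add, convexHull_sum]

/-! ### Faces of the Minkowski sum as sign vectors. -/

/-- The weights `l(e₀ - e₁), l(e₂ - e₃), l(e₄ - e₅)` of a functional, which determine it up to a
constant on the affine space of the polytope. -/
def coinWeight (l : StrongDual ℝ (Fin 6 → ℝ)) : ℝ × ℝ × ℝ :=
  (l ![1, -1, 0, 0, 0, 0], l ![0, 0, 1, -1, 0, 0], l ![0, 0, 0, 0, 1, -1])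

/-- A functional with prescribed weights. -/
noncomputable def coinFunctional (w : ℝ × ℝ × ℝ) : StrongDual ℝ (Fin 6 → ℝ) :=
  w.1 • ContinuousLinearMap.proj 0 + w.2.1 • ContinuousLinearMap.proj 2 +
    w.2.2 • ContinuousLinearMap.proj 4

theorem coinWeight_coinFunctional (w : ℝ × ℝ × ℝ) : coinWeight (coinFunctional w) = w := by
  obtain ⟨u, a, b⟩ := w
  simp [coinWeight, coinFunctional]

/-- The difference between the maximum of a functional on the edge `x₀ = 1` of `N(P_ℓ)` and its
maximum on the edge `x₀ = 0`. -/
noncomputable def coinGap (m : ℕ) (w : ℝ × ℝ × ℝ) (ℓ : ℕ) : ℝ :=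
  w.1 + (ℓ * w.2.1 + m * max w.2.2 0) - (ℓ * w.2.2 + m * max w.2.1 0)

theorem apply_coinPoint (m : ℕ) (l : StrongDual ℝ (Fin 6 → ℝ)) (i a b : ℝ) :
    l (coinPoint m i a b) = l (coinPoint m 0 0 0) + i * (coinWeight l).1 +
      a * (coinWeight l).2.1 + b * (coinWeight l).2.2 := by
  have : coinPoint m i a b = coinPoint m 0 0 0 + i • ![1, -1, 0, 0, 0, 0] +
      a • ![0, 0, 1, -1, 0, 0] + b • ![0, 0, 0, 0, 1, -1] := by
    funext j
    fin_cases j <;> simp [coinPoint] <;> ring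
  rw [this]
  simp only [coinWeight, map_add, map_smul, smul_eq_mul]

theorem coinPoint_inj {m : ℕ} {i a b i' a' b' : ℝ} :
    coinPoint m i a b = coinPoint m i' a' b' ↔ i = i' ∧ a = a' ∧ b = b' := by
  constructor
  · intro h
    exact ⟨congrFun h 0, congrFun h 2, congrFun h 4⟩
  · rintro ⟨rfl, rfl, rfl⟩
    rfl

/-- The endpoint `c` of `[0, 1]` maximizes the product with `x`. -/
def IsMaxEnd (x c : ℝ) : Prop := (c = 0 ∧ x ≤ 0) ∨ (c = 1 ∧ 0 ≤ x)

theorem IsMaxEnd.mem {x c : ℝ} (h : IsMaxEnd x c) : c ∈ ({0, 1} : Set ℝ) := by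
  rcases h with ⟨rfl, -⟩ | ⟨rfl, -⟩ <;> simp

theorem IsMaxEnd.mul_eq {x c : ℝ} (h : IsMaxEnd x c) : c * x = max x 0 := by
  rcases h with ⟨rfl, h⟩ | ⟨rfl, h⟩ <;> simp [h]

theorem exists_isMaxEnd (x : ℝ) : ∃ c, IsMaxEnd x c := by
  rcases le_total x 0 with h | h
  · exact ⟨0, Or.inl ⟨rfl, h⟩⟩
  · exact ⟨1, Or.inr ⟨rfl, h⟩⟩

theorem isMaxEnd_of_max_le {x c : ℝ} (hc : c ∈ ({0, 1} : Set ℝ)) (h : max x 0 ≤ c * x) :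
    IsMaxEnd x c := by
  rcases hc with rfl | rfl
  · left
    simpa using h
  · right
    simpa using h

theorem mul_le_max {x c : ℝ} (hc : c ∈ ({0, 1} : Set ℝ)) : c * x ≤ max x 0 := by
  rcases hc with rfl | rfl <;> simp

/-- The maximizing endpoints are `{0}`, `{1}` or both, according to the sign of `x`; inclusion of
these sets is degeneration of the sign to zero. -/
theorem isMaxEnd_imp_iff {x y : ℝ} :
    (∀ c, IsMaxEnd x c → IsMaxEnd y c) ↔ SignType.sign y = 0 ∨ SignType.sign y = SignType.sign x := by
  constructor
  · intro h
    rcases lt_trichotomy x 0 with hx | rfl | hx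
    · have : y ≤ 0 := by
        rcases h 0 (Or.inl ⟨rfl, hx.le⟩) with h | h
        · exact h.2
        · exact absurd h.1 (by norm_num)
      rcases this.lt_or_eq with hy | hy
      · right; rw [sign_neg hx, sign_neg hy]
      · left; simp [hy]
    · have h1 : y ≤ 0 := by
        rcases h 0 (Or.inl ⟨rfl, le_rfl⟩) with h | h
        · exact h.2
        · exact absurd h.1 (by norm_num)
      have h2 : 0 ≤ y := by
        rcases h 1 (Or.inr ⟨rfl, le_rfl⟩) with h | h
        · exact absurd h.1 (by norm_num)
        · exact h.2
      left
      rw [le_antisymm h1 h2, sign_zero]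
    · have : 0 ≤ y := by
        rcases h 1 (Or.inr ⟨rfl, hx.le⟩) with h | h
        · exact absurd h.1 (by norm_num)
        · exact h.2
      rcases this.lt_or_eq with hy | hy
      · right; rw [sign_pos hx, sign_pos hy]
      · left; simp [← hy]
  · rintro (h | h) c hc
    · rw [sign_eq_zero_iff] at h
      subst h
      rcases hc with ⟨rfl, -⟩ | ⟨rfl, -⟩
      · exact Or.inl ⟨rfl, le_rfl⟩
      · exact Or.inr ⟨rfl, le_rfl⟩
    · rcases hc with ⟨rfl, hx⟩ | ⟨rfl, hx⟩
      · refine Or.inl ⟨rfl, ?_⟩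
        by_contra hy
        rw [sign_pos (not_le.1 hy), eq_comm, sign_eq_one_iff] at h
        linarith
      · refine Or.inr ⟨rfl, ?_⟩
        by_contra hy
        rw [sign_neg (not_le.1 hy), eq_comm, sign_eq_neg_one_iff] at h
        linarith

/-- The functional splits into a sum over the three coordinates of the box, each maximized
independently. -/
theorem toExposed_boxPoints (m : ℕ) (hm : 1 ≤ m) (l : StrongDual ℝ (Fin 6 → ℝ)) :
    l.toExposed (boxPoints m) = {x | ∃ i a b, IsMaxEnd (coinWeight l).1 i ∧
      IsMaxEnd (coinWeight l).2.1 a ∧ IsMaxEnd (coinWeight l).2.2 b ∧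
      x = coinPoint m i (m * a) (m * b)} := by
  have hm' : (0 : ℝ) < m := by positivity
  obtain ⟨i₀, hi₀⟩ := exists_isMaxEnd (coinWeight l).1
  obtain ⟨a₀, ha₀⟩ := exists_isMaxEnd (coinWeight l).2.1
  obtain ⟨b₀, hb₀⟩ := exists_isMaxEnd (coinWeight l).2.2
  ext x
  constructor
  · rintro ⟨⟨i, hi, a, ha, b, hb, rfl⟩, h⟩
    have h1 := h _ ⟨i₀, hi₀.mem, a₀, ha₀.mem, b₀, hb₀.mem, rfl⟩
    rw [apply_coinPoint, apply_coinPoint m l i, mul_assoc, mul_assoc, mul_assoc, mul_assoc,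
      hi₀.mul_eq, ha₀.mul_eq, hb₀.mul_eq] at h1
    have e1 := mul_le_max (x := (coinWeight l).1) hi
    have e2 := mul_le_mul_of_nonneg_left (mul_le_max (x := (coinWeight l).2.1) ha) hm'.le
    have e3 := mul_le_mul_of_nonneg_left (mul_le_max (x := (coinWeight l).2.2) hb) hm'.le
    refine ⟨i, a, b, isMaxEnd_of_max_le hi (by linarith), isMaxEnd_of_max_le ha ?_,
      isMaxEnd_of_max_le hb ?_, rfl⟩ <;>
    · refine le_of_mul_le_mul_left ?_ hm'
      linarith
  · rintro ⟨i, a, b, hi, ha, hb, rfl⟩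
    refine ⟨⟨i, hi.mem, a, ha.mem, b, hb.mem, rfl⟩, ?_⟩
    rintro _ ⟨i', hi', a', ha', b', hb', rfl⟩
    rw [apply_coinPoint, apply_coinPoint m l i, mul_assoc, mul_assoc, mul_assoc, mul_assoc,
      hi.mul_eq, ha.mul_eq, hb.mul_eq]
    have e1 := mul_le_max (x := (coinWeight l).1) hi'
    have e2 := mul_le_mul_of_nonneg_left (mul_le_max (x := (coinWeight l).2.1) ha') hm'.le
    have e3 := mul_le_mul_of_nonneg_left (mul_le_max (x := (coinWeight l).2.2) hb') hm'.le
    linarith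

/-- The sign of the gap decides which of the two opposite edges carries the maximum (both if it
vanishes); within an edge the sign of `b` or of `a` decides. -/
theorem toExposed_tetraPoints (m ℓ : ℕ) (hm : 1 ≤ m) (l : StrongDual ℝ (Fin 6 → ℝ)) :
    l.toExposed (tetraPoints m ℓ) = {x |
      (0 ≤ coinGap m (coinWeight l) ℓ ∧ ∃ b, IsMaxEnd (coinWeight l).2.2 b ∧
        x = coinPoint m 1 ℓ (m * b)) ∨
      (coinGap m (coinWeight l) ℓ ≤ 0 ∧ ∃ a, IsMaxEnd (coinWeight l).2.1 a ∧
        x = coinPoint m 0 (m * a) ℓ)} := by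
  have hm' : (0 : ℝ) < m := by positivity
  obtain ⟨a₀, ha₀⟩ := exists_isMaxEnd (coinWeight l).2.1
  obtain ⟨b₀, hb₀⟩ := exists_isMaxEnd (coinWeight l).2.2
  have v1 : ∀ b, l (coinPoint m 1 ℓ (m * b)) = l (coinPoint m 0 0 0) + (coinWeight l).1 +
      ℓ * (coinWeight l).2.1 + m * (b * (coinWeight l).2.2) := by
    intro b
    rw [apply_coinPoint]
    ring
  have v0 : ∀ a, l (coinPoint m 0 (m * a) ℓ) = l (coinPoint m 0 0 0) +
      m * (a * (coinWeight l).2.1) + ℓ * (coinWeight l).2.2 := by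
    intro a
    rw [apply_coinPoint]
    ring
  unfold coinGap
  ext x
  constructor
  · rintro ⟨⟨b, hb, rfl⟩ | ⟨a, ha, rfl⟩, h⟩
    · left
      have h1 := h _ (Or.inl ⟨b₀, hb₀.mem, rfl⟩)
      have h2 := h _ (Or.inr ⟨a₀, ha₀.mem, rfl⟩)
      rw [v1, v1, hb₀.mul_eq] at h1
      rw [v0, v1, ha₀.mul_eq] at h2
      have e3 := mul_le_mul_of_nonneg_left (mul_le_max (x := (coinWeight l).2.2) hb) hm'.le
      refine ⟨by linarith, b, isMaxEnd_of_max_le hb (le_of_mul_le_mul_left ?_ hm'), rfl⟩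
      linarith
    · right
      have h1 := h _ (Or.inl ⟨b₀, hb₀.mem, rfl⟩)
      have h2 := h _ (Or.inr ⟨a₀, ha₀.mem, rfl⟩)
      rw [v1, v0, hb₀.mul_eq] at h1
      rw [v0, v0, ha₀.mul_eq] at h2
      have e3 := mul_le_mul_of_nonneg_left (mul_le_max (x := (coinWeight l).2.1) ha) hm'.le
      refine ⟨by linarith, a, isMaxEnd_of_max_le ha (le_of_mul_le_mul_left ?_ hm'), rfl⟩
      linarith
  · rintro (⟨hg, b, hb, rfl⟩ | ⟨hg, a, ha, rfl⟩)
    · refine ⟨Or.inl ⟨b, hb.mem, rfl⟩, ?_⟩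
      rintro _ (⟨b', hb', rfl⟩ | ⟨a', ha', rfl⟩)
      · have e3 := mul_le_mul_of_nonneg_left (mul_le_max (x := (coinWeight l).2.2) hb') hm'.le
        rw [v1, v1, hb.mul_eq]
        linarith
      · have e3 := mul_le_mul_of_nonneg_left (mul_le_max (x := (coinWeight l).2.1) ha') hm'.le
        rw [v1, v0, hb.mul_eq]
        linarith
    · refine ⟨Or.inr ⟨a, ha.mem, rfl⟩, ?_⟩
      rintro _ (⟨b', hb', rfl⟩ | ⟨a', ha', rfl⟩)
      · have e3 := mul_le_mul_of_nonneg_left (mul_le_max (x := (coinWeight l).2.2) hb') hm'.le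
        rw [v0, v1, ha.mul_eq]
        linarith
      · have e3 := mul_le_mul_of_nonneg_left (mul_le_max (x := (coinWeight l).2.1) ha') hm'.le
        rw [v0, v0, ha.mul_eq]
        linarith

/-- `s` is obtained from `t` by replacing some signs by zero. -/
def SignSpecializes (s t : SignType) : Prop := s = 0 ∨ s = t

theorem toExposed_boxPoints_subset_iff {m : ℕ} (hm : 1 ≤ m) (l l' : StrongDual ℝ (Fin 6 → ℝ)) :
    l.toExposed (boxPoints m) ⊆ l'.toExposed (boxPoints m) ↔
      SignSpecializes (SignType.sign (coinWeight l').1) (SignType.sign (coinWeight l).1) ∧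
      SignSpecializes (SignType.sign (coinWeight l').2.1) (SignType.sign (coinWeight l).2.1) ∧
      SignSpecializes (SignType.sign (coinWeight l').2.2) (SignType.sign (coinWeight l).2.2) := by
  have hm' : (m : ℝ) ≠ 0 := by positivity
  simp only [SignSpecializes, ← isMaxEnd_imp_iff]
  rw [toExposed_boxPoints m hm, toExposed_boxPoints m hm]
  obtain ⟨i₀, hi₀⟩ := exists_isMaxEnd (coinWeight l).1
  obtain ⟨a₀, ha₀⟩ := exists_isMaxEnd (coinWeight l).2.1
  obtain ⟨b₀, hb₀⟩ := exists_isMaxEnd (coinWeight l).2.2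
  constructor
  · intro h
    have key : ∀ i a b, IsMaxEnd (coinWeight l).1 i → IsMaxEnd (coinWeight l).2.1 a →
        IsMaxEnd (coinWeight l).2.2 b → IsMaxEnd (coinWeight l').1 i ∧
          IsMaxEnd (coinWeight l').2.1 a ∧ IsMaxEnd (coinWeight l').2.2 b := by
      intro i a b hi ha hb
      obtain ⟨i', a', b', hi', ha', hb', e⟩ := h ⟨i, a, b, hi, ha, hb, rfl⟩
      obtain ⟨rfl, e2, e3⟩ := coinPoint_inj.1 e
      rw [mul_right_inj' hm'] at e2 e3
      exact ⟨hi', e2 ▸ ha', e3 ▸ hb'⟩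
    exact ⟨fun i hi => (key i _ _ hi ha₀ hb₀).1, fun a ha => (key _ a _ hi₀ ha hb₀).2.1,
      fun b hb => (key _ _ b hi₀ ha₀ hb).2.2⟩
  · rintro ⟨h1, h2, h3⟩ x ⟨i, a, b, hi, ha, hb, rfl⟩
    exact ⟨i, a, b, h1 i hi, h2 a ha, h3 b hb, rfl⟩

/-- Given `ha` and `hb`, which come from the box, maximizers within each edge are already
compatible, and only the choice of edge remains to be compared. -/
theorem toExposed_tetraPoints_subset_iff {m : ℕ} (hm : 1 ≤ m) (ℓ : ℕ)
    (l l' : StrongDual ℝ (Fin 6 → ℝ))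
    (ha : SignSpecializes (SignType.sign (coinWeight l').2.1) (SignType.sign (coinWeight l).2.1))
    (hb : SignSpecializes (SignType.sign (coinWeight l').2.2) (SignType.sign (coinWeight l).2.2)) :
    l.toExposed (tetraPoints m ℓ) ⊆ l'.toExposed (tetraPoints m ℓ) ↔
      SignSpecializes (SignType.sign (coinGap m (coinWeight l') ℓ))
        (SignType.sign (coinGap m (coinWeight l) ℓ)) := by
  simp only [SignSpecializes, ← isMaxEnd_imp_iff] at ha hb ⊢
  rw [toExposed_tetraPoints m ℓ hm, toExposed_tetraPoints m ℓ hm]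
  obtain ⟨a₀, ha₀⟩ := exists_isMaxEnd (coinWeight l).2.1
  obtain ⟨b₀, hb₀⟩ := exists_isMaxEnd (coinWeight l).2.2
  constructor
  · rintro h c (⟨rfl, hc⟩ | ⟨rfl, hc⟩)
    · rcases h (Or.inr ⟨hc, a₀, ha₀, rfl⟩) with ⟨-, b, -, e⟩ | ⟨h, -⟩
      · exact absurd (coinPoint_inj.1 e).1 (by norm_num)
      · exact Or.inl ⟨rfl, h⟩
    · rcases h (Or.inl ⟨hc, b₀, hb₀, rfl⟩) with ⟨h, -⟩ | ⟨-, b, -, e⟩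
      · exact Or.inr ⟨rfl, h⟩
      · exact absurd (coinPoint_inj.1 e).1 (by norm_num)
  · rintro h x (⟨hg, b, hb', rfl⟩ | ⟨hg, a, ha', rfl⟩)
    · rcases h 1 (Or.inr ⟨rfl, hg⟩) with ⟨h, -⟩ | ⟨-, h⟩
      · exact absurd h (by norm_num)
      · exact Or.inl ⟨h, b, hb b hb', rfl⟩
    · rcases h 0 (Or.inl ⟨rfl, hg⟩) with ⟨-, h⟩ | ⟨h, -⟩
      · exact Or.inr ⟨h, a, ha a ha', rfl⟩
      · exact absurd h (by norm_num)

theorem toExposed_coinPolytope_subset_iff {m : ℕ} (hm : 1 ≤ m) (l l' : StrongDual ℝ (Fin 6 → ℝ)) :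
    l.toExposed (coinPolytope m) ⊆ l'.toExposed (coinPolytope m) ↔
      (SignSpecializes (SignType.sign (coinWeight l').1) (SignType.sign (coinWeight l).1) ∧
      SignSpecializes (SignType.sign (coinWeight l').2.1) (SignType.sign (coinWeight l).2.1) ∧
      SignSpecializes (SignType.sign (coinWeight l').2.2) (SignType.sign (coinWeight l).2.2)) ∧
      ∀ ℓ ≤ m, SignSpecializes (SignType.sign (coinGap m (coinWeight l') ℓ))
        (SignType.sign (coinGap m (coinWeight l) ℓ)) := by
  have hne : ∀ S : Set (Fin 6 → ℝ), S.Finite → S.Nonempty →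
      (l.toExposed (convexHull ℝ S)).Nonempty := by
    intro S hS hS'
    rw [toExposed_convexHull l hS]
    exact (toExposed_nonempty_of_finite l hS hS').convexHull
  have hne' := fun ℓ => hne _ (tetraPoints_finite m ℓ) (tetraPoints_nonempty m ℓ)
  rw [coinPolytope_eq hm, toExposed_add_subset_iff, toExposed_sum_subset_iff,
    toExposed_convexHull_subset_iff (boxPoints_finite m), toExposed_boxPoints_subset_iff hm]
  · refine and_congr_right fun h => forall_congr' fun ℓ => ?_
    rw [Finset.mem_range, Nat.lt_succ_iff, toExposed_convexHull_subset_iff (tetraPoints_finite m ℓ),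
      toExposed_tetraPoints_subset_iff hm ℓ l l' h.2.1 h.2.2]
  · exact fun ℓ _ => hne' ℓ
  · exact hne _ (boxPoints_finite m) (boxPoints_nonempty m)
  · rw [toExposed_sum]
    exact Set.finset_sum_nonempty _ _ fun ℓ _ => hne' ℓ

/-- The face of the polytope in direction `w`. -/
def coinFace (m : ℕ) (w : ℝ × ℝ × ℝ) : Set (Fin 6 → ℝ) :=
  (coinFunctional w).toExposed (coinPolytope m)

/-- Functionals with equal weights have equal sign data, so their faces contain each other. Three
parameters therefore describe all faces. -/
theorem toExposed_coinPolytope {m : ℕ} (hm : 1 ≤ m) (l : StrongDual ℝ (Fin 6 → ℝ)) :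
    l.toExposed (coinPolytope m) = coinFace m (coinWeight l) := by
  have h : ∀ s, SignSpecializes s s := fun s => Or.inr rfl
  apply Set.Subset.antisymm <;> rw [coinFace, toExposed_coinPolytope_subset_iff hm] <;>
    simp [coinWeight_coinFunctional, h]

theorem coinFace_nonempty {m : ℕ} (hm : 1 ≤ m) (w : ℝ × ℝ × ℝ) : (coinFace m w).Nonempty := by
  obtain ⟨S, hS, h⟩ := exists_finite_coinPolytope_eq_convexHull hm
  rw [coinFace, h, toExposed_convexHull _ hS]
  refine (toExposed_nonempty_of_finite _ hS ?_).convexHull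
  rw [← convexHull_nonempty_iff (𝕜 := ℝ), ← h, coinPolytope_eq hm]
  exact (boxPoints_nonempty m).convexHull.add
    (Set.finset_sum_nonempty _ _ fun ℓ _ => (tetraPoints_nonempty m ℓ).convexHull)

theorem polyFaces_coinPolytope {m : ℕ} (hm : 1 ≤ m) :
    polyFaces (coinPolytope m) = Set.range (coinFace m) := by
  ext F
  rw [mem_polyFaces_iff]
  constructor
  · rintro ⟨-, l, rfl⟩
    exact ⟨coinWeight l, (toExposed_coinPolytope hm l).symm⟩
  · rintro ⟨w, rfl⟩
    exact ⟨coinFace_nonempty hm w, _, rfl⟩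

theorem polyVertices_coinFace {m : ℕ} (hm : 1 ≤ m) (w : ℝ × ℝ × ℝ) :
    polyVertices (coinFace m w) = {v ∈ polyVertices (coinPolytope m) | v ∈ coinFace m w} := by
  obtain ⟨S, hS, h⟩ := exists_finite_coinPolytope_eq_convexHull hm
  rw [coinFace, h, polyVertices_toExposed hS]

theorem exists_finite_coinFace_eq_convexHull {m : ℕ} (hm : 1 ≤ m) (w : ℝ × ℝ × ℝ) :
    ∃ S : Set (Fin 6 → ℝ), S.Finite ∧ coinFace m w = convexHull ℝ S := by
  obtain ⟨S, hS, h⟩ := exists_finite_coinPolytope_eq_convexHull hm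
  exact ⟨(coinFunctional w).toExposed S, hS.subset fun x hx => hx.1,
    by rw [coinFace, h, toExposed_convexHull _ hS]⟩

/-- The signs that determine the face of the polytope in direction `w`. -/
noncomputable def coinType (m : ℕ) (w : ℝ × ℝ × ℝ) :
    (SignType × SignType × SignType) × (Fin (m + 1) → SignType) :=
  ((SignType.sign w.1, SignType.sign w.2.1, SignType.sign w.2.2),
    fun ℓ => SignType.sign (coinGap m w ℓ))

/-- Componentwise specialization of sign data. -/
def TypeSpecializes {n : ℕ} (s t : (SignType × SignType × SignType) × (Fin n → SignType)) : Prop :=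
  (SignSpecializes s.1.1 t.1.1 ∧ SignSpecializes s.1.2.1 t.1.2.1 ∧
    SignSpecializes s.1.2.2 t.1.2.2) ∧ ∀ ℓ, SignSpecializes (s.2 ℓ) (t.2 ℓ)

theorem coinFace_subset_iff {m : ℕ} (hm : 1 ≤ m) (w w' : ℝ × ℝ × ℝ) :
    coinFace m w ⊆ coinFace m w' ↔ TypeSpecializes (coinType m w') (coinType m w) := by
  rw [coinFace, coinFace, toExposed_coinPolytope_subset_iff hm]
  simp only [coinWeight_coinFunctional, TypeSpecializes, coinType]
  refine and_congr_right fun _ => ⟨fun h ℓ => h ℓ (Nat.lt_succ_iff.1 ℓ.2), fun h ℓ hℓ => ?_⟩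
  exact h ⟨ℓ, Nat.lt_succ_iff.2 hℓ⟩

theorem SignSpecializes.antisymm {s t : SignType} (h : SignSpecializes s t)
    (h' : SignSpecializes t s) : s = t := by
  rcases h with rfl | rfl
  · rcases h' with rfl | rfl <;> rfl
  · rfl

theorem coinFace_eq_iff {m : ℕ} (hm : 1 ≤ m) (w w' : ℝ × ℝ × ℝ) :
    coinFace m w = coinFace m w' ↔ coinType m w = coinType m w' := by
  rw [Set.Subset.antisymm_iff, coinFace_subset_iff hm, coinFace_subset_iff hm]
  constructor
  · rintro ⟨⟨⟨h1, h2, h3⟩, h4⟩, ⟨h1', h2', h3'⟩, h4'⟩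
    exact Prod.ext (Prod.ext (h1'.antisymm h1) (Prod.ext (h2'.antisymm h2) (h3'.antisymm h3)))
      (funext fun ℓ => (h4' ℓ).antisymm (h4 ℓ))
  · intro h
    rw [h]
    exact ⟨⟨⟨Or.inr rfl, Or.inr rfl, Or.inr rfl⟩, fun _ => Or.inr rfl⟩,
      ⟨⟨Or.inr rfl, Or.inr rfl, Or.inr rfl⟩, fun _ => Or.inr rfl⟩⟩

/-! ### Directions and dimensions of the faces. -/

/-- The linear part of `coinPoint`. -/
def coinVector : (ℝ × ℝ × ℝ) →ₗ[ℝ] (Fin 6 → ℝ) where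
  toFun x := ![x.1, -x.1, x.2.1, -x.2.1, x.2.2, -x.2.2]
  map_add' x y := by
    funext j
    fin_cases j <;> simp <;> ring
  map_smul' c x := by
    funext j
    fin_cases j <;> simp

theorem coinVector_injective : Function.Injective coinVector := by
  rintro ⟨x, y, z⟩ ⟨x', y', z'⟩ h
  have h0 := congrFun h 0
  have h2 := congrFun h 2
  have h4 := congrFun h 4
  simp [coinVector] at h0 h2 h4
  simp [h0, h2, h4]

theorem coinPoint_sub (m : ℕ) (i a b i' a' b' : ℝ) :
    coinPoint m i a b - coinPoint m i' a' b' = coinVector (i - i', a - a', b - b') := by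
  funext j
  fin_cases j <;> simp [coinPoint, coinVector]

/-- The normal vector of the wall separating the two sides of `N(P_ℓ)`. -/
noncomputable def wallNormal (m : ℕ) (w : ℝ × ℝ × ℝ) (ℓ : ℕ) : ℝ × ℝ × ℝ :=
  (1, ℓ - m * (if 0 < w.2.1 then 1 else 0), m * (if 0 < w.2.2 then 1 else 0) - ℓ)

/-- The direction of the face in direction `w`, in the coordinates `x₀, s₀, t₀`. -/
def faceDirection (m : ℕ) (w : ℝ × ℝ × ℝ) : Submodule ℝ (ℝ × ℝ × ℝ) :=
  Submodule.span ℝ {x | (w.1 = 0 ∧ x = (1, 0, 0)) ∨ (w.2.1 = 0 ∧ x = (0, 1, 0)) ∨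
    (w.2.2 = 0 ∧ x = (0, 0, 1)) ∨ ∃ ℓ ≤ m, coinGap m w ℓ = 0 ∧ x = wallNormal m w ℓ}

section FaceDirection

variable {m : ℕ} {w : ℝ × ℝ × ℝ}

theorem faceDirection_u (h : w.1 = 0) (c : ℝ) : (c, 0, 0) ∈ faceDirection m w := by
  have := (faceDirection m w).smul_mem c (Submodule.subset_span (Or.inl ⟨h, rfl⟩))
  simpa using this

theorem faceDirection_s (h : w.2.1 = 0) (c : ℝ) : (0, c, 0) ∈ faceDirection m w := by
  have := (faceDirection m w).smul_mem c (Submodule.subset_span (Or.inr (Or.inl ⟨h, rfl⟩)))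
  simpa using this

theorem faceDirection_t (h : w.2.2 = 0) (c : ℝ) : (0, 0, c) ∈ faceDirection m w := by
  have := (faceDirection m w).smul_mem c
    (Submodule.subset_span (Or.inr (Or.inr (Or.inl ⟨h, rfl⟩))))
  simpa using this

theorem wallNormal_mem {ℓ : ℕ} (hℓ : ℓ ≤ m) (h : coinGap m w ℓ = 0) :
    wallNormal m w ℓ ∈ faceDirection m w :=
  Submodule.subset_span (Or.inr (Or.inr (Or.inr ⟨ℓ, hℓ, h, rfl⟩)))

theorem isMaxEnd_sub {x c c' : ℝ} (h : IsMaxEnd x c) (h' : IsMaxEnd x c') : x = 0 ∨ c - c' = 0 := by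
  rcases h with ⟨rfl, h⟩ | ⟨rfl, h⟩ <;> rcases h' with ⟨rfl, h'⟩ | ⟨rfl, h'⟩
  · simp
  · exact Or.inl (le_antisymm h h')
  · exact Or.inl (le_antisymm h' h)
  · simp

theorem faceDirection_s_of_sub {c c' : ℝ} (h : IsMaxEnd w.2.1 c) (h' : IsMaxEnd w.2.1 c') (r : ℝ) :
    (0, r * (c - c'), 0) ∈ faceDirection m w := by
  rcases isMaxEnd_sub h h' with h | h
  · exact faceDirection_s h _
  · rw [h, mul_zero]
    exact Submodule.zero_mem _

theorem faceDirection_t_of_sub {c c' : ℝ} (h : IsMaxEnd w.2.2 c) (h' : IsMaxEnd w.2.2 c') (r : ℝ) :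
    (0, 0, r * (c - c')) ∈ faceDirection m w := by
  rcases isMaxEnd_sub h h' with h | h
  · exact faceDirection_t h _
  · rw [h, mul_zero]
    exact Submodule.zero_mem _

theorem isMaxEnd_indicator (x : ℝ) : IsMaxEnd x (if 0 < x then 1 else 0) := by
  split_ifs with h
  · exact Or.inr ⟨rfl, h.le⟩
  · exact Or.inl ⟨rfl, not_lt.1 h⟩

theorem vectorSpan_toExposed_boxPoints_le (hm : 1 ≤ m) (l : StrongDual ℝ (Fin 6 → ℝ)) :
    vectorSpan ℝ (l.toExposed (boxPoints m)) ≤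
      (faceDirection m (coinWeight l)).map coinVector := by
  rw [toExposed_boxPoints m hm, vectorSpan_def, Submodule.span_le]
  rintro _ ⟨_, ⟨i, a, b, hi, ha, hb, rfl⟩, _, ⟨i', a', b', hi', ha', hb', rfl⟩, rfl⟩
  refine ⟨_, ?_, (coinPoint_sub m _ _ _ _ _ _).symm⟩
  have h1 : (i - i', (0 : ℝ), (0 : ℝ)) ∈ faceDirection m (coinWeight l) := by
    rcases isMaxEnd_sub hi hi' with h | h
    · exact faceDirection_u h _
    · rw [h]
      exact Submodule.zero_mem _
  have := Submodule.add_mem _ (Submodule.add_mem _ h1 (faceDirection_s_of_sub ha ha' (m : ℝ)))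
    (faceDirection_t_of_sub hb hb' (m : ℝ))
  simpa [mul_sub] using this

theorem vectorSpan_toExposed_tetraPoints_le (hm : 1 ≤ m) {ℓ : ℕ} (hℓ : ℓ ≤ m)
    (l : StrongDual ℝ (Fin 6 → ℝ)) :
    vectorSpan ℝ (l.toExposed (tetraPoints m ℓ)) ≤
      (faceDirection m (coinWeight l)).map coinVector := by
  have key : ∀ a b, coinGap m (coinWeight l) ℓ = 0 → IsMaxEnd (coinWeight l).2.1 a →
      IsMaxEnd (coinWeight l).2.2 b →
      ((1 : ℝ), (ℓ - m * a : ℝ), (m * b - ℓ : ℝ)) ∈ faceDirection m (coinWeight l) := by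
    intro a b h ha hb
    have := Submodule.add_mem _ (Submodule.add_mem _ (wallNormal_mem hℓ h)
      (faceDirection_s_of_sub (isMaxEnd_indicator _) ha (m : ℝ)))
      (faceDirection_t_of_sub hb (isMaxEnd_indicator _) (m : ℝ))
    convert this using 1
    simp only [wallNormal, Prod.mk_add_mk, Prod.mk.injEq]
    refine ⟨by ring, by ring, by ring⟩
  rw [toExposed_tetraPoints m ℓ hm, vectorSpan_def, Submodule.span_le]
  rintro _ ⟨_, ⟨hg, b, hb, rfl⟩ | ⟨hg, a, ha, rfl⟩, _, ⟨hg', b', hb', rfl⟩ | ⟨hg', a', ha', rfl⟩, rfl⟩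
  all_goals refine ⟨_, ?_, (coinPoint_sub m _ _ _ _ _ _).symm⟩
  · have := faceDirection_t_of_sub (m := m) hb hb' (m : ℝ)
    simpa [mul_sub] using this
  · have := key a' b (le_antisymm hg' hg) ha' hb
    simpa using this
  · have := Submodule.neg_mem _ (key a b' (le_antisymm hg hg') ha hb')
    simpa using this
  · have := faceDirection_s_of_sub (m := m) ha ha' (m : ℝ)
    simpa [mul_sub] using this

/-- The direction of a sum is the join of the directions of the summands. A box face contributes the
coordinate axes of zero weight; a tetrahedron face contributes moves along its two edges, already
covered by those axes, and one vector joining the edges when the gap vanishes. -/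
theorem vectorSpan_coinFace (hm : 1 ≤ m) (w : ℝ × ℝ × ℝ) :
    vectorSpan ℝ (coinFace m w) = (faceDirection m w).map coinVector := by
  have hm' : (m : ℝ) ≠ 0 := by positivity
  set l := coinFunctional w with hl
  have hw : coinWeight l = w := coinWeight_coinFunctional w
  have hB : (l.toExposed (boxPoints m)).Nonempty :=
    toExposed_nonempty_of_finite l (boxPoints_finite m) (boxPoints_nonempty m)
  have hT : ∀ ℓ, (l.toExposed (tetraPoints m ℓ)).Nonempty := fun ℓ =>
    toExposed_nonempty_of_finite l (tetraPoints_finite m ℓ) (tetraPoints_nonempty m ℓ)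
  have e : vectorSpan ℝ (coinFace m w) = vectorSpan ℝ (l.toExposed (boxPoints m)) ⊔
      ⨆ ℓ ∈ Finset.range (m + 1), vectorSpan ℝ (l.toExposed (tetraPoints m ℓ)) := by
    rw [coinFace, coinPolytope_eq hm, toExposed_add, toExposed_sum, ← hl,
      toExposed_convexHull l (boxPoints_finite m)]
    simp only [fun ℓ => toExposed_convexHull l (tetraPoints_finite m ℓ)]
    rw [vectorSpan_add_of_nonempty hB.convexHull
      (Set.finset_sum_nonempty _ _ fun ℓ _ => (hT ℓ).convexHull),
      vectorSpan_sum_of_nonempty _ _ fun ℓ _ => (hT ℓ).convexHull]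
    simp only [vectorSpan_convexHull]
  rw [e]
  apply le_antisymm
  · refine sup_le ?_ (iSup₂_le fun ℓ hℓ => ?_)
    · rw [← hw]
      exact vectorSpan_toExposed_boxPoints_le hm l
    · rw [← hw]
      exact vectorSpan_toExposed_tetraPoints_le hm (Nat.lt_succ_iff.1 (Finset.mem_range.1 hℓ)) l
  · rw [faceDirection, Submodule.map_span, Submodule.span_le]
    have hi := isMaxEnd_indicator w.1
    have ha := isMaxEnd_indicator w.2.1
    have hb := isMaxEnd_indicator w.2.2
    have z0 : IsMaxEnd 0 0 := Or.inl ⟨rfl, le_rfl⟩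
    have z1 : IsMaxEnd 0 1 := Or.inr ⟨rfl, le_rfl⟩
    have hbox : ∀ i a b i' a' b', IsMaxEnd w.1 i → IsMaxEnd w.2.1 a → IsMaxEnd w.2.2 b →
        IsMaxEnd w.1 i' → IsMaxEnd w.2.1 a' → IsMaxEnd w.2.2 b' →
        coinVector (i - i', m * a - m * a', m * b - m * b') ∈
          vectorSpan ℝ (l.toExposed (boxPoints m)) := by
      intro i a b i' a' b' hi ha hb hi' ha' hb'
      rw [← coinPoint_sub m]
      apply vsub_mem_vectorSpan <;> rw [toExposed_boxPoints m hm, hw]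
      · exact ⟨i, a, b, hi, ha, hb, rfl⟩
      · exact ⟨i', a', b', hi', ha', hb', rfl⟩
    rintro _ ⟨x, ⟨h, rfl⟩ | ⟨h, rfl⟩ | ⟨h, rfl⟩ | ⟨ℓ, hℓ, h, rfl⟩, rfl⟩
    · apply Submodule.mem_sup_left
      have := hbox 1 _ _ 0 _ _ (h ▸ z1) ha hb (h ▸ z0) ha hb
      simpa using this
    · apply Submodule.mem_sup_left
      have := Submodule.smul_mem _ (m : ℝ)⁻¹ (hbox _ 1 _ _ 0 _ hi (h ▸ z1) hb hi (h ▸ z0) hb)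
      rw [← map_smul] at this
      simpa [hm'] using this
    · apply Submodule.mem_sup_left
      have := Submodule.smul_mem _ (m : ℝ)⁻¹ (hbox _ _ 1 _ _ 0 hi ha (h ▸ z1) hi ha (h ▸ z0))
      rw [← map_smul] at this
      simpa [hm'] using this
    · apply Submodule.mem_sup_right
      apply Submodule.mem_iSup_of_mem ℓ
      apply Submodule.mem_iSup_of_mem (Finset.mem_range.2 (Nat.lt_succ_iff.2 hℓ))
      have : coinVector (wallNormal m w ℓ) =
          coinPoint m 1 ℓ (m * (if 0 < w.2.2 then 1 else 0)) -
            coinPoint m 0 (m * (if 0 < w.2.1 then 1 else 0)) ℓ := by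
        rw [coinPoint_sub, sub_zero, wallNormal]
      rw [this]
      apply vsub_mem_vectorSpan <;> rw [toExposed_tetraPoints m ℓ hm, hw]
      · exact Or.inl ⟨h.ge, _, hb, rfl⟩
      · exact Or.inr ⟨h.le, _, ha, rfl⟩

theorem polyDim_coinFace (hm : 1 ≤ m) (w : ℝ × ℝ × ℝ) :
    polyDim (coinFace m w) = Module.finrank ℝ (faceDirection m w) := by
  rw [polyDim, vectorSpan_coinFace hm]
  exact (LinearEquiv.finrank_eq (Submodule.equivMapOfInjective _ coinVector_injective _)).symm

theorem two_le_finrank_of_mem {D : Submodule ℝ (ℝ × ℝ × ℝ)} {x y : ℝ × ℝ × ℝ} (hx : x ∈ D)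
    (hy : y ∈ D) (h : ∀ s t : ℝ, s • x + t • y = 0 → s = 0 ∧ t = 0) : 2 ≤ Module.finrank ℝ D := by
  have hli : LinearIndependent ℝ ![x, y] := LinearIndependent.pair_iff.2 h
  have := finrank_span_eq_card hli
  refine this.symm.le.trans (Submodule.finrank_mono ?_)
  rw [Submodule.span_le]
  rintro _ ⟨j, rfl⟩
  fin_cases j <;> assumption

theorem coinGap_eq (m : ℕ) (w : ℝ × ℝ × ℝ) (ℓ : ℕ) :
    coinGap m w ℓ = w.1 + ℓ * (w.2.1 - w.2.2) + m * (max w.2.2 0 - max w.2.1 0) := by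
  rw [coinGap]
  ring

/-- All generators lie in the plane orthogonal to `w`: the pairing of `w` with `wallNormal m w ℓ` is
exactly the gap at `ℓ`. -/
theorem finrank_faceDirection_le (hw : w ≠ 0) : Module.finrank ℝ (faceDirection m w) ≤ 2 := by
  let f : Module.Dual ℝ (ℝ × ℝ × ℝ) := w.1 • LinearMap.fst ℝ _ _ +
    w.2.1 • (LinearMap.fst ℝ _ _ ∘ₗ LinearMap.snd ℝ _ _) +
    w.2.2 • (LinearMap.snd ℝ _ _ ∘ₗ LinearMap.snd ℝ _ _)
  have hf : f ≠ 0 := by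
    intro h
    apply hw
    have h1 := LinearMap.congr_fun h (1, 0, 0)
    have h2 := LinearMap.congr_fun h (0, 1, 0)
    have h3 := LinearMap.congr_fun h (0, 0, 1)
    simp [f] at h1 h2 h3
    exact Prod.ext h1 (Prod.ext h2 h3)
  have h1 := Module.Dual.finrank_ker_add_one_of_ne_zero hf
  have h2 : faceDirection m w ≤ LinearMap.ker f := by
    rw [faceDirection, Submodule.span_le]
    rintro _ (⟨h, rfl⟩ | ⟨h, rfl⟩ | ⟨h, rfl⟩ | ⟨ℓ, hℓ, h, rfl⟩)
    · simp [f, h]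
    · simp [f, h]
    · simp [f, h]
    · have e1 := (isMaxEnd_indicator w.2.1).mul_eq
      have e2 := (isMaxEnd_indicator w.2.2).mul_eq
      simp only [SetLike.mem_coe, LinearMap.mem_ker]
      rw [coinGap_eq, ← e1, ← e2] at h
      simp only [f, wallNormal, LinearMap.add_apply, LinearMap.smul_apply, LinearMap.comp_apply,
        LinearMap.fst_apply, LinearMap.snd_apply, smul_eq_mul]
      linarith
  have h3 := Submodule.finrank_mono h2
  have h4 : Module.finrank ℝ (ℝ × ℝ × ℝ) = 3 := by simp
  omega

theorem finrank_faceDirection_eq_two (hw : w ≠ 0) {x y : ℝ × ℝ × ℝ} (hx : x ∈ faceDirection m w)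
    (hy : y ∈ faceDirection m w) (h : ∀ s t : ℝ, s • x + t • y = 0 → s = 0 ∧ t = 0) :
    Module.finrank ℝ (faceDirection m w) = 2 :=
  le_antisymm (finrank_faceDirection_le hw) (two_le_finrank_of_mem hx hy h)

theorem finrank_faceDirection_eq_one {x : ℝ × ℝ × ℝ} (hx : x ∈ faceDirection m w) (hx0 : x ≠ 0)
    (h : faceDirection m w ≤ Submodule.span ℝ {x}) :
    Module.finrank ℝ (faceDirection m w) = 1 := by
  rw [le_antisymm h ((Submodule.span_singleton_le_iff_mem _ _).2 hx), finrank_span_singleton hx0]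

open Classical in
/-- The dimension of the face in direction `w`. -/
noncomputable def coinDim (m : ℕ) (w : ℝ × ℝ × ℝ) : ℕ :=
  if w.1 ≠ 0 then (if w.2.1 = 0 then 1 else 0) + (if w.2.2 = 0 then 1 else 0) +
    (if ∃ ℓ ≤ m, coinGap m w ℓ = 0 then 1 else 0)
  else if w.2.1 = 0 ∧ w.2.2 = 0 then 3
  else if w.2.1 = 0 ∨ w.2.2 = 0 ∨ w.2.1 = w.2.2 ∨
    (w.2.1 * w.2.2 < 0 ∧ ∃ ℓ ≤ m, coinGap m w ℓ = 0) then 2 else 1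

/-- The gap is affine in `ℓ` with slope `a - b`; two zeros force the slope to vanish, and then the
gap is the constant `u`. -/
theorem coinGap_eq_of_eq_zero_of_eq_zero {ℓ ℓ' : ℕ} (h : coinGap m w ℓ = 0)
    (h' : coinGap m w ℓ' = 0) : ℓ = ℓ' ∨ (w.1 = 0 ∧ w.2.1 = w.2.2) := by
  by_cases hℓ : ℓ = ℓ'
  · exact Or.inl hℓ
  right
  rw [coinGap_eq] at h h'
  have h1 : ((ℓ : ℝ) - ℓ') * (w.2.1 - w.2.2) = 0 := by linarith
  have h2 : (ℓ : ℝ) - ℓ' ≠ 0 := sub_ne_zero.2 (by exact_mod_cast hℓ)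
  have h3 : w.2.1 = w.2.2 := sub_eq_zero.1 ((mul_eq_zero.1 h1).resolve_left h2)
  rw [h3] at h
  exact ⟨by linarith, h3⟩

/-- For `u ≠ 0` at most one gap vanishes unless it is counted out by
`coinGap_eq_of_eq_zero_of_eq_zero`, so the generators are few and explicit. For `u = 0` the first
axis is always present, and a vanishing gap adds a dimension only if its normal is not that axis. -/
theorem finrank_faceDirection (hm : 1 ≤ m) :
    Module.finrank ℝ (faceDirection m w) = coinDim m w := by
  obtain ⟨u, a, b⟩ := w
  have hm' : (m : ℝ) ≠ 0 := by positivity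
  by_cases hu : u = 0
  · subst hu
    have hU := faceDirection_u (m := m) (w := (0, a, b)) rfl 1
    by_cases ha : a = 0
    · subst ha
      have hA := faceDirection_s (m := m) (w := (0, 0, b)) rfl 1
      by_cases hb : b = 0
      · subst hb
        have hB := faceDirection_t (m := m) (w := (0, 0, 0)) rfl 1
        have : faceDirection m (0, 0, 0) = ⊤ := by
          rw [eq_top_iff]
          rintro ⟨x, y, z⟩ -
          have := Submodule.add_mem _ (Submodule.add_mem _ (Submodule.smul_mem _ x hU)
            (Submodule.smul_mem _ y hA)) (Submodule.smul_mem _ z hB)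
          simpa using this
        rw [this]
        simp [coinDim]
      · rw [finrank_faceDirection_eq_two (by simp [hb]) hU hA (by simp)]
        simp [coinDim, hb]
    · by_cases hb : b = 0
      · subst hb
        have hB := faceDirection_t (m := m) (w := (0, a, 0)) rfl 1
        rw [finrank_faceDirection_eq_two (by simp [ha]) hU hB (by simp)]
        simp [coinDim, ha]
      · by_cases hex : a = b ∨ (a * b < 0 ∧ ∃ ℓ ≤ m, coinGap m (0, a, b) ℓ = 0)
        · have : ∃ ℓ ≤ m, coinGap m (0, a, b) ℓ = 0 ∧
              (wallNormal m (0, a, b) ℓ).2 ≠ 0 := by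
            -- If `a = b`, every gap vanishes, and `ℓ` is taken at the end where the last two
            -- coordinates of the normal, `±ℓ` or `±(m - ℓ)`, are nonzero. If `a` and `b` have
            -- opposite signs these coordinates never vanish together.
            rcases hex with rfl | ⟨hab, ℓ, hℓ, h⟩
            · rcases lt_or_gt_of_ne ha with h | h
              · exact ⟨m, le_rfl, by simp [coinGap], by simp [wallNormal, h.not_gt]; omega⟩
              · exact ⟨0, by simp, by simp [coinGap], by simp [wallNormal, h]; omega⟩
            · refine ⟨ℓ, hℓ, h, ?_⟩
              rcases lt_or_gt_of_ne ha with ha | ha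
              · have hb : 0 < b := by nlinarith
                simp [wallNormal, ha.not_gt, hb, sub_eq_zero]
                rintro rfl
                simpa using hm'
              · have hb : b < 0 := by nlinarith
                simp [wallNormal, hb.not_gt, ha, sub_eq_zero]
                intro h
                rw [h]
                omega
          obtain ⟨ℓ, hℓ, h, hne⟩ := this
          rw [finrank_faceDirection_eq_two (by simp [ha]) hU (wallNormal_mem hℓ h)]
          · simp only [coinDim]
            rw [if_neg (by simp), if_neg (by simp [ha]), if_pos (Or.inr (Or.inr hex))]
          · intro s t hst
            have h1 := congrArg Prod.fst hst
            have h2 := congrArg Prod.snd hst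
            have ht : t = 0 := by
              exact (smul_eq_zero.1 (Eq.trans (by simp) h2)).resolve_right hne
            subst ht
            simpa using h1
        · have hab : a ≠ b := fun h => hex (Or.inl h)
          rw [finrank_faceDirection_eq_one hU (by simp)]
          · simp only [coinDim]
            rw [if_neg (by simp), if_neg (by simp [ha]), if_neg (fun h => (h.resolve_left ha).elim hb hex)]
          · conv_lhs => rw [faceDirection]
            rw [Submodule.span_le]
            rintro _ (⟨h, rfl⟩ | ⟨h, rfl⟩ | ⟨h, rfl⟩ | ⟨ℓ, hℓ, h, rfl⟩)
            · exact Submodule.mem_span_singleton_self _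
            · exact absurd h ha
            · exact absurd h hb
            · have hab' : 0 ≤ a * b := by
                by_contra hc
                exact hex (Or.inr ⟨not_le.1 hc, ℓ, hℓ, h⟩)
              have hsub : a - b ≠ 0 := sub_ne_zero.2 hab
              -- With equal signs and `a ≠ b` the gap vanishes only at `ℓ = 0` (negative weights) or
              -- `ℓ = m` (positive weights), where the normal is the first axis and adds nothing.
              have : wallNormal m (0, a, b) ℓ = (1, 0, 0) := by
                rcases lt_or_gt_of_ne ha with ha' | ha'
                · have hb' : b < 0 := lt_of_le_of_ne (by nlinarith) hb
                  rw [coinGap_eq] at h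
                  simp [ha'.le, hb'.le, hsub] at h
                  simp [wallNormal, ha'.not_gt, hb'.not_gt, h]
                · have hb' : 0 < b := lt_of_le_of_ne (by nlinarith) (Ne.symm hb)
                  rw [coinGap_eq] at h
                  simp only [max_eq_left ha'.le, max_eq_left hb'.le] at h
                  have h2 : ((ℓ : ℝ) - m) * (a - b) = 0 := by linarith
                  have h3 := (mul_eq_zero.1 h2).resolve_right hsub
                  simp [wallNormal, ha', hb', h3]
                  linarith
              rw [this]
              exact Submodule.mem_span_singleton_self _
  · have huniq : ∀ ℓ ℓ', coinGap m (u, a, b) ℓ = 0 → coinGap m (u, a, b) ℓ' = 0 → ℓ = ℓ' :=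
      fun ℓ ℓ' h h' => (coinGap_eq_of_eq_zero_of_eq_zero h h').resolve_right fun h => hu h.1
    have hw0 : (u, a, b) ≠ 0 := by simp [hu]
    simp only [coinDim]
    rw [if_pos hu]
    by_cases ha : a = 0
    · subst ha
      have hA := faceDirection_s (m := m) (w := (u, 0, b)) rfl 1
      by_cases hb : b = 0
      · subst hb
        have hB := faceDirection_t (m := m) (w := (u, 0, 0)) rfl 1
        rw [finrank_faceDirection_eq_two hw0 hA hB (by simp)]
        simp [coinGap, hu]
      · by_cases hex : ∃ ℓ ≤ m, coinGap m (u, 0, b) ℓ = 0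
        · obtain ⟨ℓ, hℓ, h⟩ := id hex
          rw [finrank_faceDirection_eq_two hw0 (wallNormal_mem hℓ h) hA, if_pos rfl, if_neg hb,
            if_pos hex]
          simp only [wallNormal, Prod.smul_mk, Prod.mk_add_mk, smul_eq_mul]
          intro s t hst
          have h1 := congrArg Prod.fst hst
          have h2 := congrArg (fun x => x.2.1) hst
          simp at h1
          subst h1
          simpa using h2
        · rw [finrank_faceDirection_eq_one hA (by simp), if_pos rfl, if_neg hb, if_neg hex]
          conv_lhs => rw [faceDirection]
          rw [Submodule.span_le]
          rintro _ (⟨h, rfl⟩ | ⟨h, rfl⟩ | ⟨h, rfl⟩ | ⟨ℓ, hℓ, h, rfl⟩)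
          · exact absurd h hu
          · exact Submodule.mem_span_singleton_self _
          · exact absurd h hb
          · exact absurd ⟨ℓ, hℓ, h⟩ hex
    · by_cases hb : b = 0
      · subst hb
        have hB := faceDirection_t (m := m) (w := (u, a, 0)) rfl 1
        by_cases hex : ∃ ℓ ≤ m, coinGap m (u, a, 0) ℓ = 0
        · obtain ⟨ℓ, hℓ, h⟩ := id hex
          rw [finrank_faceDirection_eq_two hw0 (wallNormal_mem hℓ h) hB, if_pos rfl, if_neg ha,
            if_pos hex]
          simp only [wallNormal, Prod.smul_mk, Prod.mk_add_mk, smul_eq_mul]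
          intro s t hst
          have h1 := congrArg Prod.fst hst
          have h2 := congrArg (fun x => x.2.2) hst
          simp at h1
          subst h1
          simpa using h2
        · rw [finrank_faceDirection_eq_one hB (by simp), if_pos rfl, if_neg ha, if_neg hex]
          conv_lhs => rw [faceDirection]
          rw [Submodule.span_le]
          rintro _ (⟨h, rfl⟩ | ⟨h, rfl⟩ | ⟨h, rfl⟩ | ⟨ℓ, hℓ, h, rfl⟩)
          · exact absurd h hu
          · exact absurd h ha
          · exact Submodule.mem_span_singleton_self _
          · exact absurd ⟨ℓ, hℓ, h⟩ hex
      · by_cases hex : ∃ ℓ ≤ m, coinGap m (u, a, b) ℓ = 0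
        · obtain ⟨ℓ, hℓ, h⟩ := id hex
          rw [finrank_faceDirection_eq_one (wallNormal_mem hℓ h), if_neg ha, if_neg hb,
            if_pos hex]
          · simp [wallNormal]
          · conv_lhs => rw [faceDirection]
            rw [Submodule.span_le]
            rintro _ (⟨h, rfl⟩ | ⟨h, rfl⟩ | ⟨h, rfl⟩ | ⟨ℓ', hℓ', h', rfl⟩)
            · exact absurd h hu
            · exact absurd h ha
            · exact absurd h hb
            · rw [huniq _ _ h' h]
              exact Submodule.mem_span_singleton_self _
        · have : faceDirection m (u, a, b) = ⊥ := by
            rw [faceDirection, Submodule.span_eq_bot]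
            rintro _ (⟨h, rfl⟩ | ⟨h, rfl⟩ | ⟨h, rfl⟩ | ⟨ℓ', hℓ', h', rfl⟩)
            · exact absurd h hu
            · exact absurd h ha
            · exact absurd h hb
            · exact absurd ⟨ℓ', hℓ', h'⟩ hex
          rw [this, if_neg ha, if_neg hb, if_neg hex]
          simp

theorem polyDim_coinFace_eq_coinDim (hm : 1 ≤ m) (w : ℝ × ℝ × ℝ) :
    polyDim (coinFace m w) = coinDim m w := by
  rw [polyDim_coinFace hm, finrank_faceDirection hm]

end FaceDirection

/-! ### Counting faces by counting sign vectors. -/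

theorem Set.ncard_image_eq_of_forall_eq_iff {α β γ : Type*} {f : α → β} {g : α → γ} (X : Set α)
    (h : ∀ x ∈ X, ∀ y ∈ X, f x = f y ↔ g x = g y) : (f '' X).ncard = (g '' X).ncard := by
  classical
  refine Set.ncard_congr (fun b hb => g hb.choose) ?_ ?_ ?_
  · exact fun b hb => ⟨_, hb.choose_spec.1, rfl⟩
  · intro b b' hb hb' hg
    rw [← hb.choose_spec.2, ← hb'.choose_spec.2]
    exact (h _ hb.choose_spec.1 _ hb'.choose_spec.1).2 hg
  · rintro _ ⟨x, hx, rfl⟩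
    have hfx : f x ∈ f '' X := ⟨x, hx, rfl⟩
    exact ⟨f x, hfx, (h _ hfx.choose_spec.1 _ hx).1 hfx.choose_spec.2⟩

/-- The number of faces of the polytope with directions in `X`. -/
noncomputable def faceCount (m : ℕ) (X : Set (ℝ × ℝ × ℝ)) : ℕ := (coinType m '' X).ncard

theorem ncard_image_coinFace {m : ℕ} (hm : 1 ≤ m) (X : Set (ℝ × ℝ × ℝ)) :
    (coinFace m '' X).ncard = faceCount m X :=
  Set.ncard_image_eq_of_forall_eq_iff X fun w _ w' _ => coinFace_eq_iff hm w w'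

theorem eq_singleton_of_polyDim_eq_zero {F : Set (Fin 6 → ℝ)} (hF : F.Nonempty)
    (h : polyDim F = 0) : ∃ v, F = {v} := by
  obtain ⟨v, hv⟩ := hF
  rw [polyDim, Submodule.finrank_eq_zero] at h
  refine ⟨v, Set.Subset.antisymm (fun y hy => ?_) (by simpa using hv)⟩
  have := vsub_mem_vectorSpan ℝ hy hv
  rw [h, Submodule.mem_bot, vsub_eq_sub, sub_eq_zero] at this
  exact this

theorem polyDim_singleton {E : Type*} [AddCommGroup E] [Module ℝ E] (v : E) :
    polyDim ({v} : Set E) = 0 := by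
  rw [polyDim, vectorSpan_singleton, finrank_bot]

theorem mem_polyVertices_coinPolytope_iff {m : ℕ} (hm : 1 ≤ m) {v : Fin 6 → ℝ} :
    v ∈ polyVertices (coinPolytope m) ↔ ∃ w, coinDim m w = 0 ∧ coinFace m w = {v} := by
  change {v} ∈ polyFaces (coinPolytope m) ↔ _
  rw [polyFaces_coinPolytope hm]
  refine exists_congr fun w => ⟨fun h => ⟨?_, h⟩, fun h => h.2⟩
  rw [← polyDim_coinFace_eq_coinDim hm, h, polyDim_singleton]

/-- Turns a condition on vertices into a condition on the directions exposing them; used for the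
vertices of a facet and for those above a corner of the cube. -/
theorem ncard_polyVertices_filter {m : ℕ} (hm : 1 ≤ m) (q : (Fin 6 → ℝ) → Prop)
    (Q : ℝ × ℝ × ℝ → Prop)
    (h : ∀ w v, coinDim m w = 0 → coinFace m w = {v} → (q v ↔ Q w)) :
    {v ∈ polyVertices (coinPolytope m) | q v}.ncard = faceCount m {w | coinDim m w = 0 ∧ Q w} := by
  rw [← ncard_image_coinFace hm, ← Set.ncard_image_of_injective _ Set.singleton_injective]
  congr 1
  ext F
  constructor
  · rintro ⟨v, ⟨hv, hq⟩, rfl⟩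
    obtain ⟨w, hw, e⟩ := (mem_polyVertices_coinPolytope_iff hm).1 hv
    exact ⟨w, ⟨hw, (h w v hw e).1 hq⟩, e⟩
  · rintro ⟨w, ⟨hw, hQ⟩, rfl⟩
    obtain ⟨v, e⟩ := eq_singleton_of_polyDim_eq_zero (coinFace_nonempty hm w)
      ((polyDim_coinFace_eq_coinDim hm w).trans hw)
    exact ⟨v, ⟨(mem_polyVertices_coinPolytope_iff hm).2 ⟨w, hw, e⟩, (h w v hw e).2 hQ⟩, e.symm⟩

/-- The signs of the three weights. -/
noncomputable def weightSigns (w : ℝ × ℝ × ℝ) : SignType × SignType × SignType :=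
  (SignType.sign w.1, SignType.sign w.2.1, SignType.sign w.2.2)

/-- The sign triple is part of the sign vector, so directions with different triples never expose
the same face. -/
theorem faceCount_eq_sum (m : ℕ) (X : Set (ℝ × ℝ × ℝ))
    (T : Finset (SignType × SignType × SignType)) (hT : ∀ w ∈ X, weightSigns w ∈ T) :
    faceCount m X = ∑ σ ∈ T, faceCount m {w | weightSigns w = σ ∧ w ∈ X} := by
  classical
  have hfin : ∀ Y : Set ((SignType × SignType × SignType) × (Fin (m + 1) → SignType)),
      Y.Finite := fun Y => Y.toFinite
  have h1 : ∀ σ, coinType m '' {w | weightSigns w = σ ∧ w ∈ X} =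
      {t ∈ coinType m '' X | t.1 = σ} := by
    intro σ
    ext t
    constructor
    · rintro ⟨w, ⟨hσ, hw⟩, rfl⟩
      exact ⟨⟨w, hw, rfl⟩, hσ⟩
    · rintro ⟨⟨w, hw, rfl⟩, hσ⟩
      exact ⟨w, ⟨hσ, hw⟩, rfl⟩
  simp only [faceCount, h1]
  rw [Set.ncard_eq_toFinset_card _ (hfin _), Finset.card_eq_sum_card_fiberwise (f := Prod.fst)
    (t := T)]
  · refine Finset.sum_congr rfl fun σ _ => ?_
    rw [Set.ncard_eq_toFinset_card _ (hfin _)]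
    congr 1
    ext t
    simp
  · intro t ht
    simp only [Set.Finite.coe_toFinset] at ht
    obtain ⟨w, hw, rfl⟩ := ht
    exact hT w hw

/-! ### Symmetries -/

/-- The exchange of the two coins, on directions. -/
def swapWeight (w : ℝ × ℝ × ℝ) : ℝ × ℝ × ℝ := (-w.1, w.2.2, w.2.1)

/-- The exchange of heads and tails, on directions. -/
def flipWeight (w : ℝ × ℝ × ℝ) : ℝ × ℝ × ℝ := (w.1, -w.2.1, -w.2.2)

theorem swapWeight_swapWeight (w : ℝ × ℝ × ℝ) : swapWeight (swapWeight w) = w := by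
  simp [swapWeight]

theorem flipWeight_flipWeight (w : ℝ × ℝ × ℝ) : flipWeight (flipWeight w) = w := by
  simp [flipWeight]

theorem coinGap_swapWeight (m : ℕ) (w : ℝ × ℝ × ℝ) (ℓ : ℕ) :
    coinGap m (swapWeight w) ℓ = -coinGap m w ℓ := by
  simp only [coinGap, swapWeight]
  ring

theorem max_neg_self_zero (x : ℝ) : max (-x) 0 = max x 0 - x := by
  rcases le_total x 0 with h | h
  · rw [max_eq_left (by linarith), max_eq_right h, zero_sub]
  · rw [max_eq_right (by linarith), max_eq_left h, sub_self]

/-- Exchanging heads and tails turns `ℓ` heads into `m - ℓ`, reversing the progression of gaps. -/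
theorem coinGap_flipWeight {m ℓ : ℕ} (hℓ : ℓ ≤ m) (w : ℝ × ℝ × ℝ) :
    coinGap m (flipWeight w) ℓ = coinGap m w (m - ℓ) := by
  simp only [coinGap, flipWeight, max_neg_self_zero, Nat.cast_sub hℓ]
  ring

theorem exists_coinGap_flipWeight (m : ℕ) (w : ℝ × ℝ × ℝ) :
    (∃ ℓ ≤ m, coinGap m (flipWeight w) ℓ = 0) ↔ ∃ ℓ ≤ m, coinGap m w ℓ = 0 := by
  constructor
  · rintro ⟨ℓ, hℓ, h⟩
    exact ⟨m - ℓ, Nat.sub_le _ _, by rwa [← coinGap_flipWeight hℓ]⟩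
  · rintro ⟨ℓ, hℓ, h⟩
    refine ⟨m - ℓ, Nat.sub_le _ _, ?_⟩
    rwa [coinGap_flipWeight (Nat.sub_le _ _), Nat.sub_sub_self hℓ]

theorem coinDim_swapWeight (m : ℕ) (w : ℝ × ℝ × ℝ) : coinDim m (swapWeight w) = coinDim m w := by
  have h1 : (swapWeight w).1 = -w.1 := rfl
  have h2 : (swapWeight w).2.1 = w.2.2 := rfl
  have h3 : (swapWeight w).2.2 = w.2.1 := rfl
  unfold coinDim
  simp only [coinGap_swapWeight, neg_eq_zero, h1, h2, h3, ne_eq]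
  have e1 : (w.2.2 = 0 ∧ w.2.1 = 0) ↔ (w.2.1 = 0 ∧ w.2.2 = 0) := and_comm
  have e2 : (w.2.2 = 0 ∨ w.2.1 = 0 ∨ w.2.2 = w.2.1 ∨
      w.2.2 * w.2.1 < 0 ∧ ∃ ℓ ≤ m, coinGap m w ℓ = 0) ↔
      (w.2.1 = 0 ∨ w.2.2 = 0 ∨ w.2.1 = w.2.2 ∨
      w.2.1 * w.2.2 < 0 ∧ ∃ ℓ ≤ m, coinGap m w ℓ = 0) := by
    rw [or_left_comm, eq_comm (a := w.2.2) (b := w.2.1), mul_comm]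
  simp only [e1, e2, add_comm (if w.2.2 = 0 then 1 else 0) (if w.2.1 = 0 then 1 else 0)]

theorem coinDim_flipWeight (m : ℕ) (w : ℝ × ℝ × ℝ) : coinDim m (flipWeight w) = coinDim m w := by
  unfold coinDim
  simp only [exists_coinGap_flipWeight]
  simp only [flipWeight, neg_eq_zero, neg_inj, neg_mul_neg]

theorem faceCount_congr_of_injective {m : ℕ} (X : Set (ℝ × ℝ × ℝ)) (f : ℝ × ℝ × ℝ → ℝ × ℝ × ℝ)
    (hf : ∀ w, f (f w) = w) {g : (SignType × SignType × SignType) × (Fin (m + 1) → SignType) →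
      (SignType × SignType × SignType) × (Fin (m + 1) → SignType)}
    (hg : ∀ t, g (g t) = t) (hfg : ∀ w, coinType m (f w) = g (coinType m w)) :
    faceCount m {w | f w ∈ X} = faceCount m X := by
  have : coinType m '' {w | f w ∈ X} = g '' (coinType m '' X) := by
    ext t
    constructor
    · rintro ⟨w, hw, rfl⟩
      exact ⟨_, ⟨f w, hw, rfl⟩, by rw [← hfg, hf]⟩
    · rintro ⟨_, ⟨w, hw, rfl⟩, rfl⟩
      exact ⟨f w, by simpa [hf] using hw, hfg w⟩
  rw [faceCount, this, Set.ncard_image_of_injective _ (Function.LeftInverse.injective hg), faceCount]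

/-- The exchange of the two coins, on sign data. -/
def swapType {n : ℕ} (t : (SignType × SignType × SignType) × (Fin n → SignType)) :
    (SignType × SignType × SignType) × (Fin n → SignType) :=
  ((-t.1.1, t.1.2.2, t.1.2.1), fun ℓ => -t.2 ℓ)

/-- The exchange of heads and tails, on sign data. -/
def flipType {n : ℕ} (t : (SignType × SignType × SignType) × (Fin n → SignType)) :
    (SignType × SignType × SignType) × (Fin n → SignType) :=
  ((t.1.1, -t.1.2.1, -t.1.2.2), fun ℓ => t.2 ℓ.rev)

theorem coinType_swapWeight (m : ℕ) (w : ℝ × ℝ × ℝ) :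
    coinType m (swapWeight w) = swapType (coinType m w) := by
  simp only [coinType, swapType, coinGap_swapWeight, Left.sign_neg]
  simp only [swapWeight, Left.sign_neg]

theorem coinType_flipWeight (m : ℕ) (w : ℝ × ℝ × ℝ) :
    coinType m (flipWeight w) = flipType (coinType m w) := by
  simp only [coinType, flipType]
  congr 1
  · simp only [flipWeight, Left.sign_neg]
  · funext ℓ
    rw [coinGap_flipWeight (Nat.lt_succ_iff.1 ℓ.2), Fin.val_rev, Nat.add_sub_add_right]

theorem swapType_swapType {n : ℕ} (t : (SignType × SignType × SignType) × (Fin n → SignType)) :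
    swapType (swapType t) = t := by
  simp [swapType]

theorem flipType_flipType {n : ℕ} (t : (SignType × SignType × SignType) × (Fin n → SignType)) :
    flipType (flipType t) = t := by
  simp [flipType]

theorem faceCount_swapWeight (m : ℕ) (X : Set (ℝ × ℝ × ℝ)) :
    faceCount m {w | swapWeight w ∈ X} = faceCount m X :=
  faceCount_congr_of_injective X _ swapWeight_swapWeight swapType_swapType (coinType_swapWeight m)

theorem faceCount_flipWeight (m : ℕ) (X : Set (ℝ × ℝ × ℝ)) :
    faceCount m {w | flipWeight w ∈ X} = faceCount m X :=
  faceCount_congr_of_injective X _ flipWeight_flipWeight flipType_flipType (coinType_flipWeight m)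

theorem SignSpecializes.neg_iff (s t : SignType) :
    SignSpecializes (-s) (-t) ↔ SignSpecializes s t := by
  simp [SignSpecializes]

theorem typeSpecializes_swapType {n : ℕ}
    (s t : (SignType × SignType × SignType) × (Fin n → SignType)) :
    TypeSpecializes (swapType s) (swapType t) ↔ TypeSpecializes s t := by
  simp only [TypeSpecializes, swapType, SignSpecializes.neg_iff]
  tauto

theorem typeSpecializes_flipType {n : ℕ}
    (s t : (SignType × SignType × SignType) × (Fin n → SignType)) :
    TypeSpecializes (flipType s) (flipType t) ↔ TypeSpecializes s t := by
  simp only [TypeSpecializes, flipType, SignSpecializes.neg_iff]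
  refine and_congr_right fun _ => ⟨fun h ℓ => ?_, fun h ℓ => h _⟩
  simpa using h ℓ.rev

theorem typeSpecializes_swapType_right {n : ℕ}
    (s t : (SignType × SignType × SignType) × (Fin n → SignType)) :
    TypeSpecializes s (swapType t) ↔ TypeSpecializes (swapType s) t := by
  rw [← typeSpecializes_swapType, swapType_swapType]

theorem typeSpecializes_flipType_right {n : ℕ}
    (s t : (SignType × SignType × SignType) × (Fin n → SignType)) :
    TypeSpecializes s (flipType t) ↔ TypeSpecializes (flipType s) t := by
  rw [← typeSpecializes_flipType, flipType_flipType]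

theorem weightSigns_swapWeight_eq_iff (w : ℝ × ℝ × ℝ) (a b c : SignType) :
    weightSigns (swapWeight w) = (a, b, c) ↔ weightSigns w = (-a, c, b) := by
  simp only [weightSigns, swapWeight, Left.sign_neg, Prod.mk.injEq, neg_eq_iff_eq_neg]
  tauto

theorem weightSigns_flipWeight_eq_iff (w : ℝ × ℝ × ℝ) (a b c : SignType) :
    weightSigns (flipWeight w) = (a, b, c) ↔ weightSigns w = (a, -b, -c) := by
  simp only [weightSigns, flipWeight, Left.sign_neg, Prod.mk.injEq, neg_eq_iff_eq_neg]

/-! ### Sign patterns of arithmetic progressions. -/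

/-- The sign pattern of an increasing arithmetic progression of length `m + 1`: if `p = 2j` it
changes sign just before `j`, and if `p = 2j + 1` it vanishes at `j`. -/
noncomputable def signPattern (m p : ℕ) (ℓ : Fin (m + 1)) : SignType := SignType.sign ((2 * (ℓ : ℕ) + 1 : ℤ) - p)

theorem signPattern_injOn (m : ℕ) : Set.InjOn (signPattern m) {p | p ≤ 2 * m} := by
  have key : ∀ p p', p ≤ 2 * m → p < p' → signPattern m p ≠ signPattern m p' := by
    intro p p' hp hpp' h
    -- At index `p / 2` the pattern of `p` is positive (even `p`) or zero (odd `p`), and any larger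
    -- `p'` gives a smaller sign there.
    have h1 := congrFun h ⟨p / 2, by omega⟩
    simp only [signPattern] at h1
    rcases Nat.even_or_odd' p with ⟨j, hj | hj⟩
    · rw [sign_pos (by omega), eq_comm, sign_eq_one_iff] at h1
      omega
    · rw [show (2 * ((p / 2 : ℕ) : ℤ) + 1 - p) = 0 by omega, sign_zero, eq_comm,
        sign_eq_zero_iff] at h1
      omega
  intro p hp p' hp' h
  rcases lt_trichotomy p p' with hlt | rfl | hlt
  · exact absurd h (key _ _ hp hlt)
  · rfl
  · exact absurd h.symm (key _ _ hp' hlt)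

/-- With slope at most zero every term is positive and `p = 0`. Otherwise let `j` be the first index
with a nonnegative term: `p` is `2j` or `2j + 1` as that term is positive or zero. Positivity at `m`
excludes `p = 2m + 1`. -/
theorem exists_sign_eq_of_affine {g : ℕ → ℝ} {a d : ℝ} (hg : ∀ ℓ, g ℓ = a + ℓ * d) {m : ℕ}
    (hm : 0 < g m) :
    ∃ p ≤ 2 * m, ∀ ℓ ≤ m, SignType.sign (g ℓ) = SignType.sign ((2 * ℓ + 1 : ℤ) - p) := by
  rcases le_or_gt d 0 with hd | hd
  · refine ⟨0, by omega, fun ℓ hℓ => ?_⟩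
    have h1 : (ℓ : ℝ) ≤ m := by exact_mod_cast hℓ
    have h2 : g m ≤ g ℓ := by
      rw [hg, hg]
      nlinarith
    rw [sign_pos (hm.trans_le h2), sign_pos (by omega)]
  · have hmono : ∀ i j : ℕ, i < j → g i < g j := by
      intro i j hij
      rw [hg, hg]
      have : (i : ℝ) < j := by exact_mod_cast hij
      nlinarith
    classical
    have hex : ∃ ℓ, 0 ≤ g ℓ := ⟨m, hm.le⟩
    have hj := Nat.find_spec hex
    have hjm : Nat.find hex ≤ m := Nat.find_min' hex hm.le
    have hlt : ∀ ℓ < Nat.find hex, g ℓ < 0 := fun ℓ h => not_le.1 (Nat.find_min hex h)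
    set j := Nat.find hex
    rcases hj.lt_or_eq with hpos | hzero
    · refine ⟨2 * j, by omega, fun ℓ hℓ => ?_⟩
      rcases lt_or_ge ℓ j with h | h
      · rw [sign_neg (hlt ℓ h), sign_neg (by omega)]
      · have : 0 < g ℓ := by
          rcases h.lt_or_eq with h | rfl
          · exact hpos.trans (hmono _ _ h)
          · exact hpos
        rw [sign_pos this, sign_pos (by omega)]
    · have : j ≠ m := by
        rintro h
        rw [h] at hzero
        linarith
      refine ⟨2 * j + 1, by omega, fun ℓ hℓ => ?_⟩
      rcases lt_trichotomy ℓ j with h | rfl | h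
      · rw [sign_neg (hlt ℓ h), sign_neg (by omega)]
      · rw [← hzero, sign_zero, eq_comm, sign_eq_zero_iff]
        omega
      · rw [sign_pos (hzero.trans_lt (hmono _ _ h)), sign_pos (by omega)]

theorem sign_mul_intCast {c : ℝ} (hc : 0 < c) (n : ℤ) :
    SignType.sign (c * n) = SignType.sign n := by
  rcases lt_trichotomy n 0 with h | rfl | h
  · rw [sign_neg h, sign_neg]
    exact mul_neg_of_pos_of_neg hc (by exact_mod_cast h)
  · simp
  · rw [sign_pos h, sign_pos]
    exact mul_pos hc (by exact_mod_cast h)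

/-! ### Numbers of faces for each sign triple. -/

section Counts

variable {m : ℕ}

/-- For `a ≥ 0` the terms in `a` cancel at `ℓ = m`, leaving `u + m (max b 0 - b)`. -/
theorem coinGap_last_pos {w : ℝ × ℝ × ℝ} (hu : 0 < w.1) (ha : 0 ≤ w.2.1) : 0 < coinGap m w m := by
  have h1 : w.2.2 ≤ max w.2.2 0 := le_max_left _ _
  have h2 : (m : ℝ) * w.2.2 ≤ m * max w.2.2 0 := mul_le_mul_of_nonneg_left h1 (Nat.cast_nonneg m)
  rw [coinGap, max_eq_left ha]
  linarith

theorem exists_coinType_eq {w : ℝ × ℝ × ℝ} {b : SignType} (h : weightSigns w = (1, 1, b)) :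
    ∃ p ≤ 2 * m, coinType m w = ((1, 1, b), signPattern m p) := by
  have h1 : 0 < w.1 := sign_eq_one_iff.1 (congrArg Prod.fst h)
  have h2 : 0 < w.2.1 := sign_eq_one_iff.1 (congrArg (fun x => x.2.1) h)
  obtain ⟨p, hp, hpat⟩ := exists_sign_eq_of_affine (g := coinGap m w)
    (a := w.1 + m * (max w.2.2 0 - max w.2.1 0)) (d := w.2.1 - w.2.2)
    (fun ℓ => by rw [coinGap_eq]; ring) (coinGap_last_pos h1 h2.le)
  exact ⟨p, hp, Prod.ext h (funext fun ℓ => hpat ℓ (Nat.lt_succ_iff.1 ℓ.2))⟩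

theorem exists_weight_of_signPattern (b : SignType) {p : ℕ} (hp : p ≤ 2 * m) :
    ∃ w, coinType m w = ((1, 1, b), signPattern m p) := by
  obtain ⟨r, hr1, hr2, hr⟩ : ∃ r : ℝ, -1 ≤ r ∧ r ≤ 1 ∧ SignType.sign r = b := by
    rcases b with _ | _ | _
    · exact ⟨0, by norm_num, by norm_num, sign_zero⟩
    · exact ⟨-1, by norm_num, by norm_num, sign_neg (by norm_num)⟩
    · exact ⟨1, by norm_num, by norm_num, sign_pos (by norm_num)⟩
  have hm0 : (0 : ℝ) ≤ m := Nat.cast_nonneg m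
  have hp' : (p : ℝ) ≤ 2 * m := by exact_mod_cast hp
  have hα : 0 < 2 * ((m : ℝ) + 1) + r := by linarith
  have hmin : -1 ≤ min r 0 := le_min hr1 (by norm_num)
  have hu : 0 < ((m : ℝ) + 1) * (2 * m + 1 - p) + m * min r 0 := by nlinarith
  -- The slope `a - b` is `2(m + 1)`, and `u` is solved from the requirement that the gap be `(m +
  -- 1)(2ℓ + 1 - p)`. The factor `m + 1` keeps `u` positive: `u ≥ (m + 1) - m`, as `p ≤ 2m` and `r ≥
  -- -1`.
  refine ⟨(((m : ℝ) + 1) * (2 * m + 1 - p) + m * min r 0, 2 * ((m : ℝ) + 1) + r, r), ?_⟩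
  refine Prod.ext (Prod.ext (sign_pos hu) (Prod.ext (sign_pos hα) hr)) (funext fun ℓ => ?_)
  have hgap : coinGap m (((m : ℝ) + 1) * (2 * m + 1 - p) + m * min r 0, 2 * ((m : ℝ) + 1) + r, r) ℓ =
      ((m : ℝ) + 1) * ((2 * (ℓ : ℕ) + 1 - p : ℤ) : ℝ) := by
    have := min_add_max r 0
    rw [coinGap_eq]
    simp only [max_eq_left hα.le]
    push_cast
    linear_combination (m : ℝ) * this
  simp only [coinType, hgap]
  rw [sign_mul_intCast (by linarith)]
  rfl

theorem exists_coinGap_eq_zero_iff {w : ℝ × ℝ × ℝ} {σ : SignType × SignType × SignType} {p : ℕ}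
    (hp : p ≤ 2 * m) (h : coinType m w = (σ, signPattern m p)) :
    (∃ ℓ ≤ m, coinGap m w ℓ = 0) ↔ p % 2 = 1 := by
  have h5 : ∀ ℓ ≤ m, coinGap m w ℓ = 0 ↔ 2 * ℓ + 1 = p := by
    intro ℓ hℓ
    have h6 := congrFun (congrArg Prod.snd h) ⟨ℓ, Nat.lt_succ_iff.2 hℓ⟩
    simp only [coinType, signPattern] at h6
    rw [← sign_eq_zero_iff, h6, sign_eq_zero_iff]
    omega
  constructor
  · rintro ⟨ℓ, hℓ, h⟩
    have := (h5 ℓ hℓ).1 h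
    omega
  · intro hp1
    exact ⟨p / 2, by omega, (h5 _ (by omega)).2 (by omega)⟩

theorem coinDim_eq_of_coinType {w : ℝ × ℝ × ℝ} {b : SignType} {p : ℕ} (hp : p ≤ 2 * m)
    (h : coinType m w = ((1, 1, b), signPattern m p)) :
    coinDim m w = (if b = 0 then 1 else 0) + p % 2 := by
  have h1 : 0 < w.1 := sign_eq_one_iff.1 (congrArg (fun x => x.1.1) h)
  have h2 : 0 < w.2.1 := sign_eq_one_iff.1 (congrArg (fun x => x.1.2.1) h)
  have h3 : SignType.sign w.2.2 = b := congrArg (fun x => x.1.2.2) h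
  have h4 := exists_coinGap_eq_zero_iff hp h
  rw [coinDim, if_pos h1.ne', if_neg h2.ne', ← h3]
  simp only [sign_eq_zero_iff, h4, zero_add]
  congr 1
  rcases Nat.mod_two_eq_zero_or_one p with h | h <;> simp [h]

/-- The map from `p` to sign vectors is injective and hits exactly the realizable ones, so faces
here are counted by integers `p ≤ 2m`, whose parity gives the dimension. The predicate `R` allows a
restriction to the vertices of one face. -/
theorem faceCount_pos_pos (b : SignType) (d : ℕ)
    (R : (SignType × SignType × SignType) × (Fin (m + 1) → SignType) → Prop) :
    faceCount m {w | weightSigns w = (1, 1, b) ∧ coinDim m w = d ∧ R (coinType m w)} =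
      {p | p ≤ 2 * m ∧ (if b = 0 then 1 else 0) + p % 2 = d ∧
        R ((1, 1, b), signPattern m p)}.ncard := by
  rw [faceCount]
  have : coinType m '' {w | weightSigns w = (1, 1, b) ∧ coinDim m w = d ∧ R (coinType m w)} =
      (fun p => ((1, 1, b), signPattern m p)) '' {p | p ≤ 2 * m ∧
        (if b = 0 then 1 else 0) + p % 2 = d ∧ R ((1, 1, b), signPattern m p)} := by
    ext t
    constructor
    · rintro ⟨w, ⟨hs, hd, hR⟩, rfl⟩
      obtain ⟨p, hp, e⟩ := exists_coinType_eq (m := m) hs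
      exact ⟨p, ⟨hp, by rw [← coinDim_eq_of_coinType hp e, hd], e ▸ hR⟩, e.symm⟩
    · rintro ⟨p, ⟨hp, hd, hR⟩, rfl⟩
      obtain ⟨w, hw⟩ := exists_weight_of_signPattern b hp
      exact ⟨w, ⟨congrArg Prod.fst hw, by rw [coinDim_eq_of_coinType hp hw, hd], hw ▸ hR⟩, hw⟩
  rw [this]
  apply Set.InjOn.ncard_image
  intro p hp p' hp' h
  exact signPattern_injOn m hp.1 hp'.1 (congrArg Prod.snd h)

/-- The number of `d`-dimensional faces whose directions have signs `σ`. -/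
noncomputable def signCount (m : ℕ) (σ : SignType × SignType × SignType) (d : ℕ) : ℕ :=
  faceCount m {w | weightSigns w = σ ∧ coinDim m w = d}

theorem signCount_swap (a b c : SignType) (d : ℕ) :
    signCount m (-a, b, c) d = signCount m (a, c, b) d := by
  rw [signCount, ← faceCount_swapWeight, signCount]
  simp only [Set.mem_ofPred_eq, weightSigns_swapWeight_eq_iff, coinDim_swapWeight, neg_neg]

theorem signCount_flip (a b c : SignType) (d : ℕ) :
    signCount m (a, -b, c) d = signCount m (a, b, -c) d := by
  rw [signCount, ← faceCount_flipWeight, signCount]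
  simp only [Set.mem_ofPred_eq, weightSigns_flipWeight_eq_iff, coinDim_flipWeight, neg_neg]

theorem ncard_even (m : ℕ) : {p | p ≤ 2 * m ∧ p % 2 = 0}.ncard = m + 1 := by
  have : {p | p ≤ 2 * m ∧ p % 2 = 0} = (fun j => 2 * j) '' (Finset.range (m + 1) : Set ℕ) := by
    ext p
    simp only [Set.mem_ofPred_eq, Finset.coe_range, Set.mem_image, Set.mem_Iio]
    exact ⟨fun h => ⟨p / 2, by omega, by omega⟩, by rintro ⟨j, hj, rfl⟩; omega⟩
  rw [this, Set.ncard_image_of_injective _ fun a b h => by simpa using h, Set.ncard_coe_finset,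
    Finset.card_range]

theorem ncard_odd (m : ℕ) : {p | p ≤ 2 * m ∧ p % 2 = 1}.ncard = m := by
  have : {p | p ≤ 2 * m ∧ p % 2 = 1} = (fun j => 2 * j + 1) '' (Finset.range m : Set ℕ) := by
    ext p
    simp only [Set.mem_ofPred_eq, Finset.coe_range, Set.mem_image, Set.mem_Iio]
    exact ⟨fun h => ⟨p / 2, by omega, by omega⟩, by rintro ⟨j, hj, rfl⟩; omega⟩
  rw [this, Set.ncard_image_of_injective _ fun a b h => by simpa using h, Set.ncard_coe_finset,
    Finset.card_range]

theorem signCount_pos_pos (b : SignType) (d : ℕ) :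
    signCount m (1, 1, b) d = {p | p ≤ 2 * m ∧ (if b = 0 then 1 else 0) + p % 2 = d}.ncard := by
  have := faceCount_pos_pos (m := m) b d fun _ => True
  simpa [signCount] using this

theorem signCount_pos_pos_of_ne {b : SignType} (hb : b ≠ 0) (d : ℕ) :
    signCount m (1, 1, b) d = if d = 0 then m + 1 else if d = 1 then m else 0 := by
  rw [signCount_pos_pos, if_neg hb]
  simp only [zero_add]
  split_ifs with h0 h1
  · rw [h0, ncard_even]
  · rw [h1, ncard_odd]
  · convert Set.ncard_empty ℕ
    ext p
    simp only [Set.mem_ofPred_eq, Set.mem_empty_iff_false, iff_false]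
    omega

theorem signCount_pos_pos_zero (d : ℕ) :
    signCount m (1, 1, 0) d = if d = 1 then m + 1 else if d = 2 then m else 0 := by
  rw [signCount_pos_pos, if_pos rfl]
  split_ifs with h0 h1
  · simp only [h0, Nat.add_eq_left, ncard_even]
  · rw [h1]
    conv_rhs => rw [← ncard_odd m]
    congr 1
    ext p
    simp only [Set.mem_ofPred_eq]
    omega
  · convert Set.ncard_empty ℕ
    ext p
    simp only [Set.mem_ofPred_eq, Set.mem_empty_iff_false, iff_false]
    omega

/-- For sign triples that already force all gap signs: such a triple is the normal cone of a single
face. -/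
theorem signCount_eq_ite {σ : SignType × SignType × SignType} {e : ℕ}
    {t : Fin (m + 1) → SignType} (hex : ∃ w, weightSigns w = σ)
    (h : ∀ w, weightSigns w = σ → (∀ ℓ, SignType.sign (coinGap m w (ℓ : Fin (m + 1))) = t ℓ) ∧
      coinDim m w = e) (d : ℕ) : signCount m σ d = if d = e then 1 else 0 := by
  rw [signCount, faceCount]
  split_ifs with hd
  · have : coinType m '' {w | weightSigns w = σ ∧ coinDim m w = d} = {(σ, t)} := by
      ext x
      constructor
      · rintro ⟨w, ⟨hs, -⟩, rfl⟩
        exact Prod.ext hs (funext (h w hs).1)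
      · rintro rfl
        obtain ⟨w, hw⟩ := hex
        exact ⟨w, ⟨hw, by rw [(h w hw).2, hd]⟩, Prod.ext hw (funext (h w hw).1)⟩
    rw [this, Set.ncard_singleton]
  · rw [Set.image_eq_empty.2, Set.ncard_empty]
    ext w
    simp only [Set.mem_ofPred_eq, Set.mem_empty_iff_false, iff_false]
    rintro ⟨hs, rfl⟩
    exact hd (h w hs).2

theorem weightSigns_eq_iff (w : ℝ × ℝ × ℝ) (a b c : SignType) :
    weightSigns w = (a, b, c) ↔
      SignType.sign w.1 = a ∧ SignType.sign w.2.1 = b ∧ SignType.sign w.2.2 = c := by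
  simp [weightSigns]

theorem exists_sign_eq (b : SignType) : ∃ r : ℝ, SignType.sign r = b := by
  rcases b with _ | _ | _
  · exact ⟨0, sign_zero⟩
  · exact ⟨-1, sign_neg (by norm_num)⟩
  · exact ⟨1, sign_pos (by norm_num)⟩

theorem coinGap_pos_of_pos_zero {w : ℝ × ℝ × ℝ} (hu : 0 < w.1) (ha : w.2.1 = 0) {ℓ : ℕ}
    (hℓ : ℓ ≤ m) : 0 < coinGap m w ℓ := by
  have h1 : w.2.2 ≤ max w.2.2 0 := le_max_left _ _
  have h2 : (ℓ : ℝ) ≤ m := by exact_mod_cast hℓ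
  have h3 : (ℓ : ℝ) * w.2.2 ≤ ℓ * max w.2.2 0 := mul_le_mul_of_nonneg_left h1 (Nat.cast_nonneg ℓ)
  have h4 : (ℓ : ℝ) * max w.2.2 0 ≤ m * max w.2.2 0 :=
    mul_le_mul_of_nonneg_right h2 (le_max_right _ _)
  rw [coinGap, ha]
  simp only [mul_zero, max_self, zero_add, add_zero]
  linarith

theorem signCount_pos_zero (b : SignType) (d : ℕ) :
    signCount m (1, 0, b) d = if d = 1 + (if b = 0 then 1 else 0) then 1 else 0 := by
  apply signCount_eq_ite (t := fun _ => 1)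
  · obtain ⟨r, hr⟩ := exists_sign_eq b
    exact ⟨(1, 0, r), by simp [weightSigns, hr]⟩
  · intro w hw
    obtain ⟨hu, ha, hb⟩ := (weightSigns_eq_iff _ _ _ _).1 hw
    rw [sign_eq_one_iff] at hu
    rw [sign_eq_zero_iff] at ha
    have hpos : ∀ ℓ ≤ m, 0 < coinGap m w ℓ := fun ℓ hℓ => coinGap_pos_of_pos_zero hu ha hℓ
    refine ⟨fun ℓ => sign_pos (hpos ℓ (Nat.lt_succ_iff.1 ℓ.2)), ?_⟩
    rw [coinDim, if_pos hu.ne', if_pos ha, if_neg (c := ∃ ℓ ≤ m, coinGap m w ℓ = 0)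
      (by rintro ⟨ℓ, hℓ, h⟩; exact (hpos ℓ hℓ).ne' h), ← hb]
    simp [sign_eq_zero_iff]

theorem signCount_zero_pos_zero (d : ℕ) :
    signCount m (0, 1, 0) d = if d = 2 then 1 else 0 := by
  apply signCount_eq_ite (t := fun ℓ => if (ℓ : ℕ) < m then -1 else 0)
  · exact ⟨(0, 1, 0), by simp [weightSigns]⟩
  · intro w hw
    obtain ⟨hu, ha, hb⟩ := (weightSigns_eq_iff _ _ _ _).1 hw
    rw [sign_eq_one_iff] at ha
    rw [sign_eq_zero_iff] at hu hb
    refine ⟨fun ℓ => ?_, by simp [coinDim, hu, ha.ne', hb]⟩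
    rw [coinGap, hu, hb, max_eq_left ha.le]
    simp only [max_self, mul_zero, add_zero, zero_add]
    split_ifs with h
    · apply sign_neg
      have : ((ℓ : ℕ) : ℝ) < m := by exact_mod_cast h
      nlinarith
    · have : (ℓ : ℕ) = m := le_antisymm (Nat.lt_succ_iff.1 ℓ.2) (not_lt.1 h)
      simp [this]

theorem signCount_zero_zero_zero (d : ℕ) :
    signCount m (0, 0, 0) d = if d = 3 then 1 else 0 := by
  apply signCount_eq_ite (t := fun _ => 0)
  · exact ⟨0, by simp [weightSigns]⟩
  · intro w hw
    obtain ⟨hu, ha, hb⟩ := (weightSigns_eq_iff _ _ _ _).1 hw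
    rw [sign_eq_zero_iff] at hu ha hb
    exact ⟨fun ℓ => by simp [coinGap, hu, ha, hb], by simp [coinDim, hu, ha, hb]⟩

/-- Here the gap is `(m - ℓ)(b - a)`: it vanishes at `ℓ = m`, and its other signs only compare `a`
with `b`. The ray `a = b` thus separates two edges and exposes one facet. -/
theorem coinType_zero_pos_pos {w : ℝ × ℝ × ℝ} (hw : weightSigns w = (0, 1, 1)) :
    coinType m w = ((0, 1, 1),
      fun ℓ : Fin (m + 1) => if (ℓ : ℕ) < m then SignType.sign (w.2.2 - w.2.1) else 0) := by
  refine Prod.ext hw (funext fun ℓ => ?_)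
  obtain ⟨hu, ha, hb⟩ := (weightSigns_eq_iff _ _ _ _).1 hw
  rw [sign_eq_one_iff] at ha hb
  rw [sign_eq_zero_iff] at hu
  have : coinGap m w ℓ = ((m : ℝ) - (ℓ : ℕ)) * (w.2.2 - w.2.1) := by
    rw [coinGap, hu, max_eq_left ha.le, max_eq_left hb.le]
    ring
  simp only [coinType, this]
  split_ifs with h
  · have : (0 : ℝ) < (m : ℝ) - (ℓ : ℕ) := sub_pos.2 (by exact_mod_cast h)
    rw [sign_mul, sign_pos this, one_mul]
  · have : (ℓ : ℕ) = m := le_antisymm (Nat.lt_succ_iff.1 ℓ.2) (not_lt.1 h)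
    simp [this]

theorem coinDim_zero_pos_pos {w : ℝ × ℝ × ℝ} (hw : weightSigns w = (0, 1, 1)) :
    coinDim m w = if w.2.1 = w.2.2 then 2 else 1 := by
  obtain ⟨hu, ha, hb⟩ := (weightSigns_eq_iff _ _ _ _).1 hw
  rw [sign_eq_one_iff] at ha hb
  rw [sign_eq_zero_iff] at hu
  simp [coinDim, hu, ha.ne', hb.ne', (mul_pos ha hb).not_gt]

theorem signCount_zero_pos_pos_zero : signCount m (0, 1, 1) 0 = 0 := by
  rw [signCount, faceCount]
  rw [Set.image_eq_empty.2, Set.ncard_empty]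
  ext w
  simp only [Set.mem_ofPred_eq, Set.mem_empty_iff_false, iff_false]
  rintro ⟨hs, h⟩
  rw [coinDim_zero_pos_pos hs] at h
  split_ifs at h

theorem signCount_zero_pos_pos_one (hm : 1 ≤ m) : signCount m (0, 1, 1) 1 = 2 := by
  rw [signCount, faceCount, Set.ncard_eq_two]
  refine ⟨coinType m (0, 1, 2), coinType m (0, 2, 1), ?_, ?_⟩
  · rw [coinType_zero_pos_pos (by simp [weightSigns]), coinType_zero_pos_pos (by simp [weightSigns])]
    intro h
    have := congrFun (congrArg Prod.snd h) 0
    simp only [Fin.val_zero, show 0 < m from hm, if_true] at this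
    norm_num at this
  · ext t
    constructor
    · rintro ⟨w, ⟨hs, hd⟩, rfl⟩
      rw [coinDim_zero_pos_pos hs] at hd
      have hne : w.2.1 ≠ w.2.2 := by
        rintro h
        simp [h] at hd
      rw [Set.mem_insert_iff, Set.mem_singleton_iff, coinType_zero_pos_pos hs,
        coinType_zero_pos_pos (by simp [weightSigns]), coinType_zero_pos_pos (by simp [weightSigns])]
      rcases lt_or_gt_of_ne hne with h | h
      · left
        rw [sign_pos (by linarith), sign_pos (by norm_num)]
      · right
        rw [sign_neg (by linarith), sign_neg (by norm_num)]
    · have h1 : weightSigns (0, 1, 2) = (0, 1, 1) := by simp [weightSigns]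
      have h2 : weightSigns (0, 2, 1) = (0, 1, 1) := by simp [weightSigns]
      rintro (rfl | rfl)
      · exact ⟨_, ⟨h1, by rw [coinDim_zero_pos_pos h1]; norm_num⟩, rfl⟩
      · exact ⟨_, ⟨h2, by rw [coinDim_zero_pos_pos h2]; norm_num⟩, rfl⟩

theorem signCount_zero_pos_pos_two : signCount m (0, 1, 1) 2 = 1 := by
  rw [signCount, faceCount, Set.ncard_eq_one]
  have h1 : weightSigns (0, 1, 1) = (0, 1, 1) := by simp [weightSigns]
  refine ⟨coinType m (0, 1, 1), ?_⟩
  ext t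
  constructor
  · rintro ⟨w, ⟨hs, hd⟩, rfl⟩
    rw [coinDim_zero_pos_pos hs] at hd
    have he : w.2.1 = w.2.2 := by
      by_contra h
      simp [h] at hd
    rw [Set.mem_singleton_iff, coinType_zero_pos_pos hs, coinType_zero_pos_pos h1, he, sub_self,
      sub_self]
  · rintro rfl
    exact ⟨_, ⟨h1, by rw [coinDim_zero_pos_pos h1]; norm_num⟩, rfl⟩

theorem exists_coinType_eq_zero_pos_neg (hm : 1 ≤ m) {w : ℝ × ℝ × ℝ}
    (hw : weightSigns w = (0, 1, -1)) :
    ∃ p, 2 ≤ p ∧ p ≤ 2 * m ∧ coinType m w = ((0, 1, -1), signPattern m p) := by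
  obtain ⟨hu, ha, hb⟩ := (weightSigns_eq_iff _ _ _ _).1 hw
  rw [sign_eq_one_iff] at ha
  rw [sign_eq_neg_one_iff] at hb
  rw [sign_eq_zero_iff] at hu
  have hm' : (0 : ℝ) < m := by positivity
  have hg : ∀ ℓ : ℕ, coinGap m w ℓ = -(m * w.2.1) + ℓ * (w.2.1 - w.2.2) := by
    intro ℓ
    rw [coinGap_eq, hu, max_eq_left ha.le, max_eq_right hb.le]
    ring
  obtain ⟨p, hp, hpat⟩ := exists_sign_eq_of_affine hg (m := m) (by rw [hg]; nlinarith)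
  refine ⟨p, ?_, hp, Prod.ext hw (funext fun ℓ => hpat ℓ (Nat.lt_succ_iff.1 ℓ.2))⟩
  -- The first gap is `-m a < 0`, which excludes the patterns `p = 0` and `p = 1`.
  have h0 := hpat 0 (Nat.zero_le m)
  rw [hg, sign_neg (by simp only [Nat.cast_zero]; nlinarith), eq_comm, sign_eq_neg_one_iff] at h0
  push_cast at h0
  omega

theorem exists_weight_of_signPattern_zero_pos_neg (hm : 1 ≤ m) {p : ℕ} (h2 : 2 ≤ p)
    (hp : p ≤ 2 * m) : ∃ w, coinType m w = ((0, 1, -1), signPattern m p) := by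
  have hm' : (0 : ℝ) < m := by positivity
  have h2' : (2 : ℝ) ≤ p := by exact_mod_cast h2
  have hp' : (p : ℝ) ≤ 2 * m := by exact_mod_cast hp
  have ha : (0 : ℝ) < p - 1 := by linarith
  have hb : (p : ℝ) - 1 - 2 * m < 0 := by linarith
  -- Chosen so that the gap runs from `-m (p - 1)` with slope `2m`, that is, equals `m (2ℓ + 1 -
  -- p)`.
  refine ⟨(0, p - 1, p - 1 - 2 * m), Prod.ext (Prod.ext sign_zero
    (Prod.ext (sign_pos ha) (sign_neg hb))) (funext fun ℓ => ?_)⟩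
  have : coinGap m (0, (p : ℝ) - 1, (p : ℝ) - 1 - 2 * m) ℓ =
      m * ((2 * (ℓ : ℕ) + 1 - p : ℤ) : ℝ) := by
    rw [coinGap_eq]
    simp only [max_eq_left ha.le, max_eq_right hb.le]
    push_cast
    ring
  simp only [coinType, this]
  rw [sign_mul_intCast hm']
  rfl

theorem coinDim_zero_pos_neg {w : ℝ × ℝ × ℝ} {p : ℕ} (hp : p ≤ 2 * m)
    (h : coinType m w = ((0, 1, -1), signPattern m p)) : coinDim m w = 1 + p % 2 := by
  obtain ⟨hu, ha, hb⟩ := (weightSigns_eq_iff _ _ _ _).1 (congrArg Prod.fst h)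
  rw [sign_eq_one_iff] at ha
  rw [sign_eq_neg_one_iff] at hb
  rw [sign_eq_zero_iff] at hu
  have hne : w.2.1 ≠ w.2.2 := by linarith
  simp only [coinDim, hu, ha.ne', hb.ne, hne, mul_neg_of_pos_of_neg ha hb,
    exists_coinGap_eq_zero_iff hp h, ne_eq, not_true_eq_false, if_false, false_and, false_or,
    true_and]
  rcases Nat.mod_two_eq_zero_or_one p with h | h <;> simp [h]

theorem signCount_zero_pos_neg (hm : 1 ≤ m) (d : ℕ) :
    signCount m (0, 1, -1) d = {p | 2 ≤ p ∧ p ≤ 2 * m ∧ 1 + p % 2 = d}.ncard := by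
  rw [signCount, faceCount]
  have : coinType m '' {w | weightSigns w = (0, 1, -1) ∧ coinDim m w = d} =
      (fun p => ((0, 1, -1), signPattern m p)) '' {p | 2 ≤ p ∧ p ≤ 2 * m ∧ 1 + p % 2 = d} := by
    ext t
    constructor
    · rintro ⟨w, ⟨hs, hd⟩, rfl⟩
      obtain ⟨p, h2, hp, e⟩ := exists_coinType_eq_zero_pos_neg hm hs
      exact ⟨p, ⟨h2, hp, by rw [← coinDim_zero_pos_neg hp e, hd]⟩, e.symm⟩
    · rintro ⟨p, ⟨h2, hp, hd⟩, rfl⟩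
      obtain ⟨w, hw⟩ := exists_weight_of_signPattern_zero_pos_neg hm h2 hp
      exact ⟨w, ⟨congrArg Prod.fst hw, by rw [coinDim_zero_pos_neg hp hw, hd]⟩, hw⟩
  rw [this]
  apply Set.InjOn.ncard_image
  intro p hp p' hp' h
  exact signPattern_injOn m hp.2.1 hp'.2.1 (congrArg Prod.snd h)

theorem signCount_zero_pos_neg_eq_ite (hm : 1 ≤ m) (d : ℕ) :
    signCount m (0, 1, -1) d = if d = 1 then m else if d = 2 then m - 1 else 0 := by
  rw [signCount_zero_pos_neg hm]
  have hinj : Function.Injective fun j : ℕ => 2 * j + 2 := fun a b h => by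
    simp only at h
    omega
  have hinj' : Function.Injective fun j : ℕ => 2 * j + 3 := fun a b h => by
    simp only at h
    omega
  split_ifs with h1 h2
  · have : {p | 2 ≤ p ∧ p ≤ 2 * m ∧ 1 + p % 2 = d} =
        (fun j => 2 * j + 2) '' (Finset.range m : Set ℕ) := by
      ext p
      simp only [Set.mem_ofPred_eq, Finset.coe_range, Set.mem_image, Set.mem_Iio]
      exact ⟨fun h => ⟨p / 2 - 1, by omega, by omega⟩, by rintro ⟨j, hj, rfl⟩; omega⟩
    rw [this, Set.ncard_image_of_injective _ hinj, Set.ncard_coe_finset, Finset.card_range]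
  · have : {p | 2 ≤ p ∧ p ≤ 2 * m ∧ 1 + p % 2 = d} =
        (fun j => 2 * j + 3) '' (Finset.range (m - 1) : Set ℕ) := by
      ext p
      simp only [Set.mem_ofPred_eq, Finset.coe_range, Set.mem_image, Set.mem_Iio]
      exact ⟨fun h => ⟨p / 2 - 1, by omega, by omega⟩, by rintro ⟨j, hj, rfl⟩; omega⟩
    rw [this, Set.ncard_image_of_injective _ hinj', Set.ncard_coe_finset, Finset.card_range]
  · convert Set.ncard_empty ℕ
    ext p
    simp only [Set.mem_ofPred_eq, Set.mem_empty_iff_false, iff_false]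
    omega

theorem signCount_neg (b c : SignType) (d : ℕ) :
    signCount m (-1, b, c) d = signCount m (1, c, b) d := signCount_swap 1 b c d

theorem signCount_neg_mid (a c : SignType) (d : ℕ) :
    signCount m (a, -1, c) d = signCount m (a, 1, -c) d := signCount_flip a 1 c d

theorem signCount_zero_zero_pos (d : ℕ) :
    signCount m (0, 0, 1) d = signCount m (0, 1, 0) d := signCount_swap 0 0 1 d

theorem signCount_zero_zero_neg (d : ℕ) :
    signCount m (0, 0, -1) d = signCount m (0, 1, 0) d :=
  (signCount_flip 0 0 1 d).symm.trans (signCount_zero_zero_pos d)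

theorem sum_signType {M : Type*} [AddCommMonoid M] (f : SignType → M) :
    ∑ s, f s = f 0 + f (-1) + f 1 := by
  rw [SignType.univ_eq]
  simp [add_assoc]

theorem faceCount_coinDim (d : ℕ) :
    faceCount m {w | coinDim m w = d} = ∑ σ, signCount m σ d :=
  faceCount_eq_sum m _ Finset.univ fun _ _ => Finset.mem_univ _

/-- Only the eight open octants contribute, with `m + 1` vertices each. -/
theorem sum_signCount_zero (hm : 1 ≤ m) : ∑ σ, signCount m σ 0 = 8 * (m + 1) := by
  simp only [Fintype.sum_prod_type, sum_signType, signCount_neg, signCount_neg_mid,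
    signCount_zero_zero_neg, signCount_zero_zero_pos, signCount_zero_zero_zero,
    signCount_zero_pos_zero, signCount_pos_zero, signCount_pos_pos_zero, neg_neg, neg_zero,
    signCount_zero_pos_pos_zero, signCount_zero_pos_neg_eq_ite hm,
    signCount_pos_pos_of_ne (show (1 : SignType) ≠ 0 by decide),
    signCount_pos_pos_of_ne (show (-1 : SignType) ≠ 0 by decide)]
  simp
  ring

/-- The open octants give `8m`. With `u ≠ 0` and one of `a`, `b` zero, four triples give `m + 1`
each and four give one each. With `u = 0`, equal signs of `a`, `b` give `2 + 2` and opposite signs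
`m + m`. -/
theorem sum_signCount_one (hm : 1 ≤ m) : ∑ σ, signCount m σ 1 = 14 * m + 12 := by
  simp only [Fintype.sum_prod_type, sum_signType, signCount_neg, signCount_neg_mid,
    signCount_zero_zero_neg, signCount_zero_zero_pos, signCount_zero_zero_zero,
    signCount_zero_pos_zero, signCount_pos_zero, signCount_pos_pos_zero, neg_neg, neg_zero,
    signCount_zero_pos_pos_one hm, signCount_zero_pos_neg_eq_ite hm,
    signCount_pos_pos_of_ne (show (1 : SignType) ≠ 0 by decide),
    signCount_pos_pos_of_ne (show (-1 : SignType) ≠ 0 by decide)]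
  simp
  ring

/-- The six coordinate rays give one facet each, the rays `u = 0`, `a = b` two more, the triples
with `u ≠ 0` and one of `a`, `b` zero `4m`, and opposite signs of `a`, `b` with `u = 0` another `2(m
- 1)`. -/
theorem sum_signCount_two (hm : 1 ≤ m) : ∑ σ, signCount m σ 2 = 6 * (m + 1) := by
  simp only [Fintype.sum_prod_type, sum_signType, signCount_neg, signCount_neg_mid,
    signCount_zero_zero_neg, signCount_zero_zero_pos, signCount_zero_zero_zero,
    signCount_zero_pos_zero, signCount_pos_zero, signCount_pos_pos_zero, neg_neg, neg_zero,
    signCount_zero_pos_pos_two, signCount_zero_pos_neg_eq_ite hm,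
    signCount_pos_pos_of_ne (show (1 : SignType) ≠ 0 by decide),
    signCount_pos_pos_of_ne (show (-1 : SignType) ≠ 0 by decide)]
  simp
  omega

end Counts

/-! ### Numbers of vertices of the facets. -/

section Polygons

variable {m : ℕ}

/-- The number of vertices of the face in direction `w` whose normal cones lie in the octant `σ`. -/
noncomputable def octantCount (m : ℕ) (w : ℝ × ℝ × ℝ) (σ : SignType × SignType × SignType) : ℕ :=
  faceCount m {w' | weightSigns w' = σ ∧ coinDim m w' = 0 ∧
    TypeSpecializes (coinType m w) (coinType m w')}

theorem ncard_polyVertices_coinFace (hm : 1 ≤ m) (w : ℝ × ℝ × ℝ) :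
    (polyVertices (coinFace m w)).ncard = ∑ σ, octantCount m w σ := by
  rw [polyVertices_coinFace hm, ncard_polyVertices_filter hm _
    (fun w' => TypeSpecializes (coinType m w) (coinType m w'))]
  · exact faceCount_eq_sum m _ Finset.univ fun _ _ => Finset.mem_univ _
  · intro w' v _ h
    rw [← coinFace_subset_iff hm, h, Set.singleton_subset_iff]

theorem octantCount_neg (w : ℝ × ℝ × ℝ) (b c : SignType) :
    octantCount m w (-1, b, c) = octantCount m (swapWeight w) (1, c, b) := by
  rw [octantCount, octantCount, ← faceCount_swapWeight]
  simp only [Set.mem_ofPred_eq, weightSigns_swapWeight_eq_iff, coinDim_swapWeight,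
    coinType_swapWeight, typeSpecializes_swapType_right, neg_neg]

theorem octantCount_neg_mid (w : ℝ × ℝ × ℝ) (a c : SignType) :
    octantCount m w (a, -1, c) = octantCount m (flipWeight w) (a, 1, -c) := by
  rw [octantCount, octantCount, ← faceCount_flipWeight]
  simp only [Set.mem_ofPred_eq, weightSigns_flipWeight_eq_iff, coinDim_flipWeight,
    coinType_flipWeight, typeSpecializes_flipType_right, neg_neg]

theorem ne_zero_of_coinDim_eq_zero {w : ℝ × ℝ × ℝ} (h : coinDim m w = 0) :
    w.1 ≠ 0 ∧ w.2.1 ≠ 0 ∧ w.2.2 ≠ 0 := by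
  unfold coinDim at h
  split_ifs at h <;> simp_all

theorem octantCount_eq_zero {w : ℝ × ℝ × ℝ} {a b c : SignType} (h : a = 0 ∨ b = 0 ∨ c = 0) :
    octantCount m w (a, b, c) = 0 := by
  rw [octantCount, faceCount, Set.image_eq_empty.2, Set.ncard_empty]
  ext w'
  simp only [Set.mem_ofPred_eq, Set.mem_empty_iff_false, iff_false]
  rintro ⟨hs, hd, -⟩
  obtain ⟨h1, h2, h3⟩ := ne_zero_of_coinDim_eq_zero hd
  obtain ⟨rfl, rfl, rfl⟩ := (weightSigns_eq_iff _ _ _ _).1 hs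
  simp only [sign_eq_zero_iff] at h
  tauto

/-- The number of vertices of the face in direction `w` whose normal cones lie in one of the octants
`(+, +, ±)`. -/
noncomputable def quarterCount (m : ℕ) (w : ℝ × ℝ × ℝ) : ℕ :=
  octantCount m w (1, 1, 1) + octantCount m w (1, 1, -1)

/-- Vertices occur only in the eight open octants, and the two symmetries carry these onto the pair
`(+, +, ±)`, moving the direction `w` instead. -/
theorem ncard_polyVertices_coinFace_eq (hm : 1 ≤ m) (w : ℝ × ℝ × ℝ) :
    (polyVertices (coinFace m w)).ncard = quarterCount m w + quarterCount m (flipWeight w) +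
      quarterCount m (swapWeight w) + quarterCount m (flipWeight (swapWeight w)) := by
  rw [ncard_polyVertices_coinFace hm]
  have h1 : ∀ w a b, octantCount m w (0, a, b) = 0 := fun _ _ _ => octantCount_eq_zero (by simp)
  have h2 : ∀ w a b, octantCount m w (a, 0, b) = 0 := fun _ _ _ => octantCount_eq_zero (by simp)
  have h3 : ∀ w a b, octantCount m w (a, b, 0) = 0 := fun _ _ _ => octantCount_eq_zero (by simp)
  simp only [Fintype.sum_prod_type, sum_signType, h1, h2, h3, octantCount_neg, octantCount_neg_mid,
    quarterCount, neg_neg, fun w => show swapWeight (flipWeight w) = flipWeight (swapWeight w) from rfl,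
    flipWeight_flipWeight]
  ring

theorem ncard_polyVertices_swapWeight (hm : 1 ≤ m) (w : ℝ × ℝ × ℝ) :
    (polyVertices (coinFace m (swapWeight w))).ncard = (polyVertices (coinFace m w)).ncard := by
  rw [ncard_polyVertices_coinFace_eq hm, ncard_polyVertices_coinFace_eq hm, swapWeight_swapWeight]
  ring

theorem ncard_polyVertices_flipWeight (hm : 1 ≤ m) (w : ℝ × ℝ × ℝ) :
    (polyVertices (coinFace m (flipWeight w))).ncard = (polyVertices (coinFace m w)).ncard := by
  have h : swapWeight (flipWeight w) = flipWeight (swapWeight w) := rfl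
  rw [ncard_polyVertices_coinFace_eq hm, ncard_polyVertices_coinFace_eq hm, flipWeight_flipWeight, h,
    flipWeight_flipWeight]
  ring

theorem octantCount_eq_zero_of_not {w : ℝ × ℝ × ℝ} {σ : SignType × SignType × SignType}
    (h : ¬(SignSpecializes (SignType.sign w.1) σ.1 ∧ SignSpecializes (SignType.sign w.2.1) σ.2.1 ∧
      SignSpecializes (SignType.sign w.2.2) σ.2.2)) : octantCount m w σ = 0 := by
  rw [octantCount, faceCount, Set.image_eq_empty.2, Set.ncard_empty]
  ext w'
  simp only [Set.mem_ofPred_eq, Set.mem_empty_iff_false, iff_false]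
  rintro ⟨rfl, hd, hs⟩
  exact h hs.1

theorem signSpecializes_one {x : ℝ} : SignSpecializes (SignType.sign x) 1 ↔ 0 ≤ x := by
  rw [SignSpecializes, sign_eq_zero_iff, sign_eq_one_iff, le_iff_eq_or_lt, eq_comm]

theorem signSpecializes_neg_one {x : ℝ} : SignSpecializes (SignType.sign x) (-1) ↔ x ≤ 0 := by
  rw [SignSpecializes, sign_eq_zero_iff, sign_eq_neg_one_iff, le_iff_eq_or_lt]

theorem quarterCount_eq_zero {w : ℝ × ℝ × ℝ} (h : w.1 < 0 ∨ w.2.1 < 0) : quarterCount m w = 0 := by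
  rw [quarterCount, octantCount_eq_zero_of_not, octantCount_eq_zero_of_not] <;>
  · simp only [signSpecializes_one]
    rintro ⟨h1, h2, -⟩
    rcases h with h | h <;> linarith

theorem octantCount_eq_zero_of_neg {w : ℝ × ℝ × ℝ} (h : w.2.2 < 0) :
    octantCount m w (1, 1, 1) = 0 :=
  octantCount_eq_zero_of_not fun h' => h.not_ge (signSpecializes_one.1 h'.2.2)

theorem octantCount_eq_zero_of_pos {w : ℝ × ℝ × ℝ} (h : 0 < w.2.2) :
    octantCount m w (1, 1, -1) = 0 :=
  octantCount_eq_zero_of_not fun h' => h.not_ge (signSpecializes_neg_one.1 h'.2.2)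

/-- A vertex in this octant has an even pattern `p = 2j`, negative before `j` and positive from `j`
on. It lies on the face when every nonzero gap sign of `w` agrees with this pattern. -/
theorem octantCount_eq_ncard {w : ℝ × ℝ × ℝ} {b : SignType} (hb : b ≠ 0) (hu : 0 ≤ w.1)
    (ha : 0 ≤ w.2.1) (hs : SignSpecializes (SignType.sign w.2.2) b) :
    octantCount m w (1, 1, b) = {j | j ≤ m ∧
      ∀ ℓ ≤ m, (0 < coinGap m w ℓ → j ≤ ℓ) ∧ (coinGap m w ℓ < 0 → ℓ < j)}.ncard := by
  rw [octantCount, faceCount_pos_pos b 0 (fun t => TypeSpecializes (coinType m w) t), if_neg hb]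
  have hinj : Function.Injective fun j : ℕ => 2 * j := fun a b h => by
    simp only at h
    omega
  conv_rhs => rw [← Set.ncard_image_of_injective _ hinj]
  congr 1
  have key : ∀ x : ℝ, ∀ j ℓ : ℕ,
      SignSpecializes (SignType.sign x) (SignType.sign ((2 * ℓ + 1 : ℤ) - (2 * j : ℕ))) ↔
        (0 < x → j ≤ ℓ) ∧ (x < 0 → ℓ < j) := by
    intro x j ℓ
    rcases le_or_gt j ℓ with h | h
    · rw [sign_pos (show (0 : ℤ) < 2 * ℓ + 1 - (2 * j : ℕ) by push_cast; omega), signSpecializes_one]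
      simp [h, h.not_gt]
    · rw [sign_neg (show (2 * ℓ + 1 - (2 * j : ℕ) : ℤ) < 0 by push_cast; omega), signSpecializes_neg_one]
      simp [h, h.not_ge]
  have key' : ∀ j, TypeSpecializes (coinType m w) ((1, 1, b), signPattern m (2 * j)) ↔
      ∀ ℓ ≤ m, (0 < coinGap m w ℓ → j ≤ ℓ) ∧ (coinGap m w ℓ < 0 → ℓ < j) := by
    intro j
    simp only [TypeSpecializes, coinType, signPattern, key, signSpecializes_one, hu, ha, hs,
      true_and]
    exact ⟨fun h ℓ hℓ => h ⟨ℓ, Nat.lt_succ_iff.2 hℓ⟩, fun h ℓ => h ℓ (Nat.lt_succ_iff.1 ℓ.2)⟩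
  ext p
  constructor
  · rintro ⟨hp, hp2, ht⟩
    obtain ⟨j, rfl⟩ : ∃ j, p = 2 * j := ⟨p / 2, by omega⟩
    exact ⟨j, ⟨by omega, (key' _).1 ht⟩, rfl⟩
  · rintro ⟨j, ⟨hj, h⟩, rfl⟩
    exact ⟨by simpa using hj, by simp, (key' _).2 h⟩

/-- A zero at `i` can be resolved to either sign, so the sign change falls at `j = i + 1` or `j =
i`. -/
theorem ncard_compatible_of_signPattern {w : ℝ × ℝ × ℝ} {σ : SignType × SignType × SignType}
    {i : ℕ} (hi : 2 * i + 1 ≤ 2 * m) (h : coinType m w = (σ, signPattern m (2 * i + 1))) :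
    {j | j ≤ m ∧ ∀ ℓ ≤ m, (0 < coinGap m w ℓ → j ≤ ℓ) ∧
      (coinGap m w ℓ < 0 → ℓ < j)}.ncard = 2 := by
  have hg : ∀ ℓ ≤ m, SignType.sign (coinGap m w ℓ) =
      SignType.sign ((2 * ℓ + 1 : ℤ) - (2 * i + 1 : ℕ)) := fun ℓ hℓ =>
    congrFun (congrArg Prod.snd h) ⟨ℓ, Nat.lt_succ_iff.2 hℓ⟩
  have hpos : ∀ ℓ ≤ m, 0 < coinGap m w ℓ ↔ i < ℓ := fun ℓ hℓ => by
    rw [← sign_eq_one_iff, hg ℓ hℓ, sign_eq_one_iff]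
    omega
  have hneg : ∀ ℓ ≤ m, coinGap m w ℓ < 0 ↔ ℓ < i := fun ℓ hℓ => by
    rw [← sign_eq_neg_one_iff, hg ℓ hℓ, sign_eq_neg_one_iff]
    omega
  have : {j | j ≤ m ∧ ∀ ℓ ≤ m, (0 < coinGap m w ℓ → j ≤ ℓ) ∧ (coinGap m w ℓ < 0 → ℓ < j)} =
      {i, i + 1} := by
    ext j
    simp only [Set.mem_ofPred_eq, Set.mem_insert_iff, Set.mem_singleton_iff]
    constructor
    · rintro ⟨hj, h⟩
      have h1 := (h (i + 1) (by omega)).1 ((hpos _ (by omega)).2 (by omega))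
      by_contra hne
      have h2 := (h (i - 1) (by omega)).2 ((hneg _ (by omega)).2 (by omega))
      omega
    · intro hj
      refine ⟨by omega, fun ℓ hℓ => ?_⟩
      rw [hpos ℓ hℓ, hneg ℓ hℓ]
      omega
  rw [this, Set.ncard_pair (by omega)]

theorem quarterCount_pos_zero_zero {w : ℝ × ℝ × ℝ} (hu : 0 < w.1) (ha : w.2.1 = 0)
    (hb : w.2.2 = 0) : quarterCount m w = 2 := by
  have h1 : {j | j ≤ m ∧ ∀ ℓ ≤ m, (0 < coinGap m w ℓ → j ≤ ℓ) ∧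
      (coinGap m w ℓ < 0 → ℓ < j)} = {0} := by
    have hg : ∀ ℓ, coinGap m w ℓ = w.1 := fun ℓ => by simp [coinGap, ha, hb]
    ext j
    simp only [hg, hu, hu.not_gt, Set.mem_ofPred_eq, Set.mem_singleton_iff, forall_const,
      false_imp_iff, and_true]
    exact ⟨fun h => Nat.le_zero.1 (h.2 0 (Nat.zero_le m)), by rintro rfl; simp⟩
  rw [quarterCount, octantCount_eq_ncard (by decide) hu.le ha.ge (signSpecializes_one.2 hb.ge),
    octantCount_eq_ncard (by decide) hu.le ha.ge (signSpecializes_neg_one.2 hb.le), h1,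
    Set.ncard_singleton]

theorem ncard_polyVertices_pos_zero_zero (hm : 1 ≤ m) {w : ℝ × ℝ × ℝ} (hu : 0 < w.1)
    (ha : w.2.1 = 0) (hb : w.2.2 = 0) : (polyVertices (coinFace m w)).ncard = 4 := by
  rw [ncard_polyVertices_coinFace_eq hm, quarterCount_pos_zero_zero hu ha hb,
    quarterCount_pos_zero_zero (w := flipWeight w) hu (by simp [flipWeight, ha])
      (by simp [flipWeight, hb]),
    quarterCount_eq_zero (w := swapWeight w) (Or.inl (neg_lt_zero.2 hu)),
    quarterCount_eq_zero (w := flipWeight (swapWeight w)) (Or.inl (neg_lt_zero.2 hu))]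

theorem ncard_polyVertices_pos_pos_zero (hm : 1 ≤ m) {w : ℝ × ℝ × ℝ} (hu : 0 < w.1)
    (ha : 0 < w.2.1) (hb : w.2.2 = 0) (hd : coinDim m w = 2) :
    (polyVertices (coinFace m w)).ncard = 4 := by
  have hs : weightSigns w = (1, 1, 0) := by simp [weightSigns, hu, ha, hb]
  obtain ⟨p, hp, e⟩ := exists_coinType_eq (m := m) hs
  rw [coinDim_eq_of_coinType hp e, if_pos rfl] at hd
  obtain ⟨i, rfl⟩ : ∃ i, p = 2 * i + 1 := ⟨p / 2, by omega⟩
  have h1 := ncard_compatible_of_signPattern hp e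
  rw [ncard_polyVertices_coinFace_eq hm,
    quarterCount_eq_zero (w := flipWeight w) (Or.inr (neg_lt_zero.2 ha)),
    quarterCount_eq_zero (w := swapWeight w) (Or.inl (neg_lt_zero.2 hu)),
    quarterCount_eq_zero (w := flipWeight (swapWeight w)) (Or.inl (neg_lt_zero.2 hu)), quarterCount,
    octantCount_eq_ncard (by decide) hu.le ha.le (signSpecializes_one.2 hb.ge),
    octantCount_eq_ncard (by decide) hu.le ha.le (signSpecializes_neg_one.2 hb.le), h1]

theorem ncard_polyVertices_zero_pos_neg (hm : 1 ≤ m) {w : ℝ × ℝ × ℝ} (hu : w.1 = 0)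
    (ha : 0 < w.2.1) (hb : w.2.2 < 0) (hd : coinDim m w = 2) :
    (polyVertices (coinFace m w)).ncard = 4 := by
  have key : ∀ w : ℝ × ℝ × ℝ, w.1 = 0 → 0 < w.2.1 → w.2.2 < 0 → coinDim m w = 2 →
      quarterCount m w = 2 := by
    intro w hu ha hb hd
    have hs : weightSigns w = (0, 1, -1) := by simp [weightSigns, hu, ha, hb]
    obtain ⟨p, h2, hp, e⟩ := exists_coinType_eq_zero_pos_neg hm hs
    rw [coinDim_zero_pos_neg hp e] at hd
    obtain ⟨i, rfl⟩ : ∃ i, p = 2 * i + 1 := ⟨p / 2, by omega⟩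
    rw [quarterCount, octantCount_eq_zero_of_neg hb,
      octantCount_eq_ncard (by decide) hu.ge ha.le (signSpecializes_neg_one.2 hb.le),
      ncard_compatible_of_signPattern hp e]
  rw [ncard_polyVertices_coinFace_eq hm, key w hu ha hb hd,
    key (flipWeight (swapWeight w)) (by simp [flipWeight, swapWeight, hu])
      (by simpa [flipWeight, swapWeight] using hb) (by simpa [flipWeight, swapWeight] using ha)
      (by rw [coinDim_flipWeight, coinDim_swapWeight, hd]),
    quarterCount_eq_zero (w := flipWeight w) (Or.inr (neg_lt_zero.2 ha)),
    quarterCount_eq_zero (w := swapWeight w) (Or.inr hb)]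

/-- All gaps vanish, so every `j ≤ m` is admissible; this happens in the two octants with `a, b >
0`, one for each sign of `u`. -/
theorem ncard_polyVertices_zero_pos_pos (hm : 1 ≤ m) {w : ℝ × ℝ × ℝ} (hu : w.1 = 0)
    (ha : 0 < w.2.1) (hb : w.2.2 = w.2.1) :
    (polyVertices (coinFace m w)).ncard = 2 * (m + 1) := by
  have key : ∀ w : ℝ × ℝ × ℝ, w.1 = 0 → 0 < w.2.1 → w.2.2 = w.2.1 →
      quarterCount m w = m + 1 := by
    intro w hu ha hb
    have hg : ∀ ℓ, coinGap m w ℓ = 0 := fun ℓ => by simp [coinGap_eq, hu, hb]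
    have h1 : {j | j ≤ m ∧ ∀ ℓ ≤ m, (0 < coinGap m w ℓ → j ≤ ℓ) ∧
        (coinGap m w ℓ < 0 → ℓ < j)} = (Finset.range (m + 1) : Set ℕ) := by
      ext j
      simp [hg]
    have hb' : 0 < w.2.2 := hb ▸ ha
    rw [quarterCount, octantCount_eq_zero_of_pos hb',
      octantCount_eq_ncard (by decide) hu.ge ha.le (signSpecializes_one.2 hb'.le), h1,
      Set.ncard_coe_finset, Finset.card_range, add_zero]
  rw [ncard_polyVertices_coinFace_eq hm, key w hu ha hb,
    key (swapWeight w) (by simp [swapWeight, hu]) (by simpa [swapWeight, hb] using ha)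
      (by simp [swapWeight, hb]),
    quarterCount_eq_zero (w := flipWeight w) (Or.inr (neg_lt_zero.2 ha)),
    quarterCount_eq_zero (w := flipWeight (swapWeight w)) 
      (Or.inr (neg_lt_zero.2 (show 0 < w.2.2 by rw [hb]; exact ha)))]
  ring

/-- The gap `(ℓ - m) a` vanishes only at the last index. For `u > 0` this forces `j = m`, with
either sign of `b`: two vertices. For `u < 0` the swapped gap `(m - ℓ) a` forces `j = 0`: one
vertex. After a further flip the gap is `ℓ a`, leaving `j = 0` or `j = 1`: two vertices. The total
is five. -/
theorem ncard_polyVertices_zero_pos_zero (hm : 1 ≤ m) {w : ℝ × ℝ × ℝ} (hu : w.1 = 0)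
    (ha : 0 < w.2.1) (hb : w.2.2 = 0) : (polyVertices (coinFace m w)).ncard = 5 := by
  have hg : ∀ ℓ, coinGap m w ℓ = ((ℓ : ℝ) - m) * w.2.1 := fun ℓ => by
    rw [coinGap_eq, hu, hb, max_eq_left ha.le, max_self]
    ring
  have hneg : ∀ ℓ, coinGap m w ℓ < 0 ↔ ℓ < m := fun ℓ => by
    rw [hg, ← neg_pos, ← neg_mul, mul_pos_iff_of_pos_right ha, neg_pos, sub_neg, Nat.cast_lt]
  have hpos : ∀ ℓ, 0 < coinGap m w ℓ ↔ m < ℓ := fun ℓ => by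
    rw [hg, mul_pos_iff_of_pos_right ha, sub_pos, Nat.cast_lt]
  have h1 : quarterCount m w = 2 := by
    have : {j | j ≤ m ∧ ∀ ℓ ≤ m, (0 < coinGap m w ℓ → j ≤ ℓ) ∧
        (coinGap m w ℓ < 0 → ℓ < j)} = {m} := by
      ext j
      simp only [hneg, hpos, Set.mem_ofPred_eq, Set.mem_singleton_iff]
      constructor
      · rintro ⟨hj, h⟩
        have := (h (m - 1) (by omega)).2 (by omega)
        omega
      · rintro rfl
        exact ⟨le_rfl, fun ℓ hℓ => by omega⟩
    rw [quarterCount, octantCount_eq_ncard (by decide) hu.ge ha.le (signSpecializes_one.2 hb.ge),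
      octantCount_eq_ncard (by decide) hu.ge ha.le (signSpecializes_neg_one.2 hb.le), this,
      Set.ncard_singleton]
  have h2 : quarterCount m (swapWeight w) = 1 := by
    have : {j | j ≤ m ∧ ∀ ℓ ≤ m, (0 < coinGap m (swapWeight w) ℓ → j ≤ ℓ) ∧
        (coinGap m (swapWeight w) ℓ < 0 → ℓ < j)} = {0} := by
      ext j
      simp only [coinGap_swapWeight, neg_pos, neg_lt_zero, hneg, hpos, Set.mem_ofPred_eq,
        Set.mem_singleton_iff]
      constructor
      · rintro ⟨hj, h⟩
        exact Nat.le_zero.1 ((h 0 (by omega)).1 (by omega))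
      · rintro rfl
        exact ⟨Nat.zero_le _, fun ℓ hℓ => by omega⟩
    rw [quarterCount, octantCount_eq_zero_of_pos (w := swapWeight w) ha,
      octantCount_eq_ncard (by decide) (by simp [swapWeight, hu]) (by simp [swapWeight, hb])
        (signSpecializes_one.2 ha.le), this, Set.ncard_singleton]
  have h3 : quarterCount m (flipWeight (swapWeight w)) = 2 := by
    have : {j | j ≤ m ∧ ∀ ℓ ≤ m, (0 < coinGap m (flipWeight (swapWeight w)) ℓ → j ≤ ℓ) ∧
        (coinGap m (flipWeight (swapWeight w)) ℓ < 0 → ℓ < j)} = {0, 1} := by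
      ext j
      simp only [Set.mem_ofPred_eq, Set.mem_insert_iff, Set.mem_singleton_iff]
      constructor
      · rintro ⟨hj, h⟩
        have h1 := (h 1 hm).1
        rw [coinGap_flipWeight hm, coinGap_swapWeight, neg_pos, hneg] at h1
        have := h1 (by omega)
        omega
      · intro hj
        refine ⟨by omega, fun ℓ hℓ => ?_⟩
        rw [coinGap_flipWeight hℓ, coinGap_swapWeight, neg_pos, neg_lt_zero, hneg, hpos]
        omega
    have hneg' : (flipWeight (swapWeight w)).2.2 < 0 := neg_lt_zero.2 ha
    rw [quarterCount, octantCount_eq_zero_of_neg hneg',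
      octantCount_eq_ncard (by decide) (by simp [flipWeight, swapWeight, hu])
        (by simp [flipWeight, swapWeight, hb]) (signSpecializes_neg_one.2 hneg'.le), this,
      Set.ncard_pair (by decide)]
  rw [ncard_polyVertices_coinFace_eq hm, h1, h2, h3,
    quarterCount_eq_zero (w := flipWeight w) (Or.inr (neg_lt_zero.2 ha))]

/-- The signs of the normals of the pentagons. -/
def pentagonSigns : Finset (SignType × SignType × SignType) :=
  {(0, 1, 0), (0, -1, 0), (0, 0, 1), (0, 0, -1)}

/-- The signs of the normals of the `2(m+1)`-gons. -/
def largeFacetSigns : Finset (SignType × SignType × SignType) := {(0, 1, 1), (0, -1, -1)}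

theorem ncard_polyVertices_pentagon (hm : 1 ≤ m) {w : ℝ × ℝ × ℝ}
    (hw : weightSigns w ∈ pentagonSigns) : (polyVertices (coinFace m w)).ncard = 5 := by
  simp only [pentagonSigns, Finset.mem_insert, Finset.mem_singleton, weightSigns_eq_iff,
    sign_eq_zero_iff, sign_eq_one_iff, sign_eq_neg_one_iff] at hw
  rcases hw with ⟨hu, ha, hb⟩ | ⟨hu, ha, hb⟩ | ⟨hu, ha, hb⟩ | ⟨hu, ha, hb⟩
  · exact ncard_polyVertices_zero_pos_zero hm hu ha hb
  · rw [← ncard_polyVertices_flipWeight hm]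
    exact ncard_polyVertices_zero_pos_zero hm hu (neg_pos.2 ha) (neg_eq_zero.2 hb)
  · rw [← ncard_polyVertices_swapWeight hm]
    exact ncard_polyVertices_zero_pos_zero hm (neg_eq_zero.2 hu) hb ha
  · rw [← ncard_polyVertices_swapWeight hm, ← ncard_polyVertices_flipWeight hm]
    exact ncard_polyVertices_zero_pos_zero hm (neg_eq_zero.2 hu) (neg_pos.2 hb) (neg_eq_zero.2 ha)

theorem ncard_polyVertices_largeFacet (hm : 1 ≤ m) {w : ℝ × ℝ × ℝ}
    (hw : weightSigns w ∈ largeFacetSigns) (hd : coinDim m w = 2) :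
    (polyVertices (coinFace m w)).ncard = 2 * (m + 1) := by
  have key : ∀ w : ℝ × ℝ × ℝ, weightSigns w = (0, 1, 1) → coinDim m w = 2 →
      (polyVertices (coinFace m w)).ncard = 2 * (m + 1) := by
    intro w hw hd
    have he : w.2.1 = w.2.2 := by
      rw [coinDim_zero_pos_pos hw] at hd
      by_contra h
      simp [h] at hd
    simp only [weightSigns_eq_iff, sign_eq_zero_iff, sign_eq_one_iff] at hw
    exact ncard_polyVertices_zero_pos_pos hm hw.1 hw.2.1 he.symm
  simp only [largeFacetSigns, Finset.mem_insert, Finset.mem_singleton] at hw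
  rcases hw with hw | hw
  · exact key w hw hd
  · rw [← ncard_polyVertices_flipWeight hm]
    exact key _ ((weightSigns_flipWeight_eq_iff _ _ _ _).2 hw) (by rw [coinDim_flipWeight, hd])

/-- Up to symmetry the remaining facet normals have signs `(1, 0, 0)`, `(1, 1, 0)` or `(0, 1, -1)`.
In the last two cases exactly one gap vanishes. -/
theorem ncard_polyVertices_quadrilateral (hm : 1 ≤ m) {w : ℝ × ℝ × ℝ} (hd : coinDim m w = 2)
    (h5 : weightSigns w ∉ pentagonSigns) (h2 : weightSigns w ∉ largeFacetSigns) :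
    (polyVertices (coinFace m w)).ncard = 4 := by
  have hposu : ∀ w : ℝ × ℝ × ℝ, 0 < w.1 → coinDim m w = 2 →
      (polyVertices (coinFace m w)).ncard = 4 := by
    intro w hu hd
    by_cases ha : w.2.1 = 0
    · by_cases hb : w.2.2 = 0
      · exact ncard_polyVertices_pos_zero_zero hm hu ha hb
      · rw [coinDim, if_pos hu.ne', if_pos ha, if_neg hb, if_neg (c := ∃ ℓ ≤ m, coinGap m w ℓ = 0)
          (by rintro ⟨ℓ, hℓ, h⟩; exact (coinGap_pos_of_pos_zero hu ha hℓ).ne' h)] at hd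
        omega
    · have hb : w.2.2 = 0 := by
        by_contra hb
        rw [coinDim, if_pos hu.ne', if_neg ha, if_neg hb] at hd
        split_ifs at hd <;> omega
      rcases lt_or_gt_of_ne ha with ha | ha
      · rw [← ncard_polyVertices_flipWeight hm]
        exact ncard_polyVertices_pos_pos_zero hm hu (neg_pos.2 ha) (neg_eq_zero.2 hb)
          (by rw [coinDim_flipWeight, hd])
      · exact ncard_polyVertices_pos_pos_zero hm hu ha hb hd
  rcases lt_trichotomy w.1 0 with hu | hu | hu
  · rw [← ncard_polyVertices_swapWeight hm]
    exact hposu _ (neg_pos.2 hu) (by rw [coinDim_swapWeight, hd])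
  · simp only [pentagonSigns, largeFacetSigns, Finset.mem_insert, Finset.mem_singleton,
      weightSigns_eq_iff, sign_eq_zero_iff, sign_eq_one_iff, sign_eq_neg_one_iff, hu,
      true_and, not_or, not_and] at h5 h2
    obtain ⟨h51, h52, h53, h54⟩ := h5
    obtain ⟨h21, h22⟩ := h2
    rcases lt_trichotomy w.2.1 0 with ha | ha | ha
    · rcases lt_trichotomy w.2.2 0 with hb | hb | hb
      · exact absurd hb (h22 ha)
      · exact absurd hb (h52 ha)
      · rw [← ncard_polyVertices_flipWeight hm]
        exact ncard_polyVertices_zero_pos_neg hm hu (neg_pos.2 ha) (neg_lt_zero.2 hb)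
          (by rw [coinDim_flipWeight, hd])
    · rcases lt_trichotomy w.2.2 0 with hb | hb | hb
      · exact absurd hb (h54 ha)
      · simp [coinDim, hu, ha, hb] at hd
      · exact absurd hb (h53 ha)
    · rcases lt_trichotomy w.2.2 0 with hb | hb | hb
      · exact ncard_polyVertices_zero_pos_neg hm hu ha hb hd
      · exact absurd hb (h51 ha)
      · exact absurd hb (h21 ha)
  · exact hposu w hu hd

end Polygons

/-! ### Assembly: global counts, corners of the cube, types of facets. -/

section Main

variable {m : ℕ}

theorem coinFace_zero (m : ℕ) : coinFace m 0 = coinPolytope m := by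
  ext x
  simp [coinFace, coinFunctional, ContinuousLinearMap.toExposed]

theorem polyDim_coinPolytope (hm : 1 ≤ m) : polyDim (coinPolytope m) = 3 := by
  rw [← coinFace_zero, polyDim_coinFace_eq_coinDim hm]
  simp [coinDim]

theorem setOf_polyFaces_polyDim (hm : 1 ≤ m) (d : ℕ) :
    {F ∈ polyFaces (coinPolytope m) | polyDim F = d} = coinFace m '' {w | coinDim m w = d} := by
  rw [polyFaces_coinPolytope hm]
  ext F
  constructor
  · rintro ⟨⟨w, rfl⟩, h⟩
    exact ⟨w, by rwa [Set.mem_ofPred_eq, ← polyDim_coinFace_eq_coinDim hm], rfl⟩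
  · rintro ⟨w, hw, rfl⟩
    exact ⟨⟨w, rfl⟩, by rwa [polyDim_coinFace_eq_coinDim hm]⟩

theorem polyFacets_coinPolytope (hm : 1 ≤ m) :
    polyFacets (coinPolytope m) = coinFace m '' {w | coinDim m w = 2} := by
  rw [← setOf_polyFaces_polyDim hm, polyFacets, polyDim_coinPolytope hm]
  simp

theorem ncard_polyVertices_coinPolytope (hm : 1 ≤ m) :
    (polyVertices (coinPolytope m)).ncard = 8 * (m + 1) := by
  have := ncard_polyVertices_filter hm (fun _ => True) (fun _ => True) (fun _ _ _ _ => Iff.rfl)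
  simp only [and_true, Set.ofPred_mem_eq] at this
  rw [this, faceCount_coinDim, sum_signCount_zero hm]

theorem ncard_polyEdges_coinPolytope (hm : 1 ≤ m) :
    (polyEdges (coinPolytope m)).ncard = 14 * m + 12 := by
  rw [polyEdges, setOf_polyFaces_polyDim hm, ncard_image_coinFace hm, faceCount_coinDim,
    sum_signCount_one hm]

theorem ncard_polyFacets_coinPolytope (hm : 1 ≤ m) :
    (polyFacets (coinPolytope m)).ncard = 6 * (m + 1) := by
  rw [polyFacets_coinPolytope hm, ncard_image_coinFace hm, faceCount_coinDim, sum_signCount_two hm]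

/-! ### The cube -/

/-- Among directions with nonzero weights, those maximized at a given corner of the cube form one
open octant. -/
theorem exists_weight_isMaxEnd {i a b : ℝ} (hi : i ∈ ({0, 1} : Set ℝ)) (ha : a ∈ ({0, 1} : Set ℝ))
    (hb : b ∈ ({0, 1} : Set ℝ)) : ∃ σ : SignType × SignType × SignType,
      (σ.1 ≠ 0 ∧ σ.2.1 ≠ 0 ∧ σ.2.2 ≠ 0) ∧ ∀ w : ℝ × ℝ × ℝ, w.1 ≠ 0 → w.2.1 ≠ 0 → w.2.2 ≠ 0 →
        ((IsMaxEnd w.1 i ∧ IsMaxEnd w.2.1 a ∧ IsMaxEnd w.2.2 b) ↔ weightSigns w = σ) := by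
  have key : ∀ c ∈ ({0, 1} : Set ℝ), ∃ s : SignType, s ≠ 0 ∧
      ∀ x : ℝ, x ≠ 0 → (IsMaxEnd x c ↔ SignType.sign x = s) := by
    rintro c (rfl | rfl)
    · refine ⟨-1, by decide, fun x hx => ?_⟩
      rw [sign_eq_neg_one_iff, IsMaxEnd]
      simp [hx.le_iff_lt]
    · refine ⟨1, by decide, fun x hx => ?_⟩
      rw [sign_eq_one_iff, IsMaxEnd]
      simp [hx.symm.le_iff_lt]
  obtain ⟨s, hs, hs'⟩ := key i hi
  obtain ⟨t, ht, ht'⟩ := key a ha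
  obtain ⟨r, hr, hr'⟩ := key b hb
  refine ⟨(s, t, r), ⟨hs, ht, hr⟩, fun w h1 h2 h3 => ?_⟩
  rw [hs' _ h1, ht' _ h2, hr' _ h3, weightSigns_eq_iff]

theorem IsMaxEnd.eq_of_ne_zero {x c c' : ℝ} (hx : x ≠ 0) (h : IsMaxEnd x c) (h' : IsMaxEnd x c') :
    c = c' :=
  sub_eq_zero.1 ((isMaxEnd_sub h h').resolve_left hx)

theorem toExposed_boxPoints_eq_singleton (hm : 1 ≤ m) {l : StrongDual ℝ (Fin 6 → ℝ)} {i a b : ℝ}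
    (h1 : (coinWeight l).1 ≠ 0) (h2 : (coinWeight l).2.1 ≠ 0) (h3 : (coinWeight l).2.2 ≠ 0)
    (hi : IsMaxEnd (coinWeight l).1 i) (ha : IsMaxEnd (coinWeight l).2.1 a)
    (hb : IsMaxEnd (coinWeight l).2.2 b) :
    l.toExposed (boxPoints m) = {coinPoint m i (m * a) (m * b)} := by
  rw [toExposed_boxPoints m hm]
  ext x
  constructor
  · rintro ⟨i', a', b', hi', ha', hb', rfl⟩
    rw [hi.eq_of_ne_zero h1 hi', ha.eq_of_ne_zero h2 ha', hb.eq_of_ne_zero h3 hb']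
    rfl
  · rintro rfl
    exact ⟨i, a, b, hi, ha, hb, rfl⟩

theorem polyVertices_convexHull_boxPoints (hm : 1 ≤ m) :
    polyVertices (convexHull ℝ (boxPoints m)) = boxPoints m := by
  apply Set.Subset.antisymm
  · rw [polyVertices_convexHull (boxPoints_finite m)]
    exact extremePoints_convexHull_subset
  · rintro x ⟨i, hi, a, ha, b, hb, rfl⟩
    have key : ∀ c ∈ ({0, 1} : Set ℝ), 2 * c - 1 ≠ 0 ∧ IsMaxEnd (2 * c - 1) c := by
      rintro c (rfl | rfl) <;> norm_num [IsMaxEnd]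
    refine mem_polyFaces_iff.2 ⟨Set.singleton_nonempty _,
      coinFunctional (2 * i - 1, 2 * a - 1, 2 * b - 1), ?_⟩
    rw [toExposed_convexHull _ (boxPoints_finite m), toExposed_boxPoints_eq_singleton hm
      (i := i) (a := a) (b := b), convexHull_singleton] <;>
    · rw [coinWeight_coinFunctional]
      first
        | exact (key _ hi).1
        | exact (key _ ha).1
        | exact (key _ hb).1
        | exact (key _ hi).2
        | exact (key _ ha).2
        | exact (key _ hb).2

theorem ncard_boxPoints (hm : 1 ≤ m) : (boxPoints m).ncard = 8 := by
  have hm' : (m : ℝ) ≠ 0 := by positivity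
  have h : boxPoints m = (fun p : ℝ × ℝ × ℝ => coinPoint m p.1 (m * p.2.1) (m * p.2.2)) ''
      (({0, 1} : Set ℝ) ×ˢ ({0, 1} : Set ℝ) ×ˢ ({0, 1} : Set ℝ)) := by
    ext x
    constructor
    · rintro ⟨i, hi, a, ha, b, hb, rfl⟩
      exact ⟨(i, a, b), ⟨hi, ha, hb⟩, rfl⟩
    · rintro ⟨⟨i, a, b⟩, ⟨hi, ha, hb⟩, rfl⟩
      exact ⟨i, hi, a, ha, b, hb, rfl⟩
  rw [h, Set.ncard_image_of_injective, Set.ncard_prod, Set.ncard_prod, Set.ncard_pair zero_ne_one]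
  rintro ⟨i, a, b⟩ ⟨i', a', b'⟩ h
  obtain ⟨h1, h2, h3⟩ := coinPoint_inj.1 h
  simp only [mul_right_inj' hm'] at h2 h3
  simp only at h1
  rw [h1, h2, h3]

theorem isAffineCube_newtonPolytope_coinQ (hm : 1 ≤ m) : IsAffineCube (newtonPolytope (coinQ m)) :=
  ⟨boxMap m, boxMap_injective hm, by rw [boxMap_image_Icc, newtonPolytope_coinQ hm]⟩

/-- In any decomposition of the exposed vertex `u`, the box summand must itself maximize the
functional. All weights being nonzero, that maximizer is unique. -/
theorem mem_singleton_add_coinNumeratorSum_iff (hm : 1 ≤ m) {w : ℝ × ℝ × ℝ} {u : Fin 6 → ℝ}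
    {i a b : ℝ} (hv : coinPoint m i (m * a) (m * b) ∈ boxPoints m) (hd : coinDim m w = 0)
    (hu : coinFace m w = {u}) :
    u ∈ {coinPoint m i (m * a) (m * b)} + coinNumeratorSum m ↔
      IsMaxEnd w.1 i ∧ IsMaxEnd w.2.1 a ∧ IsMaxEnd w.2.2 b := by
  have hm' : (m : ℝ) ≠ 0 := by positivity
  obtain ⟨h1, h2, h3⟩ := ne_zero_of_coinDim_eq_zero hd
  obtain ⟨i₀, hi₀⟩ := exists_isMaxEnd w.1
  obtain ⟨a₀, ha₀⟩ := exists_isMaxEnd w.2.1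
  obtain ⟨b₀, hb₀⟩ := exists_isMaxEnd w.2.2
  have hbox : (coinFunctional w).toExposed (convexHull ℝ (boxPoints m)) =
      {coinPoint m i₀ (m * a₀) (m * b₀)} := by
    rw [toExposed_convexHull _ (boxPoints_finite m), toExposed_boxPoints_eq_singleton hm,
      convexHull_singleton] <;> rwa [coinWeight_coinFunctional]
  have hface : coinFace m w = {coinPoint m i₀ (m * a₀) (m * b₀)} +
      (coinFunctional w).toExposed (coinNumeratorSum m) := by
    rw [coinFace, coinPolytope_eq hm, toExposed_add, hbox, coinNumeratorSum_eq hm]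
  constructor
  · rintro ⟨_, rfl, n, hn, rfl⟩
    have hmem : coinPoint m i (m * a) (m * b) + n ∈ coinFace m w := hu ▸ rfl
    have hv' : coinPoint m i (m * a) (m * b) ∈
        (coinFunctional w).toExposed (convexHull ℝ (boxPoints m)) := by
      refine ⟨subset_convexHull ℝ _ hv, fun y hy => ?_⟩
      -- Replacing the box summand by any other `y` stays in the polytope, so it cannot increase the
      -- functional.
      have := hmem.2 (y + n) (by
        rw [coinPolytope_eq hm, ← coinNumeratorSum_eq hm]
        exact Set.add_mem_add hy hn)
      simpa using this
    rw [hbox, Set.mem_singleton_iff, coinPoint_inj, mul_right_inj' hm', mul_right_inj' hm'] at hv'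
    obtain ⟨rfl, rfl, rfl⟩ := hv'
    exact ⟨hi₀, ha₀, hb₀⟩
  · rintro ⟨hi, ha, hb⟩
    obtain ⟨_, rfl, n, hn, e⟩ : u ∈ {coinPoint m i₀ (m * a₀) (m * b₀)} +
      (coinFunctional w).toExposed (coinNumeratorSum m) := by
        rw [← hface, hu]
        rfl
    rw [hi₀.eq_of_ne_zero h1 hi, ha₀.eq_of_ne_zero h2 ha, hb₀.eq_of_ne_zero h3 hb] at e
    exact ⟨_, rfl, n, hn.1, e⟩

theorem signCount_octant {σ : SignType × SignType × SignType}
    (hσ : σ.1 ≠ 0 ∧ σ.2.1 ≠ 0 ∧ σ.2.2 ≠ 0) : signCount m σ 0 = m + 1 := by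
  have key : ∀ s : SignType, s ≠ 0 → s = 1 ∨ s = -1 := by decide
  have h1 := signCount_pos_pos_of_ne (m := m) (show (1 : SignType) ≠ 0 by decide) 0
  have h2 := signCount_pos_pos_of_ne (m := m) (show (-1 : SignType) ≠ 0 by decide) 0
  obtain ⟨a, b, c⟩ := σ
  rcases key a hσ.1 with rfl | rfl <;> rcases key b hσ.2.1 with rfl | rfl <;>
    rcases key c hσ.2.2 with rfl | rfl <;>
    simp [signCount_neg, signCount_neg_mid, h1, h2]

theorem ncard_polyVertices_over_box (hm : 1 ≤ m) {v : Fin 6 → ℝ} (hv : v ∈ boxPoints m) :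
    {u ∈ polyVertices (coinPolytope m) | u ∈ {v} + coinNumeratorSum m}.ncard = m + 1 := by
  obtain ⟨i, hi, a, ha, b, hb, rfl⟩ := id hv
  obtain ⟨σ, hσ, h⟩ := exists_weight_isMaxEnd hi ha hb
  rw [ncard_polyVertices_filter hm _ (fun w => weightSigns w = σ), ← signCount_octant (m := m) hσ,
    signCount]
  · simp only [and_comm]
  · intro w u hd hu
    obtain ⟨h1, h2, h3⟩ := ne_zero_of_coinDim_eq_zero hd
    rw [mem_singleton_add_coinNumeratorSum_iff hm hv hd hu, h w h1 h2 h3]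

/-! ### The facets -/

/-- The facets whose normals have signs in `T`. -/
def facetsOfSigns (m : ℕ) (T : Finset (SignType × SignType × SignType)) :
    Set (Set (Fin 6 → ℝ)) := coinFace m '' {w | weightSigns w ∈ T ∧ coinDim m w = 2}

theorem facetsOfSigns_subset (hm : 1 ≤ m) (T : Finset (SignType × SignType × SignType)) :
    facetsOfSigns m T ⊆ polyFacets (coinPolytope m) := by
  rw [polyFacets_coinPolytope hm]
  exact Set.image_mono fun w hw => hw.2

theorem coinFace_mem_facetsOfSigns_iff (hm : 1 ≤ m) {T : Finset (SignType × SignType × SignType)}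
    {w : ℝ × ℝ × ℝ} (hd : coinDim m w = 2) :
    coinFace m w ∈ facetsOfSigns m T ↔ weightSigns w ∈ T := by
  constructor
  · rintro ⟨w', ⟨h, -⟩, e⟩
    have : weightSigns w' = weightSigns w := congrArg Prod.fst ((coinFace_eq_iff hm _ _).1 e)
    rwa [← this]
  · exact fun h => ⟨w, ⟨h, hd⟩, rfl⟩

theorem ncard_facetsOfSigns (hm : 1 ≤ m) (T : Finset (SignType × SignType × SignType)) :
    (facetsOfSigns m T).ncard = ∑ σ ∈ T, signCount m σ 2 := by
  rw [facetsOfSigns, ncard_image_coinFace hm, faceCount_eq_sum m _ T fun w hw => hw.1]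
  refine Finset.sum_congr rfl fun σ hσ => ?_
  rw [signCount]
  congr 1
  ext w
  simp only [Set.mem_ofPred_eq]
  exact ⟨fun h => ⟨h.1, h.2.2⟩, fun h => ⟨h.1, h.1 ▸ hσ, h.2⟩⟩

theorem ncard_facetsOfSigns_pentagonSigns (hm : 1 ≤ m) :
    (facetsOfSigns m pentagonSigns).ncard = 4 := by
  rw [ncard_facetsOfSigns hm, pentagonSigns, Finset.sum_insert (by decide),
    Finset.sum_insert (by decide), Finset.sum_insert (by decide), Finset.sum_singleton,
    signCount_neg_mid, signCount_zero_zero_neg, signCount_zero_zero_pos, neg_zero,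
    signCount_zero_pos_zero]
  simp

theorem ncard_facetsOfSigns_largeFacetSigns (hm : 1 ≤ m) :
    (facetsOfSigns m largeFacetSigns).ncard = 2 := by
  rw [ncard_facetsOfSigns hm, largeFacetSigns, Finset.sum_insert (by decide), Finset.sum_singleton,
    signCount_neg_mid, neg_neg, signCount_zero_pos_pos_two]

theorem isConvexPolygon_coinFace (hm : 1 ≤ m) {w : ℝ × ℝ × ℝ} (hd : coinDim m w = 2) {k : ℕ}
    (hk : (polyVertices (coinFace m w)).ncard = k) : IsConvexPolygon k (coinFace m w) :=
  ⟨exists_finite_coinFace_eq_convexHull hm w, (polyDim_coinFace_eq_coinDim hm w).trans hd, hk⟩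

/-- The classes are separated by the signs of the normals, not by vertex numbers: for `m = 1` the
`2(m + 1)`-gons are themselves quadrilaterals. -/
theorem disjoint_facetsOfSigns (hm : 1 ≤ m) :
    Disjoint (facetsOfSigns m pentagonSigns) (facetsOfSigns m largeFacetSigns) := by
  rw [Set.disjoint_left]
  rintro _ ⟨w, ⟨h, hd⟩, rfl⟩ h'
  rw [coinFace_mem_facetsOfSigns_iff hm hd] at h'
  have : Disjoint pentagonSigns largeFacetSigns := by decide
  exact Finset.disjoint_left.1 this h h'

end Main

theorem mainTheorem4 (m : ℕ) (hm : 1 ≤ m) :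
    polyDim (coinPolytope m) = 3 ∧
    (polyVertices (coinPolytope m)).ncard = 8 * (m + 1) ∧
    (polyEdges (coinPolytope m)).ncard = 14 * m + 12 ∧
    (polyFacets (coinPolytope m)).ncard = 6 * (m + 1) ∧
    -- `N(Q)` is a cube, and each of its eight vertices is a summand of `m + 1` vertices
    IsAffineCube (newtonPolytope (coinQ m)) ∧
    (polyVertices (newtonPolytope (coinQ m))).ncard = 8 ∧
    (∀ v ∈ polyVertices (newtonPolytope (coinQ m)),
      {u ∈ polyVertices (coinPolytope m) | u ∈ {v} + coinNumeratorSum m}.ncard = m + 1) ∧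
    -- the facets: `A` holds the four pentagons, `B` the two `2(m+1)`-gons
    ∃ A B : Set (Set (Fin 6 → ℝ)),
      A ⊆ polyFacets (coinPolytope m) ∧ B ⊆ polyFacets (coinPolytope m) ∧ Disjoint A B ∧
      A.ncard = 4 ∧ B.ncard = 2 ∧
      (∀ F ∈ A, IsConvexPolygon 5 F) ∧
      (∀ F ∈ B, IsConvexPolygon (2 * (m + 1)) F) ∧
      (∀ F ∈ polyFacets (coinPolytope m) \ (A ∪ B), IsConvexPolygon 4 F) := by
  refine ⟨polyDim_coinPolytope hm, ncard_polyVertices_coinPolytope hm,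
    ncard_polyEdges_coinPolytope hm, ncard_polyFacets_coinPolytope hm,
    isAffineCube_newtonPolytope_coinQ hm, ?_, ?_, facetsOfSigns m pentagonSigns,
    facetsOfSigns m largeFacetSigns, facetsOfSigns_subset hm _, facetsOfSigns_subset hm _,
    disjoint_facetsOfSigns hm, ncard_facetsOfSigns_pentagonSigns hm,
    ncard_facetsOfSigns_largeFacetSigns hm, ?_, ?_, ?_⟩
  · rw [newtonPolytope_coinQ hm, polyVertices_convexHull_boxPoints hm, ncard_boxPoints hm]
  · rw [newtonPolytope_coinQ hm, polyVertices_convexHull_boxPoints hm]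
    exact fun v hv => ncard_polyVertices_over_box hm hv
  · rintro _ ⟨w, ⟨h, hd⟩, rfl⟩
    exact isConvexPolygon_coinFace hm hd (ncard_polyVertices_pentagon hm h)
  · rintro _ ⟨w, ⟨h, hd⟩, rfl⟩
    exact isConvexPolygon_coinFace hm hd (ncard_polyVertices_largeFacet hm h hd)
  · rw [polyFacets_coinPolytope hm]
    rintro _ ⟨⟨w, hd, rfl⟩, hnot⟩
    rw [Set.mem_union, coinFace_mem_facetsOfSigns_iff hm hd, coinFace_mem_facetsOfSigns_iff hm hd,
      not_or] at hnot
    exact isConvexPolygon_coinFace hm hd (ncard_polyVertices_quadrilateral hm hd hnot.1 hnot.2)
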